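/- Fix $k\ge 1$ and $\gamma>0$. Let $\Theta$ be the set of positive definite $k\times k$ matrices, viewed as a subset of $\mathbb R^d$, $d=k(k+1)/2$, via the upper triangle, with the Euclidean norm of $\mathbb R^d$; all gradients and Hessians in $\theta$ are in these coordinates. For $\theta\in\Theta$ let $P_\theta=P_\theta^{(n)}$ be the law of $X=(X_1,\dots,X_n)$ with $X_i$ i.i.d. multivariate t, $X_i\sim t_\gamma(0,\theta^{-1})$, with density $$f(x;\theta)=\prod_{i=1}^n c_{k,\gamma}\det(\theta)^{1/2}(\gamma+x_i^\top\theta x_i)^{-(\gamma+k)/2}$$ with respect to Lebesgue measure on $(\mathbb R^k)^n$, where $c_{k,\gamma}$ is the normalizing constant. Let $\mathcal L(\theta;x)=-\log f(x;\theta)$ (no regularization), $\mathcal L(\theta;x,w)=\mathcal L(\theta;x)+\sigma_n w^\top\theta$, $W\sim N(0,\frac1d I_d)$ independent of $X$, where $\sigma_n>0$ and $\sigma_n=O(\sqrt n)$. A point $\theta$ is a strict second-order stationary point (SSOSP) of $\mathcal L(\cdot;x,w)$ if $\nabla_\theta\mathcal L(\theta;x,w)=0$ and $\nabla^2_\theta\mathcal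 L(\theta;x,w)\succ0$. Initial estimator: put $$T_{jj'}=\binom n2^{-1}\sum_{i<i'}\mathrm{sign}\big((x_{ij}-x_{i'j})(x_{ij'}-x_{i'j'})\big),\qquad S_{jj'}=\sin(\tfrac\pi2T_{jj'}),$$ $$V_j=\Big(\frac{\mathrm{Median}(|x_{1j}|,\dots,|x_{nj}|)}{q}\Big)^2,\qquad \Sigma_{jj'}=S_{jj'}\sqrt{V_jV_{j'}},$$ where $q$ is the $0.75$-quantile of the univariate $t_\gamma$ distribution, and let $\hat\theta_{\rm init}(x)=\Sigma(x)^{-1}$ (set to $0$ if $\Sigma(x)$ is singular). Let $\rho_n>0$ be any sequence with $\rho_n\to0$ and $\sqrt{\log n/n}=o(\rho_n)$ (for example $\rho_n=n^{-1/4}$ for $n\ge1$). An estimator $\hat\theta=\hat\theta_n:(\mathbb R^k)^n\times\mathbb R^d\to\Theta$ is called admissible if, for all $(x,w)$ such that the closed ball $B=\mathbb B(\hat\theta_{\rm init}(x),\rho_n)$ lies in $\Theta$, $\hat\theta(x,w)$ is a first-order stationary point of the minimization of $\mathcal L(\cdot;x,w)$ over $B$, i.e. $\hat\theta(x,w)\in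 B$ and $\langle\nabla_\theta\mathcal L(\hat\theta(x,w);x,w),\theta'-\hat\theta(x,w)\rangle\ge0$ for all $\theta'\in B$ (for other $(x,w)$, $\hat\theta(x,w)\in\Theta$ is arbitrary). Then there are functions $r_n>0$ and $\delta_n,\varepsilon_n\ge0$ on $\Theta$ such that, for each fixed $\theta_0\in\Theta$, as $n\to\infty$, $r_n(\theta_0)=\tilde O(n^{-1/2})$, $\delta_n(\theta_0)=O(n^{-1})$ and $\varepsilon_n(\theta_0)=\tilde O(n^{-1/2})$ (where $\tilde O$ means up to powers of $\log n$), and such that for every $n$ the following hold. 1. (Assumption 1) $\Theta$ is convex and open, each $P_\theta$ is a probability measure with density $f(\cdot;\theta)>0$ with respect to Lebesgue measure, and $\theta\mapsto\mathcal L(\theta;x)$ is $C^2$ on $\Theta$ for each $x$. 2. (Assumption 2) For every admissible $\hat\theta$ and every $\theta_0\in\Theta$, under $(X,W)\sim P_{\theta_0}\times N(0,\frac1dI_d)$, with probability at least $1-\delta_n(\theta_0)$ we have $\|\hat\theta(X,W)-\theta_0\|\le r_n(\theta_0)$ and $\hat\theta(X,W)$ is a SSOSP of $\mathcal L(\cdot;X,W)$.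 (If $\hat\theta$ is not measurable: the exceptional set has outer measure at most $\delta_n(\theta_0)$.) 3. (Assumption 3) Let $H(\theta;x)=-\nabla_\theta^2\log f(x;\theta)$. For every $\theta_0\in\Theta$, the expectation $H(\theta)=\mathbb E_{\theta_0}[H(\theta;X)]$ exists for all $\theta\in\mathbb B(\theta_0,r_n(\theta_0))\cap\Theta$, and $$\mathbb E_{\theta_0}\Big[\sup_{\theta\in\mathbb B(\theta_0,r_n(\theta_0))\cap\Theta}r_n(\theta_0)^2\big(\lambda_{\max}(H(\theta)-H(\theta;X))\big)_+\Big]\le\varepsilon_n(\theta_0),$$ $$\mathbb E_{\theta_0}\Big[\exp\Big\{\sup_{\theta\in\mathbb B(\theta_0,r_n(\theta_0))\cap\Theta}r_n(\theta_0)^2\big(\lambda_{\max}(H(\theta;X)-H(\theta))\big)_+\Big\}\Big]\le e^{\varepsilon_n(\theta_0)}.$$ -/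

import Mathlib

open MeasureTheory ProbabilityTheory Filter Asymptotics
open scoped Topology ENNReal NNReal Matrix

noncomputable section

namespace ACSS

/-! ### Generic framework: a parametric family on `𝒳`, with parameter set `Θ ⊆ ℝ^ι` -/

/-- The matrix of second partial derivatives of `g` at `t`. -/
def hessian {ι : Type*} [Fintype ι] [DecidableEq ι] (g : EuclideanSpace ℝ ι → ℝ)
    (t : EuclideanSpace ℝ ι) : Matrix ι ι ℝ :=
  Matrix.of fun i j =>
    fderiv ℝ (fun s => fderiv ℝ g s (EuclideanSpace.single j 1)) t (EuclideanSpace.single i 1)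

/-- The penalized negative log-likelihood `L(θ; x) = - log f(x; θ) + R(θ)`. -/
def penalizedNLL {𝒳 ι : Type*} (f : 𝒳 → EuclideanSpace ℝ ι → ℝ) (R : EuclideanSpace ℝ ι → ℝ)
    (x : 𝒳) (θ : EuclideanSpace ℝ ι) : ℝ :=
  -Real.log (f x θ) + R θ

/-- The perturbed objective `L(θ; x, w) = L(θ; x) + σ wᵀθ`. -/
def perturbedNLL {𝒳 ι : Type*} [Fintype ι] (f : 𝒳 → EuclideanSpace ℝ ι → ℝ)
    (R : EuclideanSpace ℝ ι → ℝ) (σ : ℝ) (x : 𝒳) (w θ : EuclideanSpace ℝ ι) : ℝ :=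
  penalizedNLL f R x θ + σ * inner ℝ w θ

/-- `θ` is a strict second-order stationary point of `g`. -/
def IsSSOSP {ι : Type*} [Fintype ι] [DecidableEq ι] (g : EuclideanSpace ℝ ι → ℝ)
    (θ : EuclideanSpace ℝ ι) : Prop :=
  gradient g θ = 0 ∧ (hessian g θ).PosDef

/-- `θ` is a first-order stationary point of the minimization of `g` over the convex set `C`. -/
def IsConstrainedFOSP {ι : Type*} [Fintype ι] (g : EuclideanSpace ℝ ι → ℝ)
    (C : Set (EuclideanSpace ℝ ι)) (θ : EuclideanSpace ℝ ι) : Prop :=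
  θ ∈ C ∧ ∀ θ' ∈ C, 0 ≤ inner ℝ (gradient g θ) (θ' - θ)

/-- The law `N(0, (1/d) I_d)` on `ℝ^d`, where `d = card ι`. -/
def noise (ι : Type*) [Fintype ι] : Measure (EuclideanSpace ℝ ι) :=
  (Measure.pi fun _ : ι => gaussianReal 0 ((Fintype.card ι : ℝ≥0)⁻¹)).map (WithLp.toLp 2)

/-- The largest eigenvalue (used for real symmetric matrices only). -/
def lamMax {ι : Type*} [Fintype ι] [DecidableEq ι] (A : Matrix ι ι ℝ) : ℝ :=
  sSup (spectrum ℝ A)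

/-- The observed information `H(θ; x) = - ∇²_θ log f(x; θ)`. -/
def obsInfo {𝒳 ι : Type*} [Fintype ι] [DecidableEq ι] (f : 𝒳 → EuclideanSpace ℝ ι → ℝ)
    (θ : EuclideanSpace ℝ ι) (x : 𝒳) : Matrix ι ι ℝ :=
  hessian (fun t => -Real.log (f x t)) θ

/-- The expected information `H(θ) = E[H(θ; X)]` for `X ∼ μ`. -/
def expInfo {𝒳 ι : Type*} [MeasurableSpace 𝒳] [Fintype ι] [DecidableEq ι] (μ : Measure 𝒳)
    (f : 𝒳 → EuclideanSpace ℝ ι → ℝ) (θ : EuclideanSpace ℝ ι) : Matrix ι ι ℝ :=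
  Matrix.of fun i j => ∫ x, obsInfo f θ x i j ∂μ

/-- Regularity conditions. -/
structure RegularityConditions {𝒳 ι : Type*} [MeasurableSpace 𝒳] [Fintype ι] (ν : Measure 𝒳)
    (Θ : Set (EuclideanSpace ℝ ι)) (P : EuclideanSpace ℝ ι → Measure 𝒳)
    (f : 𝒳 → EuclideanSpace ℝ ι → ℝ) (R : EuclideanSpace ℝ ι → ℝ) : Prop where
  convex : Convex ℝ Θ
  isOpen : IsOpen Θ
  isProbabilityMeasure : ∀ θ ∈ Θ, IsProbabilityMeasure (P θ)
  density_pos : ∀ θ ∈ Θ, ∀ x, 0 < f x θ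
  density_measurable : ∀ θ ∈ Θ, Measurable fun x => f x θ
  eq_withDensity : ∀ θ ∈ Θ, P θ = ν.withDensity fun x => ENNReal.ofReal (f x θ)
  contDiffOn : ∀ x, ContDiffOn ℝ 2 (penalizedNLL f R x) Θ

/-- The estimator condition: for every `θ₀ ∈ Θ`, under
`(X, W) ∼ P_{θ₀} × N(0, (1/d) I_d)`, with probability at least `1 - δ(θ₀)`, the estimator is within
`r(θ₀)` of `θ₀` and is a SSOSP. It is written as a bound on the (outer) measure of the complement,
which is the same for a measurable estimator and stronger in general. -/
def EstimatorCondition {𝒳 ι : Type*} [MeasurableSpace 𝒳] [Fintype ι] [DecidableEq ι]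
    (Θ : Set (EuclideanSpace ℝ ι)) (P : EuclideanSpace ℝ ι → Measure 𝒳)
    (f : 𝒳 → EuclideanSpace ℝ ι → ℝ) (R : EuclideanSpace ℝ ι → ℝ) (σ : ℝ)
    (θhat : 𝒳 → EuclideanSpace ℝ ι → EuclideanSpace ℝ ι)
    (r δ : EuclideanSpace ℝ ι → ℝ) : Prop :=
  ∀ θ₀ ∈ Θ,
    ((P θ₀).prod (noise ι)) {p : 𝒳 × EuclideanSpace ℝ ι |
      ¬ (‖θhat p.1 p.2 - θ₀‖ ≤ r θ₀ ∧
          IsSSOSP (perturbedNLL f R σ p.1 p.2) (θhat p.1 p.2))} ≤ ENNReal.ofReal (δ θ₀)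

/-- `sup_{θ ∈ B(θ₀, r) ∩ Θ} r² (λ_max(D θ))_+`, with values in `[0, ∞]`. -/
def supDeviation {ι : Type*} [Fintype ι] [DecidableEq ι] (Θ : Set (EuclideanSpace ℝ ι))
    (θ₀ : EuclideanSpace ℝ ι) (r : ℝ) (D : EuclideanSpace ℝ ι → Matrix ι ι ℝ) : ℝ≥0∞ :=
  ⨆ θ ∈ Metric.closedBall θ₀ r ∩ Θ, ENNReal.ofReal (r ^ 2 * max (lamMax (D θ)) 0)

/-- The Hessian conditions. -/
structure HessianCondition {𝒳 ι : Type*} [MeasurableSpace 𝒳] [Fintype ι] [DecidableEq ι]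
    (Θ : Set (EuclideanSpace ℝ ι)) (P : EuclideanSpace ℝ ι → Measure 𝒳)
    (f : 𝒳 → EuclideanSpace ℝ ι → ℝ) (r ε : EuclideanSpace ℝ ι → ℝ) : Prop where
  expectation_exists : ∀ θ₀ ∈ Θ, ∀ θ ∈ Metric.closedBall θ₀ (r θ₀) ∩ Θ, ∀ i j,
    Integrable (fun x => obsInfo f θ x i j) (P θ₀)
  lower : ∀ θ₀ ∈ Θ,
    ∫⁻ x, supDeviation Θ θ₀ (r θ₀) (fun θ => expInfo (P θ₀) f θ - obsInfo f θ x) ∂(P θ₀)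
      ≤ ENNReal.ofReal (ε θ₀)
  upper : ∀ θ₀ ∈ Θ,
    ∫⁻ x, EReal.exp
        (supDeviation Θ θ₀ (r θ₀) (fun θ => obsInfo f θ x - expInfo (P θ₀) f θ)) ∂(P θ₀)
      ≤ ENNReal.ofReal (Real.exp (ε θ₀))

/-- `u = Õ(v)`: `u = O(v)` up to a power of `log n`. -/
def IsSoftO (u v : ℕ → ℝ) : Prop :=
  ∃ p : ℕ, u =O[atTop] fun n => v n * Real.log n ^ p

/-! ### The multivariate t model -/

/-- Positions in the upper triangle of a `k × k` matrix. -/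
abbrev UpperTri (k : ℕ) : Type := {p : Fin k × Fin k // p.1 ≤ p.2}

/-- The symmetric matrix with upper triangle `v`. -/
def symMat {k : ℕ} (v : EuclideanSpace ℝ (UpperTri k)) : Matrix (Fin k) (Fin k) ℝ :=
  Matrix.of fun i j => v ⟨(min i j, max i j), min_le_max⟩

/-- The upper triangle of a matrix. -/
def upperTri {k : ℕ} (M : Matrix (Fin k) (Fin k) ℝ) : EuclideanSpace ℝ (UpperTri k) :=
  WithLp.toLp 2 fun p => M p.1.1 p.1.2

/-- The parameter space: upper triangles of positive definite `k × k` matrices. -/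
def posDefParams (k : ℕ) : Set (EuclideanSpace ℝ (UpperTri k)) :=
  {v | (symMat v).PosDef}

/-- The normalizing constant `c_{k,γ}` of the `k`-dimensional t density. -/
def tConst (k : ℕ) (γ : ℝ) : ℝ :=
  (∫ z : Fin k → ℝ, (γ + z ⬝ᵥ z) ^ (-((γ + k) / 2)))⁻¹

/-- The density of `t_γ(0, A⁻¹)` on `ℝ^k`. -/
def tDensity {k : ℕ} (γ : ℝ) (A : Matrix (Fin k) (Fin k) ℝ) (z : Fin k → ℝ) : ℝ :=
  tConst k γ * √A.det * (γ + z ⬝ᵥ (A *ᵥ z)) ^ (-((γ + k) / 2))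

/-- The centred multivariate t distribution `t_γ(0, A⁻¹)` with precision matrix `A`. -/
def multivariateT {k : ℕ} (γ : ℝ) (A : Matrix (Fin k) (Fin k) ℝ) : Measure (Fin k → ℝ) :=
  volume.withDensity fun z => ENNReal.ofReal (tDensity γ A z)

/-- The law of `n` i.i.d. draws from `t_γ(0, θ⁻¹)`. -/
def sampleLaw {k : ℕ} (γ : ℝ) (n : ℕ) (θ : EuclideanSpace ℝ (UpperTri k)) :
    Measure (Fin n → Fin k → ℝ) :=
  Measure.pi fun _ => multivariateT γ (symMat θ)

/-- The joint density of `n` i.i.d. draws from `t_γ(0, θ⁻¹)`. -/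
def sampleDensity {k : ℕ} (γ : ℝ) (n : ℕ) (x : Fin n → Fin k → ℝ)
    (θ : EuclideanSpace ℝ (UpperTri k)) : ℝ :=
  ∏ i, tDensity γ (symMat θ) (x i)

/-! ### The initial estimator -/

/-- The `p`-quantile of the univariate t distribution with `γ` degrees of freedom. -/
def tQuantile (γ p : ℝ) : ℝ :=
  sInf {t : ℝ | p ≤ (multivariateT γ (1 : Matrix (Fin 1) (Fin 1) ℝ)).real {z | z 0 ≤ t}}

/-- The sample median: the midpoint of the smallest and the largest median of `y₁, …, y_n`, i.e.
the middle order statistic for odd `n` and the average of the two middle ones for even `n`. -/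
def sampleMedian {n : ℕ} (y : Fin n → ℝ) : ℝ :=
  (sInf {t : ℝ | n ≤ 2 * (Finset.univ.filter fun i => y i ≤ t).card} +
    sSup {t : ℝ | n ≤ 2 * (Finset.univ.filter fun i => t ≤ y i).card}) / 2

/-- Kendall's tau between the coordinates `j` and `j'` of the sample. -/
def kendallTau {k n : ℕ} (x : Fin n → Fin k → ℝ) (j j' : Fin k) : ℝ :=
  (n.choose 2 : ℝ)⁻¹ * ∑ p : Fin n × Fin n with p.1 < p.2,
    Real.sign ((x p.1 j - x p.2 j) * (x p.1 j' - x p.2 j'))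

/-- The estimate `V_j` of `(θ⁻¹)_{jj}`: the square of the ratio of the median of
`|x_{1j}|, …, |x_{nj}|` to the `0.75`-quantile of the univariate t distribution. -/
def scaleEst {k n : ℕ} (γ : ℝ) (x : Fin n → Fin k → ℝ) (j : Fin k) : ℝ :=
  (sampleMedian (fun i => |x i j|) / tQuantile γ (3 / 4)) ^ 2

/-- `Σ(x)_{jj'} = sin(π T_{jj'} / 2) √(V_j V_{j'})`. -/
def covEst {k n : ℕ} (γ : ℝ) (x : Fin n → Fin k → ℝ) : Matrix (Fin k) (Fin k) ℝ :=
  Matrix.of fun j j' =>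
    Real.sin (Real.pi / 2 * kendallTau x j j') * √(scaleEst γ x j * scaleEst γ x j')

/-- The initial estimator: the upper triangle of `Σ(x)⁻¹` (and `0` if `Σ(x)` is singular). -/
def initEst {k n : ℕ} (γ : ℝ) (x : Fin n → Fin k → ℝ) : EuclideanSpace ℝ (UpperTri k) :=
  upperTri (covEst γ x)⁻¹

/-- `θhat` is an estimator with values in the parameter space that maps `(x, w)` to a first-order
stationary point of the (unpenalized) perturbed negative log-likelihood over the closed ball of
radius `ρ` around the initial estimate, whenever this ball lies in the parameter space. -/
def IsLocalEstimator {k : ℕ} (γ : ℝ) (n : ℕ) (σ ρ : ℝ)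
    (θhat : (Fin n → Fin k → ℝ) → EuclideanSpace ℝ (UpperTri k) →
      EuclideanSpace ℝ (UpperTri k)) : Prop :=
  ∀ x w, θhat x w ∈ posDefParams k ∧
    (Metric.closedBall (initEst γ x) ρ ⊆ posDefParams k →
      IsConstrainedFOSP (perturbedNLL (sampleDensity γ n) (fun _ => 0) σ x w)
        (Metric.closedBall (initEst γ x) ρ) (θhat x w))

end ACSS

end

/-! The quadratic form `xᵀθx` is linear in `θ`: it equals `⟪θ, φ(x)⟫` with `φ = quadFeature`. With
`a = (γ + k) / 2`, the negative log-likelihood is therefore `a ∑ log(γ + ⟪θ, φ(xᵢ)⟫) - (n/2) log det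
θ` up to a constant, and the data enter its derivatives only through the normalized feature `y_θ(x)
= φ(x) / (γ + ⟪θ, φ(x)⟫)`. Positive definiteness bounds `y_θ(x)` uniformly in `x` and locally
uniformly in `θ` (`exists_local_bound`, `norm_normFeature_le`). So the heavy tails play no role:
score and Hessian are sums of bounded i.i.d. terms, Hoeffding controls them at `θ₀` on the scale
`√(n log n)`, and a deterministic Lipschitz bound carries this to nearby `θ`.

Information. Since the density integrates to one, `log det` is, up to an additive constant, `-2`
times the logarithm of a parametric integral. Differentiating twice (`score_mean_and_information`)
shows that the score is centred and that the expected information per observation is `a² Var⟪v,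
y_θ⟫` in the direction `v`. If this variance vanishes, continuity and full support give `⟪v, φ⟫ = 0`
everywhere, hence `v = 0` (`exists_information_lower_bound`).

Initial estimator. The t law is a linear image of a spherical law. Averaging over rotations of a
plane shows that `sin(π/2 · τ)` is the correlation, and each coordinate is a scaled univariate t
variable. Kendall's tau concentrates as a U-statistic, the medians by Hoeffding for counts, and the
map from these statistics to the precision matrix is differentiable at the truth
(`initEst_concentration`).

Estimator. Testing the variational inequality at `θ₀` and using strong monotonicity of the gradient
(`exists_strong_monotonicity`) bounds `n c ‖θ - θ₀‖²` by the score at `θ₀` plus the perturbation, so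
`‖θ - θ₀‖` is of order `√(log n / n)`. Since this is `o(ρ)`, as is the initial error, the point is
interior to the ball. Its gradient then vanishes, and the Hessian near `θ₀` is positive definite.

Hessian condition. In `H(θ; X) - H(θ)` the `log det` part cancels. Over a ball of radius `r` of
order `√(log n / n)`, the deviation times `r²` is `O(log^{3/2} n / √n)` on a good event and always
`O(log n)`. The exponential of the latter is a power of `n`, which a sufficiently small Hoeffding
tail absorbs (`exists_hessian_error`). -/

namespace ACSS

/-! ### The quadratic form as a linear function of the parameter -/

/-- The vector `φ(x)` with `xᵀ θ x = ⟪θ, φ(x)⟫`. -/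
noncomputable def quadFeature {k : ℕ} (x : Fin k → ℝ) : EuclideanSpace ℝ (UpperTri k) :=
  WithLp.toLp 2 fun p =>
    if p.1.1 = p.1.2 then x p.1.1 * x p.1.2 else 2 * (x p.1.1 * x p.1.2)

/-- Each off-diagonal position stands for two entries of a symmetric array; this is the source of
the factor 2 in `quadFeature`. -/
lemma sum_pairs_eq_sum_upperTri {k : ℕ} (g : Fin k → Fin k → ℝ) (hg : ∀ i j, g i j = g j i) :
    ∑ i, ∑ j, g i j =
      ∑ p : UpperTri k, if p.1.1 = p.1.2 then g p.1.1 p.1.2 else 2 * g p.1.1 p.1.2 := by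
  have h1 : ∑ i, ∑ j, g i j = ∑ p : Fin k × Fin k, g p.1 p.2 :=
    (Fintype.sum_prod_type (fun p : Fin k × Fin k => g p.1 p.2)).symm
  have h2 : ∑ p : UpperTri k, (if p.1.1 = p.1.2 then g p.1.1 p.1.2 else 2 * g p.1.1 p.1.2) =
      ∑ p : Fin k × Fin k with p.1 ≤ p.2,
        (if p.1 = p.2 then g p.1 p.2 else 2 * g p.1 p.2) := by
    rw [Finset.sum_subtype (p := fun p : Fin k × Fin k => p.1 ≤ p.2)]
    simp
  rw [h1, h2, ← Finset.sum_filter_add_sum_filter_not Finset.univ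
    (fun p : Fin k × Fin k => p.1 ≤ p.2)]
  have h3 : ∑ p : Fin k × Fin k with ¬ p.1 ≤ p.2, g p.1 p.2 =
      ∑ p : Fin k × Fin k with p.1 ≤ p.2, if p.1 = p.2 then 0 else g p.1 p.2 := by
    rw [← Finset.sum_filter_add_sum_filter_not
      (Finset.univ.filter fun p : Fin k × Fin k => p.1 ≤ p.2) (fun p => p.1 = p.2)
      (fun p => if p.1 = p.2 then 0 else g p.1 p.2)]
    rw [Finset.sum_eq_zero (s := Finset.filter _ (Finset.filter _ _))
      (by intro p hp; simp only [Finset.mem_filter] at hp; simp [hp.2]), zero_add]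
    refine Finset.sum_nbij' Prod.swap Prod.swap ?_ ?_ (by simp) (by simp) ?_
    · intro p hp
      simp only [Finset.mem_filter, Finset.mem_univ, true_and, Prod.fst_swap, Prod.snd_swap] at *
      omega
    · intro p hp
      simp only [Finset.mem_filter, Finset.mem_univ, true_and, Prod.fst_swap, Prod.snd_swap] at *
      omega
    · intro p hp
      simp only [Finset.mem_filter, Finset.mem_univ, true_and, Prod.fst_swap, Prod.snd_swap] at *
      rw [if_neg (by omega), hg]
  rw [h3, ← Finset.sum_add_distrib]
  refine Finset.sum_congr rfl fun p _ => ?_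
  split_ifs <;> ring

lemma dotProduct_symMat_mulVec {k : ℕ} (v : EuclideanSpace ℝ (UpperTri k)) (x : Fin k → ℝ) :
    x ⬝ᵥ (symMat v *ᵥ x) = inner ℝ v (quadFeature x) := by
  have h : x ⬝ᵥ (symMat v *ᵥ x) =
      ∑ i, ∑ j, v ⟨(min i j, max i j), min_le_max⟩ * (x i * x j) := by
    simp only [dotProduct, Matrix.mulVec, symMat, Matrix.of_apply, Finset.mul_sum]
    refine Finset.sum_congr rfl fun i _ => Finset.sum_congr rfl fun j _ => by ring
  rw [h, sum_pairs_eq_sum_upperTri]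
  · rw [PiLp.inner_apply]
    refine Finset.sum_congr rfl fun p _ => ?_
    obtain ⟨⟨i, j⟩, hij⟩ := p
    have hij' : i ≤ j := hij
    simp only [quadFeature, min_eq_left hij', max_eq_right hij']
    simp only [RCLike.inner_apply, conj_trivial]
    split_ifs <;> ring
  · intro i j
    simp only [min_comm i j, max_comm i j, mul_comm (x i)]

lemma symMat_isHermitian {k : ℕ} (v : EuclideanSpace ℝ (UpperTri k)) :
    (symMat v).IsHermitian := by
  ext i j
  simp only [Matrix.conjTranspose_apply, symMat, Matrix.of_apply, star_trivial,
    min_comm i j, max_comm i j]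

lemma upperTri_symMat {k : ℕ} (v : EuclideanSpace ℝ (UpperTri k)) : upperTri (symMat v) = v := by
  ext p
  obtain ⟨⟨i, j⟩, hij⟩ := p
  have hij' : i ≤ j := hij
  simp [symMat, upperTri, min_eq_left hij', max_eq_right hij']

lemma mem_posDefParams_iff {k : ℕ} (v : EuclideanSpace ℝ (UpperTri k)) :
    v ∈ posDefParams k ↔ ∀ x : Fin k → ℝ, x ≠ 0 → 0 < inner ℝ v (quadFeature x) := by
  simp only [posDefParams, Set.mem_ofPred_eq, Matrix.posDef_iff_dotProduct_mulVec, star_trivial,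
    dotProduct_symMat_mulVec]
  exact ⟨fun h x hx => h.2 hx, fun h => ⟨symMat_isHermitian v, fun x hx => h x hx⟩⟩

lemma quadFeature_zero {k : ℕ} : quadFeature (0 : Fin k → ℝ) = 0 := by
  ext p; simp [quadFeature]

lemma quadFeature_smul {k : ℕ} (c : ℝ) (x : Fin k → ℝ) :
    quadFeature (c • x) = c ^ 2 • quadFeature x := by
  ext p
  simp only [quadFeature, Pi.smul_apply, smul_eq_mul, PiLp.smul_apply]
  split_ifs <;> ring

lemma continuous_quadFeature {k : ℕ} : Continuous (quadFeature (k := k)) := by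
  unfold quadFeature
  refine (PiLp.continuous_toLp 2 _).comp (continuous_pi fun p => ?_)
  split_ifs <;> fun_prop

lemma inner_quadFeature_nonneg {k : ℕ} {θ : EuclideanSpace ℝ (UpperTri k)}
    (hθ : θ ∈ posDefParams k) (x : Fin k → ℝ) : 0 ≤ inner ℝ θ (quadFeature x) := by
  rcases eq_or_ne x 0 with rfl | hx
  · simp [quadFeature_zero]
  · exact ((mem_posDefParams_iff θ).1 hθ x hx).le

/-- Polarization: the basis vectors detect the diagonal, and their pairwise sums then detect the
off-diagonal entries. This is the identifiability that makes the information nondegenerate. -/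
lemma eq_zero_of_inner_quadFeature_eq_zero {k : ℕ} {v : EuclideanSpace ℝ (UpperTri k)}
    (h : ∀ x, inner ℝ v (quadFeature x) = 0) : v = 0 := by
  have hdiag : ∀ i : Fin k, symMat v i i = 0 := fun i => by
    have := h (Pi.single i 1)
    rw [← dotProduct_symMat_mulVec] at this
    simpa using this
  have hM : symMat v = 0 := by
    ext i j
    have := h (Pi.single i 1 + Pi.single j 1)
    rw [← dotProduct_symMat_mulVec] at this
    have hs := (symMat_isHermitian v).apply i j
    simp only [star_trivial] at hs
    simp [Matrix.mulVec_add, add_dotProduct, hdiag, hs] at this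
    simpa using this
  rw [← upperTri_symMat v, hM]
  ext p
  simp [upperTri]

/-- The feature is dominated by the quadratic form. -/
lemma exists_norm_quadFeature_le {k : ℕ} {θ : EuclideanSpace ℝ (UpperTri k)}
    (hθ : θ ∈ posDefParams k) :
    ∃ C > 0, ∀ x : Fin k → ℝ, ‖quadFeature x‖ ≤ C * inner ℝ θ (quadFeature x) := by
  -- Both sides are homogeneous of degree two in `x`, so it suffices to bound their ratio on the
  -- compact unit sphere.
  have hcomp : IsCompact (Metric.sphere (0 : Fin k → ℝ) 1) := isCompact_sphere 0 1
  have hcont : ContinuousOn (fun x : Fin k → ℝ => ‖quadFeature x‖ / inner ℝ θ (quadFeature x))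
      (Metric.sphere (0 : Fin k → ℝ) 1) := by
    refine ContinuousOn.div continuous_quadFeature.norm.continuousOn
      (continuous_const.inner continuous_quadFeature).continuousOn fun x hx => ?_
    refine ((mem_posDefParams_iff θ).1 hθ x ?_).ne'
    rintro rfl
    simp at hx
  obtain ⟨C, hC⟩ := hcomp.bddAbove_image hcont
  refine ⟨max C 1, by positivity, fun x => ?_⟩
  rcases eq_or_ne x 0 with rfl | hx
  · simp [quadFeature_zero]
  have hxn : 0 < ‖x‖ := norm_pos_iff.2 hx
  set u : Fin k → ℝ := ‖x‖⁻¹ • x with hu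
  have hus : u ∈ Metric.sphere (0 : Fin k → ℝ) 1 := by
    simp [hu, norm_smul, hxn.ne']
  have hxu : x = ‖x‖ • u := by rw [hu, smul_smul, mul_inv_cancel₀ hxn.ne', one_smul]
  have hu0 : u ≠ 0 := by rintro h; simp [h] at hus
  have hpos := (mem_posDefParams_iff θ).1 hθ u hu0
  have h1 : ‖quadFeature u‖ ≤ max C 1 * inner ℝ θ (quadFeature u) := by
    rw [← div_le_iff₀ hpos]
    exact (hC ⟨u, hus, rfl⟩).trans (le_max_left _ _)
  rw [hxu, quadFeature_smul, norm_smul, inner_smul_right, Real.norm_of_nonneg (by positivity)]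
  nlinarith [sq_nonneg ‖x‖]

/-- Locally uniform domination of the feature, in terms of `γ + xᵀ θ x`. -/
lemma exists_local_bound {k : ℕ} {θ₀ : EuclideanSpace ℝ (UpperTri k)}
    (hθ₀ : θ₀ ∈ posDefParams k) :
    ∃ C > 0, ∃ r₀ > 0, Metric.closedBall θ₀ r₀ ⊆ posDefParams k ∧ C * r₀ ≤ 1 ∧
      ∀ θ ∈ Metric.closedBall θ₀ r₀, ∀ x : Fin k → ℝ,
        ‖quadFeature x‖ ≤ C * inner ℝ θ (quadFeature x) := by
  obtain ⟨C, hC, h⟩ := exists_norm_quadFeature_le hθ₀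
  -- On this radius the form changes by at most `‖φ(x)‖ / (2C)`, so half of `‖φ(x)‖` is absorbed and
  -- the constant only doubles. The same inequality shows that the ball stays in the cone.
  have key : ∀ θ ∈ Metric.closedBall θ₀ (1 / (2 * C)), ∀ x : Fin k → ℝ,
      ‖quadFeature x‖ ≤ 2 * C * inner ℝ θ (quadFeature x) := by
    intro θ hθ x
    have h1 : |inner ℝ (θ - θ₀) (quadFeature x)| ≤ 1 / (2 * C) * ‖quadFeature x‖ := by
      refine (abs_real_inner_le_norm _ _).trans ?_
      rw [mem_closedBall_iff_norm] at hθ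
      gcongr
    rw [inner_sub_left] at h1
    have h2 := (abs_le.1 h1).1
    have h3 := h x
    have h4 : 2 * C * (1 / (2 * C) * ‖quadFeature x‖) = ‖quadFeature x‖ := by field_simp
    nlinarith
  refine ⟨2 * C, by positivity, 1 / (2 * C), by positivity, fun θ hθ => ?_, ?_, key⟩
  · rw [mem_posDefParams_iff]
    intro x hx
    have h0 := (mem_posDefParams_iff θ₀).1 hθ₀ x hx
    have h1 : 0 < ‖quadFeature x‖ := by
      rw [norm_pos_iff]; intro h2; simp [h2] at h0
    have := key θ hθ x
    by_contra hneg
    nlinarith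
  · field_simp; rfl

lemma isOpen_posDefParams (k : ℕ) : IsOpen (posDefParams k) := by
  rw [Metric.isOpen_iff]
  intro θ hθ
  obtain ⟨C, _, r, hr, h, _⟩ := exists_local_bound hθ
  exact ⟨r, hr, Metric.ball_subset_closedBall.trans h⟩

lemma convex_posDefParams (k : ℕ) : Convex ℝ (posDefParams k) := by
  intro u hu v hv a b ha hb hab
  rw [mem_posDefParams_iff] at *
  intro x hx
  rw [inner_add_left, real_inner_smul_left, real_inner_smul_left]
  have h1 := hu x hx
  have h2 := hv x hx
  rcases ha.eq_or_lt with rfl | ha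
  · have : b = 1 := by linarith
    subst this; linarith
  · have := mul_pos ha h1
    have := mul_nonneg hb h2.le
    linarith

/-! ### The multivariate t law -/

/-- Comparison with `(1 + ‖x‖²)` to the power `-(γ + k)/2`, integrable since `γ + k > k`. The shift
`g` is independent of `γ` because the marginal computation needs `g = γ + s²` together with a
different number of degrees of freedom. -/
lemma integrable_tKernel (k : ℕ) {g γ : ℝ} (hg : 0 < g) (hγ : 0 < γ) :
    Integrable (fun z : Fin k → ℝ => (g + z ⬝ᵥ z) ^ (-((γ + k) / 2))) := by
  have h1 : Integrable (fun x : EuclideanSpace ℝ (Fin k) =>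
      (g + ‖x‖ ^ 2) ^ (-((γ + k) / 2))) := by
    have h0 := integrable_rpow_neg_one_add_norm_sq (E := EuclideanSpace ℝ (Fin k))
      (μ := volume) (r := γ + k) (by simp [hγ])
    refine (h0.const_mul ((min g 1) ^ (-((γ + k) / 2)))).mono' ?_ (Eventually.of_forall fun x => ?_)
    · exact Measurable.aestronglyMeasurable (by fun_prop)
    · have hm : 0 < min g 1 := lt_min hg one_pos
      rw [Real.norm_of_nonneg (by positivity), neg_div,
        ← Real.mul_rpow hm.le (by positivity)]
      refine Real.rpow_le_rpow_of_nonpos (by positivity) ?_ ?_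
      · have := min_le_left g 1
        have := min_le_right g 1
        nlinarith [sq_nonneg ‖x‖]
      · have : (0 : ℝ) ≤ γ + k := by positivity
        linarith
  have h2 := (PiLp.volume_preserving_toLp (Fin k)).integrable_comp_of_integrable h1
  refine h2.congr (Eventually.of_forall fun z => ?_)
  simp [EuclideanSpace.norm_sq_eq, dotProduct, ← sq]

lemma dotProduct_self_nonneg' {k : ℕ} (z : Fin k → ℝ) : 0 ≤ z ⬝ᵥ z :=
  Finset.sum_nonneg fun i _ => mul_self_nonneg (z i)

lemma tConst_pos (k : ℕ) {γ : ℝ} (hγ : 0 < γ) : 0 < tConst k γ := by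
  have hpos : ∀ z : Fin k → ℝ, 0 < (γ + z ⬝ᵥ z) ^ (-((γ + k) / 2)) := fun z =>
    Real.rpow_pos_of_pos (by have := dotProduct_self_nonneg' z; linarith) _
  refine inv_pos.2 ((integral_pos_iff_support_of_nonneg (fun z => (hpos z).le)
    (integrable_tKernel k hγ hγ)).2 ?_)
  have : Function.support (fun z : Fin k → ℝ => (γ + z ⬝ᵥ z) ^ (-((γ + k) / 2))) = Set.univ := by
    ext z; simp [(hpos z).ne']
  rw [this]
  exact Measure.measure_univ_pos.2 (NeZero.ne _)

lemma continuous_tDensity {k : ℕ} {γ : ℝ} (hγ : 0 < γ) {A : Matrix (Fin k) (Fin k) ℝ}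
    (hA : A.PosSemidef) : Continuous (tDensity γ A) := by
  unfold tDensity
  refine continuous_const.mul (Continuous.rpow_const ?_ fun z => Or.inl ?_)
  · simp only [dotProduct, Matrix.mulVec]
    fun_prop
  · have := hA.dotProduct_mulVec_nonneg z
    simp only [star_trivial] at this
    positivity

lemma tDensity_pos {k : ℕ} {γ : ℝ} (hγ : 0 < γ) {A : Matrix (Fin k) (Fin k) ℝ}
    (hA : A.PosDef) (z : Fin k → ℝ) : 0 < tDensity γ A z := by
  have := hA.posSemidef.dotProduct_mulVec_nonneg z
  simp only [star_trivial] at this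
  exact mul_pos (mul_pos (tConst_pos k hγ) (Real.sqrt_pos.2 hA.det_pos))
    (Real.rpow_pos_of_pos (by positivity) _)

lemma isProbabilityMeasure_multivariateT_one (k : ℕ) {γ : ℝ} (hγ : 0 < γ) :
    IsProbabilityMeasure (multivariateT γ (1 : Matrix (Fin k) (Fin k) ℝ)) := by
  constructor
  have hint : Integrable (tDensity γ (1 : Matrix (Fin k) (Fin k) ℝ)) := by
    refine ((integrable_tKernel k hγ hγ).const_mul (tConst k γ)).congr
      (Eventually.of_forall fun z => ?_)
    simp [tDensity]
  rw [multivariateT, withDensity_apply _ MeasurableSet.univ, Measure.restrict_univ,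
    ← ofReal_integral_eq_lintegral_ofReal hint
      (Eventually.of_forall fun z => (tDensity_pos hγ Matrix.PosDef.one z).le)]
  have : ∫ z, tDensity γ (1 : Matrix (Fin k) (Fin k) ℝ) z = 1 := by
    have h1 := tConst_pos k hγ
    simp only [tDensity, Matrix.det_one, Real.sqrt_one, mul_one, Matrix.one_mulVec]
    rw [integral_const_mul]
    unfold tConst at *
    exact inv_mul_cancel₀ (inv_pos.1 h1).ne'
  simp [this]

/-- `t_γ(0, (BᵀB)⁻¹)` is the law of `B⁻¹ Z` with `Z ∼ t_γ(0, I)`. -/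
lemma multivariateT_transpose_mul_self {k : ℕ} {γ : ℝ} (hγ : 0 < γ)
    {B : Matrix (Fin k) (Fin k) ℝ} (hB : B.det ≠ 0) :
    multivariateT γ (Bᵀ * B) =
      (multivariateT γ (1 : Matrix (Fin k) (Fin k) ℝ)).map (fun z => B⁻¹ *ᵥ z) := by
  have hunit : IsUnit B.det := isUnit_iff_ne_zero.2 hB
  have hdet : (B⁻¹).det ≠ 0 := by
    rw [Matrix.det_nonsing_inv, Ring.inverse_eq_inv']; exact inv_ne_zero hB
  have hmeas : Measurable (fun z : Fin k → ℝ => B⁻¹ *ᵥ z) :=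
    (Matrix.toLin' B⁻¹).continuous_of_finiteDimensional.measurable
  have hmap : Measure.map (fun z : Fin k → ℝ => B⁻¹ *ᵥ z) volume =
      ENNReal.ofReal |B.det| • volume := by
    have := Real.map_matrix_volume_pi_eq_smul_volume_pi hdet
    rw [Matrix.det_nonsing_inv, Ring.inverse_eq_inv', inv_inv] at this
    exact this
  have hcont1 : Measurable (tDensity γ (1 : Matrix (Fin k) (Fin k) ℝ)) :=
    (continuous_tDensity hγ Matrix.PosSemidef.one).measurable
  ext s hs
  rw [Measure.map_apply hmeas hs, multivariateT, multivariateT,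
    withDensity_apply _ (hmeas hs), withDensity_apply _ hs]
  have hfun : ∀ z : Fin k → ℝ, ENNReal.ofReal (tDensity γ (Bᵀ * B) z) =
      ENNReal.ofReal |B.det| * ENNReal.ofReal (tDensity γ 1 (B *ᵥ z)) := by
    intro z
    rw [← ENNReal.ofReal_mul (abs_nonneg _)]
    congr 1
    have h1 : √(Bᵀ * B).det = |B.det| := by
      rw [Matrix.det_mul, Matrix.det_transpose, Real.sqrt_mul_self_eq_abs]
    have h2 : z ⬝ᵥ ((Bᵀ * B) *ᵥ z) = (B *ᵥ z) ⬝ᵥ (B *ᵥ z) := by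
      rw [← Matrix.mulVec_mulVec, Matrix.dotProduct_mulVec, Matrix.vecMul_transpose]
    simp only [tDensity, h1, h2, Matrix.one_mulVec, Matrix.det_one, Real.sqrt_one]
    ring
  have hB1 : Measurable (fun z : Fin k → ℝ => B *ᵥ z) :=
    (Matrix.toLin' B).continuous_of_finiteDimensional.measurable
  simp only [hfun]
  have hinv : ∀ z : Fin k → ℝ, B *ᵥ (B⁻¹ *ᵥ z) = z := fun z => by
    rw [Matrix.mulVec_mulVec, Matrix.mul_nonsing_inv _ hunit, Matrix.one_mulVec]
  have hm2 : Measurable fun z : Fin k → ℝ => ENNReal.ofReal (tDensity γ 1 (B *ᵥ z)) :=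
    (hcont1.comp hB1).ennreal_ofReal
  calc ∫⁻ z in s, ENNReal.ofReal |B.det| * ENNReal.ofReal (tDensity γ 1 (B *ᵥ z))
      = ∫⁻ z in s, ENNReal.ofReal (tDensity γ 1 (B *ᵥ z)) ∂(ENNReal.ofReal |B.det| • volume) := by
        rw [lintegral_const_mul _ hm2, Measure.restrict_smul, lintegral_smul_measure, smul_eq_mul]
    _ = ∫⁻ z in (fun z => B⁻¹ *ᵥ z) ⁻¹' s,
          ENNReal.ofReal (tDensity γ 1 (B *ᵥ (B⁻¹ *ᵥ z))) := by
        rw [← hmap, setLIntegral_map hs hm2 hmeas]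
    _ = _ := by simp only [hinv]

open scoped MatrixOrder in
lemma exists_transpose_mul_self {k : ℕ} {A : Matrix (Fin k) (Fin k) ℝ} (hA : A.PosDef) :
    ∃ B : Matrix (Fin k) (Fin k) ℝ, B.det ≠ 0 ∧ A = Bᵀ * B := by
  obtain ⟨B, hB⟩ := CStarAlgebra.nonneg_iff_eq_star_mul_self.mp hA.posSemidef.nonneg
  rw [Matrix.star_eq_conjTranspose, Matrix.conjTranspose_eq_transpose_of_trivial] at hB
  refine ⟨B, ?_, hB⟩
  have := hA.det_pos
  rw [hB, Matrix.det_mul] at this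
  intro h
  simp [h] at this

lemma isProbabilityMeasure_multivariateT {k : ℕ} {γ : ℝ} (hγ : 0 < γ)
    {A : Matrix (Fin k) (Fin k) ℝ} (hA : A.PosDef) :
    IsProbabilityMeasure (multivariateT γ A) := by
  obtain ⟨B, hB, rfl⟩ := exists_transpose_mul_self hA
  rw [multivariateT_transpose_mul_self hγ hB]
  have := isProbabilityMeasure_multivariateT_one k hγ
  exact Measure.isProbabilityMeasure_map
    (Matrix.toLin' B⁻¹).continuous_of_finiteDimensional.measurable.aemeasurable

/-- A finite product of measures with an integrable density has the product density. -/
lemma pi_withDensity_ofReal {ι E : Type*} [Fintype ι] [MeasurableSpace E] (μ : Measure E)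
    [SigmaFinite μ] {g : E → ℝ} (hg : ∀ x, 0 ≤ g x) (hgi : Integrable g μ) :
    Measure.pi (fun _ : ι => μ.withDensity fun x => ENNReal.ofReal (g x)) =
      (Measure.pi fun _ : ι => μ).withDensity fun x => ENNReal.ofReal (∏ i, g (x i)) := by
  have hfin : IsFiniteMeasure (μ.withDensity fun x => ENNReal.ofReal (g x)) :=
    isFiniteMeasure_withDensity_ofReal hgi.2
  refine Measure.pi_eq fun s hs => ?_
  have hi : ∀ i, Integrable g (μ.restrict (s i)) := fun i => hgi.restrict
  rw [withDensity_apply _ (MeasurableSet.univ_pi hs), Measure.restrict_pi_pi,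
    ← ofReal_integral_eq_lintegral_ofReal (Integrable.fintype_prod hi)
      (Eventually.of_forall fun x => Finset.prod_nonneg fun i _ => hg _),
    integral_fintype_prod_eq_prod (fun _ => g),
    ENNReal.ofReal_prod_of_nonneg fun i _ => integral_nonneg hg]
  refine Finset.prod_congr rfl fun i _ => ?_
  rw [withDensity_apply _ (hs i), ofReal_integral_eq_lintegral_ofReal (hi i)
    (Eventually.of_forall hg)]

lemma integrable_tDensity {k : ℕ} {γ : ℝ} (hγ : 0 < γ) {A : Matrix (Fin k) (Fin k) ℝ}
    (hA : A.PosDef) : Integrable (tDensity γ A) := by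
  refine ⟨(continuous_tDensity hγ hA.posSemidef).aestronglyMeasurable, ?_⟩
  have := isProbabilityMeasure_multivariateT hγ hA
  rw [hasFiniteIntegral_iff_ofReal (Eventually.of_forall fun z => (tDensity_pos hγ hA z).le),
    ← setLIntegral_univ, ← withDensity_apply _ MeasurableSet.univ]
  exact measure_lt_top (multivariateT γ A) _

lemma sampleLaw_eq_withDensity {k : ℕ} {γ : ℝ} (hγ : 0 < γ) (n : ℕ)
    {θ : EuclideanSpace ℝ (UpperTri k)} (hθ : θ ∈ posDefParams k) :
    sampleLaw γ n θ = volume.withDensity fun x => ENNReal.ofReal (sampleDensity γ n x θ) := by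
  unfold sampleLaw multivariateT sampleDensity
  rw [pi_withDensity_ofReal volume (fun z => (tDensity_pos hγ hθ z).le) (integrable_tDensity hγ hθ)]
  rfl

lemma isProbabilityMeasure_sampleLaw {k : ℕ} {γ : ℝ} (hγ : 0 < γ) (n : ℕ)
    {θ : EuclideanSpace ℝ (UpperTri k)} (hθ : θ ∈ posDefParams k) :
    IsProbabilityMeasure (sampleLaw γ n θ) := by
  have := isProbabilityMeasure_multivariateT hγ hθ
  unfold sampleLaw
  infer_instance

lemma sampleDensity_pos {k : ℕ} {γ : ℝ} (hγ : 0 < γ) {n : ℕ} (x : Fin n → Fin k → ℝ)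
    {θ : EuclideanSpace ℝ (UpperTri k)} (hθ : θ ∈ posDefParams k) : 0 < sampleDensity γ n x θ :=
  Finset.prod_pos fun _ _ => tDensity_pos hγ hθ _

/-! ### The negative log-likelihood and its derivatives -/

/-- `θ ↦ log det θ`. -/
noncomputable def logDet {k : ℕ} (θ : EuclideanSpace ℝ (UpperTri k)) : ℝ :=
  Real.log (symMat θ).det

lemma contDiffOn_logDet (k : ℕ) : ContDiffOn ℝ 2 (logDet (k := k)) (posDefParams k) := by
  refine ContDiffOn.log ?_ fun θ hθ => (Matrix.PosDef.det_pos hθ).ne'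
  refine ContDiff.contDiffOn ?_
  simp only [Matrix.det_apply, symMat, Matrix.of_apply]
  refine ContDiff.sum fun τ _ => ContDiff.const_smul _ (contDiff_prod fun i _ => ?_)
  exact contDiff_piLp_apply 2

/-- The negative log-likelihood, in terms of the features of the observations. -/
noncomputable def tNLL {k : ℕ} (γ : ℝ) (n : ℕ) (x : Fin n → Fin k → ℝ)
    (θ : EuclideanSpace ℝ (UpperTri k)) : ℝ :=
  ((γ + k) / 2) * (∑ i, Real.log (γ + inner ℝ θ (quadFeature (x i)))) - n / 2 * logDet θ -
    n * Real.log (tConst k γ)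

lemma neg_log_sampleDensity {k : ℕ} {γ : ℝ} (hγ : 0 < γ) {n : ℕ} (x : Fin n → Fin k → ℝ)
    {θ : EuclideanSpace ℝ (UpperTri k)} (hθ : θ ∈ posDefParams k) :
    -Real.log (sampleDensity γ n x θ) = tNLL γ n x θ := by
  have h : ∀ z : Fin k → ℝ, Real.log (tDensity γ (symMat θ) z) = Real.log (tConst k γ) +
      logDet θ / 2 - (γ + k) / 2 * Real.log (γ + inner ℝ θ (quadFeature z)) := by
    intro z
    have h1 := tConst_pos k hγ
    have h2 : 0 < √(symMat θ).det := Real.sqrt_pos.2 (Matrix.PosDef.det_pos hθ)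
    have h3 : 0 < γ + inner ℝ θ (quadFeature z) := by
      have := inner_quadFeature_nonneg hθ z; linarith
    unfold tDensity
    rw [dotProduct_symMat_mulVec, Real.log_mul (by positivity) (by positivity),
      Real.log_mul h1.ne' h2.ne', Real.log_sqrt (Matrix.PosDef.det_pos hθ).le,
      Real.log_rpow h3, logDet]
    ring
  unfold sampleDensity tNLL
  rw [Real.log_prod (fun i _ => (tDensity_pos hγ hθ _).ne')]
  simp only [h, Finset.sum_sub_distrib, Finset.sum_const, Finset.card_univ, Fintype.card_fin,
    nsmul_eq_mul, ← Finset.mul_sum]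
  ring

lemma contDiffOn_tNLL {k : ℕ} {γ : ℝ} (hγ : 0 < γ) {n : ℕ} (x : Fin n → Fin k → ℝ) :
    ContDiffOn ℝ 2 (tNLL γ n x) (posDefParams k) := by
  refine ((contDiffOn_const.mul (ContDiffOn.sum fun i _ => ContDiffOn.log ?_ fun θ hθ => ?_)).sub
    (contDiffOn_const.mul (contDiffOn_logDet k))).sub contDiffOn_const
  · exact (contDiff_const.add (contDiff_id.inner ℝ contDiff_const)).contDiffOn
  · have := inner_quadFeature_nonneg hθ (x i)
    positivity

lemma regularityConditions {k : ℕ} {γ : ℝ} (hγ : 0 < γ) (n : ℕ) :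
    RegularityConditions volume (posDefParams k) (sampleLaw γ n) (sampleDensity γ n)
      (fun _ => 0) where
  convex := convex_posDefParams k
  isOpen := isOpen_posDefParams k
  isProbabilityMeasure _ hθ := isProbabilityMeasure_sampleLaw hγ n hθ
  density_pos _ hθ x := sampleDensity_pos hγ x hθ
  density_measurable _ hθ := by
    unfold sampleDensity
    exact Finset.measurable_prod _ fun _ _ =>
      (continuous_tDensity hγ (Matrix.PosDef.posSemidef hθ)).measurable.comp (measurable_pi_apply _)
  eq_withDensity _ hθ := sampleLaw_eq_withDensity hγ n hθ
  contDiffOn x := (contDiffOn_tNLL hγ x).congr fun θ hθ => by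
    simp [penalizedNLL, neg_log_sampleDensity hγ x hθ]

lemma hessian_congr {ι : Type*} [Fintype ι] [DecidableEq ι] {g h : EuclideanSpace ℝ ι → ℝ}
    {t : EuclideanSpace ℝ ι} (hgh : g =ᶠ[𝓝 t] h) : hessian g t = hessian h t := by
  ext i j
  simp only [hessian, Matrix.of_apply]
  have : (fun s => fderiv ℝ g s (EuclideanSpace.single j 1)) =ᶠ[𝓝 t]
      fun s => fderiv ℝ h s (EuclideanSpace.single j 1) := by
    filter_upwards [hgh.fderiv (𝕜 := ℝ)] with s hs
    rw [hs]
  rw [this.fderiv_eq]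

lemma hasFDerivAt_logDet {k : ℕ} {θ : EuclideanSpace ℝ (UpperTri k)} (hθ : θ ∈ posDefParams k) :
    HasFDerivAt logDet (fderiv ℝ logDet θ) θ :=
  (((contDiffOn_logDet k).contDiffAt ((isOpen_posDefParams k).mem_nhds hθ)).differentiableAt
    (by norm_num)).hasFDerivAt

lemma hasFDerivAt_fderiv_logDet {k : ℕ} {θ : EuclideanSpace ℝ (UpperTri k)}
    (hθ : θ ∈ posDefParams k) :
    HasFDerivAt (fderiv ℝ logDet) (fderiv ℝ (fderiv ℝ logDet) θ) θ := by
  have h := ((contDiffOn_logDet k).contDiffAt ((isOpen_posDefParams k).mem_nhds hθ))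
  exact ((h.fderiv_right (m := 1) (by norm_num)).differentiableAt (by norm_num)).hasFDerivAt

lemma add_inner_quadFeature_pos {k : ℕ} {γ : ℝ} (hγ : 0 < γ) {θ : EuclideanSpace ℝ (UpperTri k)}
    (hθ : θ ∈ posDefParams k) (z : Fin k → ℝ) : 0 < γ + inner ℝ θ (quadFeature z) := by
  have := inner_quadFeature_nonneg hθ z
  linarith

lemma hasFDerivAt_log_add_inner {k : ℕ} {γ : ℝ} (hγ : 0 < γ) {θ : EuclideanSpace ℝ (UpperTri k)}
    (hθ : θ ∈ posDefParams k) (z : Fin k → ℝ) :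
    HasFDerivAt (fun t => Real.log (γ + inner ℝ t (quadFeature z)))
      ((γ + inner ℝ θ (quadFeature z))⁻¹ • innerSL ℝ (quadFeature z)) θ := by
  refine HasFDerivAt.log ?_ (add_inner_quadFeature_pos hγ hθ z).ne'
  refine HasFDerivAt.const_add γ ?_
  refine ((innerSL ℝ (quadFeature z)).hasFDerivAt (x := θ)).congr_of_eventuallyEq
    (Eventually.of_forall fun t => ?_)
  simp [real_inner_comm]

lemma hasFDerivAt_inv_add_inner {k : ℕ} {γ : ℝ} (hγ : 0 < γ) {θ : EuclideanSpace ℝ (UpperTri k)}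
    (hθ : θ ∈ posDefParams k) (z : Fin k → ℝ) :
    HasFDerivAt (fun t => (γ + inner ℝ t (quadFeature z))⁻¹)
      (-((γ + inner ℝ θ (quadFeature z)) ^ 2)⁻¹ • innerSL ℝ (quadFeature z)) θ := by
  have h : HasFDerivAt (fun t => γ + inner ℝ t (quadFeature z)) (innerSL ℝ (quadFeature z)) θ := by
    refine HasFDerivAt.const_add γ ?_
    refine ((innerSL ℝ (quadFeature z)).hasFDerivAt (x := θ)).congr_of_eventuallyEq
      (Eventually.of_forall fun t => ?_)
    simp [real_inner_comm]
  exact (hasDerivAt_inv (add_inner_quadFeature_pos hγ hθ z).ne').comp_hasFDerivAt θ h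

lemma hasFDerivAt_tNLL {k : ℕ} {γ : ℝ} (hγ : 0 < γ) {n : ℕ} (x : Fin n → Fin k → ℝ)
    {θ : EuclideanSpace ℝ (UpperTri k)} (hθ : θ ∈ posDefParams k) :
    HasFDerivAt (tNLL γ n x)
      (((γ + k) / 2) • (∑ i, (γ + inner ℝ θ (quadFeature (x i)))⁻¹ •
        innerSL ℝ (quadFeature (x i))) - (n / 2 : ℝ) • fderiv ℝ logDet θ) θ := by
  refine HasFDerivAt.sub_const _ (HasFDerivAt.sub ?_ ?_)
  · refine HasFDerivAt.const_mul ?_ _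
    exact HasFDerivAt.fun_sum fun i _ => hasFDerivAt_log_add_inner hγ hθ (x i)
  · exact (hasFDerivAt_logDet hθ).const_mul _

lemma fderiv_tNLL_apply {k : ℕ} {γ : ℝ} (hγ : 0 < γ) {n : ℕ} (x : Fin n → Fin k → ℝ)
    {θ : EuclideanSpace ℝ (UpperTri k)} (hθ : θ ∈ posDefParams k)
    (v : EuclideanSpace ℝ (UpperTri k)) :
    fderiv ℝ (tNLL γ n x) θ v = ((γ + k) / 2) * (∑ i, (γ + inner ℝ θ (quadFeature (x i)))⁻¹ *
        inner ℝ v (quadFeature (x i))) - n / 2 * fderiv ℝ logDet θ v := by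
  rw [(hasFDerivAt_tNLL hγ x hθ).fderiv]
  simp [real_inner_comm]

lemma inner_single_quadFeature {k : ℕ} (p : UpperTri k) (z : Fin k → ℝ) :
    inner ℝ (EuclideanSpace.single p (1 : ℝ)) (quadFeature z) = quadFeature z p := by
  rw [EuclideanSpace.inner_single_left]
  simp

lemma hessian_tNLL {k : ℕ} {γ : ℝ} (hγ : 0 < γ) {n : ℕ} (x : Fin n → Fin k → ℝ)
    {θ : EuclideanSpace ℝ (UpperTri k)} (hθ : θ ∈ posDefParams k) (p q : UpperTri k) :
    hessian (tNLL γ n x) θ p q =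
      -((γ + k) / 2) * (∑ i, quadFeature (x i) p * quadFeature (x i) q /
        (γ + inner ℝ θ (quadFeature (x i))) ^ 2) -
        n / 2 * fderiv ℝ (fderiv ℝ logDet) θ (EuclideanSpace.single p 1)
          (EuclideanSpace.single q 1) := by
  have hev : (fun s => fderiv ℝ (tNLL γ n x) s (EuclideanSpace.single q 1)) =ᶠ[𝓝 θ]
      fun s => ((γ + k) / 2) * (∑ i, (γ + inner ℝ s (quadFeature (x i)))⁻¹ *
        quadFeature (x i) q) - n / 2 * fderiv ℝ logDet s (EuclideanSpace.single q 1) := by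
    filter_upwards [(isOpen_posDefParams k).mem_nhds hθ] with s hs
    rw [fderiv_tNLL_apply hγ x hs]
    simp only [inner_single_quadFeature]
  have hd : HasFDerivAt (fun s => ((γ + k) / 2) * (∑ i, (γ + inner ℝ s (quadFeature (x i)))⁻¹ *
        quadFeature (x i) q) - n / 2 * fderiv ℝ logDet s (EuclideanSpace.single q 1))
      (((γ + k) / 2) • (∑ i, quadFeature (x i) q •
        (-((γ + inner ℝ θ (quadFeature (x i))) ^ 2)⁻¹ • innerSL ℝ (quadFeature (x i)))) -
        (n / 2 : ℝ) • ((ContinuousLinearMap.apply ℝ ℝ (EuclideanSpace.single q 1)).comp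
          (fderiv ℝ (fderiv ℝ logDet) θ))) θ := by
    refine HasFDerivAt.sub ?_ ?_
    · refine HasFDerivAt.const_mul ?_ _
      exact HasFDerivAt.fun_sum fun i _ => (hasFDerivAt_inv_add_inner hγ hθ (x i)).mul_const _
    · exact ((ContinuousLinearMap.apply ℝ ℝ (EuclideanSpace.single q 1)).hasFDerivAt.comp θ
        (hasFDerivAt_fderiv_logDet hθ)).const_mul _
  rw [hessian, Matrix.of_apply, hev.fderiv_eq, hd.fderiv]
  simp only [sub_apply, smul_apply,
    sum_apply, innerSL_apply_apply, ContinuousLinearMap.comp_apply,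
    ContinuousLinearMap.apply_apply, smul_eq_mul]
  congr 1
  rw [neg_mul, ← mul_neg, ← Finset.sum_neg_distrib]
  congr 1
  refine Finset.sum_congr rfl fun i _ => ?_
  rw [real_inner_comm (EuclideanSpace.single p 1), inner_single_quadFeature]
  ring

/-- The two functions need not agree off the cone; openness of the cone is what allows all
derivatives to be computed on `tNLL`. -/
lemma eventuallyEq_tNLL {k : ℕ} {γ : ℝ} (hγ : 0 < γ) {n : ℕ} (x : Fin n → Fin k → ℝ)
    {θ : EuclideanSpace ℝ (UpperTri k)} (hθ : θ ∈ posDefParams k) :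
    (fun t => -Real.log (sampleDensity γ n x t)) =ᶠ[𝓝 θ] tNLL γ n x := by
  filter_upwards [(isOpen_posDefParams k).mem_nhds hθ] with t ht
  exact neg_log_sampleDensity hγ x ht

lemma obsInfo_sampleDensity {k : ℕ} {γ : ℝ} (hγ : 0 < γ) {n : ℕ} (x : Fin n → Fin k → ℝ)
    {θ : EuclideanSpace ℝ (UpperTri k)} (hθ : θ ∈ posDefParams k) :
    obsInfo (sampleDensity γ n) θ x = hessian (tNLL γ n x) θ :=
  hessian_congr (eventuallyEq_tNLL hγ x hθ)

lemma fderiv_perturbedNLL {k : ℕ} {γ : ℝ} (hγ : 0 < γ) {n : ℕ} (σ : ℝ) (x : Fin n → Fin k → ℝ)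
    (w : EuclideanSpace ℝ (UpperTri k))
    {θ : EuclideanSpace ℝ (UpperTri k)} (hθ : θ ∈ posDefParams k) :
    fderiv ℝ (perturbedNLL (sampleDensity γ n) (fun _ => 0) σ x w) θ =
      fderiv ℝ (tNLL γ n x) θ + σ • innerSL ℝ w := by
  have hev : perturbedNLL (sampleDensity γ n) (fun _ => 0) σ x w =ᶠ[𝓝 θ]
      fun t => tNLL γ n x t + σ * innerSL ℝ w t := by
    filter_upwards [eventuallyEq_tNLL hγ x hθ] with t ht
    simp [perturbedNLL, penalizedNLL, ht]
  rw [hev.fderiv_eq]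
  exact ((hasFDerivAt_tNLL hγ x hθ).differentiableAt.hasFDerivAt.add
    ((innerSL ℝ w).hasFDerivAt.const_mul σ)).fderiv

lemma hessian_perturbedNLL {k : ℕ} {γ : ℝ} (hγ : 0 < γ) {n : ℕ} (σ : ℝ) (x : Fin n → Fin k → ℝ)
    (w : EuclideanSpace ℝ (UpperTri k))
    {θ : EuclideanSpace ℝ (UpperTri k)} (hθ : θ ∈ posDefParams k) :
    hessian (perturbedNLL (sampleDensity γ n) (fun _ => 0) σ x w) θ =
      hessian (tNLL γ n x) θ := by
  ext p q
  simp only [hessian, Matrix.of_apply]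
  have hev : (fun s => fderiv ℝ (perturbedNLL (sampleDensity γ n) (fun _ => 0) σ x w) s
      (EuclideanSpace.single q 1)) =ᶠ[𝓝 θ] fun s => fderiv ℝ (tNLL γ n x) s
      (EuclideanSpace.single q 1) + σ * inner ℝ w (EuclideanSpace.single q 1) := by
    filter_upwards [(isOpen_posDefParams k).mem_nhds hθ] with s hs
    rw [fderiv_perturbedNLL hγ σ x w hs]
    simp
  rw [hev.fderiv_eq, fderiv_add_const]

lemma inner_gradient_perturbedNLL {k : ℕ} {γ : ℝ} (hγ : 0 < γ) {n : ℕ} (σ : ℝ)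
    (x : Fin n → Fin k → ℝ) (w : EuclideanSpace ℝ (UpperTri k))
    {θ : EuclideanSpace ℝ (UpperTri k)} (hθ : θ ∈ posDefParams k)
    (v : EuclideanSpace ℝ (UpperTri k)) :
    inner ℝ (gradient (perturbedNLL (sampleDensity γ n) (fun _ => 0) σ x w) θ) v =
      fderiv ℝ (tNLL γ n x) θ v + σ * inner ℝ w v := by
  rw [gradient, InnerProductSpace.toDual_symm_apply, fderiv_perturbedNLL hγ σ x w hθ]
  simp

lemma hessian_tNLL_isHermitian {k : ℕ} {γ : ℝ} (hγ : 0 < γ) {n : ℕ} (x : Fin n → Fin k → ℝ)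
    {θ : EuclideanSpace ℝ (UpperTri k)} (hθ : θ ∈ posDefParams k) :
    (hessian (tNLL γ n x) θ).IsHermitian := by
  ext p q
  have hsymm : IsSymmSndFDerivAt ℝ (logDet (k := k)) θ :=
    ((contDiffOn_logDet k).contDiffAt ((isOpen_posDefParams k).mem_nhds hθ)).isSymmSndFDerivAt
      (by simp)
  simp only [Matrix.conjTranspose_apply, star_trivial, hessian_tNLL hγ x hθ, hsymm.eq
    (EuclideanSpace.single p 1) (EuclideanSpace.single q 1), mul_comm (quadFeature _ q)]

lemma dotProduct_hessian_tNLL_mulVec {k : ℕ} {γ : ℝ} (hγ : 0 < γ) {n : ℕ} (x : Fin n → Fin k → ℝ)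
    {θ : EuclideanSpace ℝ (UpperTri k)} (hθ : θ ∈ posDefParams k)
    (v : EuclideanSpace ℝ (UpperTri k)) :
    v.ofLp ⬝ᵥ (hessian (tNLL γ n x) θ *ᵥ v.ofLp) =
      -((γ + k) / 2) * (∑ i, inner ℝ v (quadFeature (x i)) ^ 2 /
        (γ + inner ℝ θ (quadFeature (x i))) ^ 2) -
        n / 2 * fderiv ℝ (fderiv ℝ logDet) θ v v := by
  have hv : v = ∑ p, v p • EuclideanSpace.single p (1 : ℝ) := by
    ext q
    simp [Finset.sum_apply, Pi.single_apply]
  have h2 : fderiv ℝ (fderiv ℝ logDet) θ v v = ∑ p, ∑ q, v p * v q *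
      fderiv ℝ (fderiv ℝ logDet) θ (EuclideanSpace.single p 1) (EuclideanSpace.single q 1) := by
    conv_lhs => rw [hv]
    simp only [map_sum, map_smul, sum_apply, smul_apply,
      smul_eq_mul, Finset.mul_sum]
    rw [Finset.sum_comm]
    refine Finset.sum_congr rfl fun p _ => Finset.sum_congr rfl fun q _ => by ring
  have h3 : ∀ z : Fin k → ℝ, inner ℝ v (quadFeature z) ^ 2 =
      ∑ p, ∑ q, v p * v q * (quadFeature z p * quadFeature z q) := by
    intro z
    rw [PiLp.inner_apply, sq, Finset.sum_mul_sum]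
    refine Finset.sum_congr rfl fun p _ => Finset.sum_congr rfl fun q _ => ?_
    simp only [RCLike.inner_apply, conj_trivial]
    ring
  simp only [dotProduct, Matrix.mulVec, hessian_tNLL hγ x hθ, h2, h3]
  simp only [Finset.mul_sum, Finset.sum_div]
  rw [Finset.sum_comm (s := (Finset.univ : Finset (Fin n))), ← Finset.sum_sub_distrib]
  refine Finset.sum_congr rfl fun p _ => ?_
  rw [Finset.sum_comm (s := (Finset.univ : Finset (Fin n))), ← Finset.sum_sub_distrib]
  refine Finset.sum_congr rfl fun q _ => ?_
  rw [sub_mul, mul_sub, Finset.sum_mul, Finset.mul_sum]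
  congr 1
  · refine Finset.sum_congr rfl fun i _ => by ring
  · ring

/-! ### Information identities -/

section ParametricIntegral

variable {E : Type*} [MeasurableSpace E] {μ : Measure E} {D U : E → ℝ} {K a : ℝ}

lemma half_le_add_mul {d u K t : ℝ} (hd : 0 < d) (hu : |u| ≤ K * d)
    (ht : |t| * K < 1 / 2) : d / 2 ≤ d + t * u := by
  have h1 : |t * u| ≤ |t| * (K * d) := by rw [abs_mul]; gcongr
  have h2 := (abs_le.1 h1).1
  nlinarith

/-- Each factor `u` costs `K * d`, which the extra negative power of `d + t * u ≥ d / 2`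
compensates. Hence every order has the same majorant `d ^ (-a)`, and integrability of the kernel
alone justifies all differentiations. -/
lemma norm_pow_mul_rpow_le {d u K a t : ℝ} (hd : 0 < d) (hK : 0 ≤ K) (ha : 0 < a)
    (hu : |u| ≤ K * d) (ht : |t| * K < 1 / 2) (m : ℕ) :
    ‖u ^ m * (d + t * u) ^ (-(a + m))‖ ≤ K ^ m * 2 ^ (a + m) * d ^ (-a) := by
  have h1 := half_le_add_mul hd hu ht
  have h2 : 0 < d + t * u := by linarith
  rw [norm_mul, norm_pow, Real.norm_eq_abs, Real.norm_of_nonneg (Real.rpow_nonneg h2.le _)]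
  have h3 : (d + t * u) ^ (-(a + m)) ≤ (d / 2) ^ (-(a + m)) :=
    Real.rpow_le_rpow_of_nonpos (by positivity) h1 (by linarith [m.cast_nonneg (α := ℝ)])
  have h4 : (d / 2) ^ (-(a + m)) = 2 ^ (a + m) * (d ^ (-a) * (d ^ m)⁻¹) := by
    rw [Real.div_rpow hd.le (by norm_num), Real.rpow_neg (x := 2) (by norm_num), div_inv_eq_mul,
      neg_add, Real.rpow_add hd, Real.rpow_neg hd.le (m : ℝ), Real.rpow_natCast]
    ring
  calc |u| ^ m * (d + t * u) ^ (-(a + m)) ≤ (K * d) ^ m * (2 ^ (a + m) * (d ^ (-a) * (d ^ m)⁻¹)) := by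
        rw [← h4]; gcongr
    _ = _ := by
        rw [mul_pow]; field_simp

/-- The family of integrals is closed under differentiation, so two derivatives of the normalizing
integral come from using this with `m = 0` and `m = 1`. -/
lemma hasDerivAt_integral_pow_mul_rpow (hD : Measurable D) (hU : Measurable U)
    (hDpos : ∀ z, 0 < D z) (hK : 0 ≤ K) (hUK : ∀ z, |U z| ≤ K * D z) (ha : 0 < a)
    (hint : Integrable (fun z => D z ^ (-a)) μ) (m : ℕ) {t : ℝ} (ht : |t| * K < 1 / 2) :
    HasDerivAt (fun s => ∫ z, U z ^ m * (D z + s * U z) ^ (-(a + m)) ∂μ)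
      (-(a + m) * ∫ z, U z ^ (m + 1) * (D z + t * U z) ^ (-(a + (m + 1 : ℕ))) ∂μ) t := by
  have hmeas : ∀ (m : ℕ) (s : ℝ),
      AEStronglyMeasurable (fun z => U z ^ m * (D z + s * U z) ^ (-(a + m))) μ := fun m s =>
    Measurable.aestronglyMeasurable (by fun_prop)
  have hopen : {s : ℝ | |s| * K < 1 / 2} ∈ 𝓝 t :=
    (isOpen_lt (by fun_prop) continuous_const).mem_nhds ht
  have key := hasDerivAt_integral_of_dominated_loc_of_deriv_le (μ := μ) (𝕜 := ℝ)
    (F := fun s z => U z ^ m * (D z + s * U z) ^ (-(a + m)))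
    (F' := fun s z => -(a + m) * (U z ^ (m + 1) * (D z + s * U z) ^ (-(a + (m + 1 : ℕ)))))
    (x₀ := t) (s := {s : ℝ | |s| * K < 1 / 2})
    (bound := fun z => (a + m) * (K ^ (m + 1) * 2 ^ (a + (m + 1 : ℕ)) * D z ^ (-a)))
    hopen (Eventually.of_forall fun s => hmeas m s)
    ?_ ((hmeas (m + 1) t).const_mul _) ?_ ((hint.const_mul _).const_mul _) ?_
  · have := key.2
    rwa [integral_const_mul] at this
  · exact (hint.const_mul _).mono' (hmeas m t)
      (Eventually.of_forall fun z => norm_pow_mul_rpow_le (hDpos z) hK ha (hUK z) ht m)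
  · refine Eventually.of_forall fun z s hs => ?_
    rw [norm_mul, norm_neg, Real.norm_of_nonneg (by positivity : 0 ≤ a + (m : ℝ))]
    exact mul_le_mul_of_nonneg_left
      (norm_pow_mul_rpow_le (hDpos z) hK ha (hUK z) hs (m + 1)) (by positivity)
  · refine Eventually.of_forall fun z s hs => ?_
    have hpos : 0 < D z + s * U z := by
      have := half_le_add_mul (hDpos z) (hUK z) hs
      have := hDpos z
      linarith
    have h1 : HasDerivAt (fun s => D z + s * U z) (U z) s := by
      simpa using ((hasDerivAt_id s).mul_const (U z)).const_add (D z)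
    have h2 := (h1.rpow_const (p := -(a + m)) (Or.inl hpos.ne')).const_mul (U z ^ m)
    refine h2.congr_deriv ?_
    rw [show -(a + (m + 1 : ℕ)) = -(a + m) - 1 by push_cast; ring]
    ring

end ParametricIntegral

lemma integral_multivariateT {k : ℕ} {γ : ℝ} (hγ : 0 < γ) {θ : EuclideanSpace ℝ (UpperTri k)}
    (hθ : θ ∈ posDefParams k) (g : (Fin k → ℝ) → ℝ) :
    ∫ z, g z ∂(multivariateT γ (symMat θ)) =
      tConst k γ * √(symMat θ).det *
        ∫ z, (γ + inner ℝ θ (quadFeature z)) ^ (-((γ + k) / 2)) * g z := by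
  rw [multivariateT, integral_withDensity_eq_integral_toReal_smul
    (continuous_tDensity hγ (Matrix.PosDef.posSemidef hθ)).measurable.ennreal_ofReal
    (Eventually.of_forall fun _ => ENNReal.ofReal_lt_top), ← integral_const_mul]
  refine integral_congr_ae (Eventually.of_forall fun z => ?_)
  simp only
  rw [ENNReal.toReal_ofReal (tDensity_pos hγ hθ z).le, tDensity, dotProduct_symMat_mulVec,
    smul_eq_mul]
  ring

/-- Total mass one, read as a formula for `log det`: its derivatives can then be expressed by
moments of the t law. -/
lemma normalization_logDet {k : ℕ} {γ : ℝ} (hγ : 0 < γ) {θ : EuclideanSpace ℝ (UpperTri k)}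
    (hθ : θ ∈ posDefParams k) :
    ∫ z : Fin k → ℝ, (γ + inner ℝ θ (quadFeature z)) ^ (-((γ + k) / 2)) =
      (tConst k γ)⁻¹ * Real.exp (-(logDet θ / 2)) := by
  have hp := isProbabilityMeasure_multivariateT hγ hθ
  have h := integral_multivariateT hγ hθ (fun _ => 1)
  simp only [mul_one, integral_const, probReal_univ, smul_eq_mul] at h
  have hc := tConst_pos k hγ
  have hs : Real.exp (logDet θ / 2) = √(symMat θ).det := by
    rw [Real.exp_half, logDet, Real.exp_log (Matrix.PosDef.det_pos hθ)]
  rw [Real.exp_neg, hs, ← mul_inv]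
  exact eq_inv_of_mul_eq_one_right h.symm

lemma integrable_quadForm_rpow {k : ℕ} {γ : ℝ} (hγ : 0 < γ) {θ : EuclideanSpace ℝ (UpperTri k)}
    (hθ : θ ∈ posDefParams k) :
    Integrable fun z : Fin k → ℝ => (γ + inner ℝ θ (quadFeature z)) ^ (-((γ + k) / 2)) := by
  have hc : tConst k γ * √(symMat θ).det ≠ 0 :=
    (mul_pos (tConst_pos k hγ) (Real.sqrt_pos.2 (Matrix.PosDef.det_pos hθ))).ne'
  refine ((integrable_tDensity hγ hθ).const_mul (tConst k γ * √(symMat θ).det)⁻¹).congr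
    (Eventually.of_forall fun z => ?_)
  simp only [tDensity, dotProduct_symMat_mulVec]
  rw [inv_mul_cancel_left₀ hc]

/-- The normalized feature `φ(z) / (γ + zᵀ θ z)`. -/
noncomputable def normFeature {k : ℕ} (γ : ℝ) (θ : EuclideanSpace ℝ (UpperTri k))
    (z : Fin k → ℝ) : EuclideanSpace ℝ (UpperTri k) :=
  (γ + inner ℝ θ (quadFeature z))⁻¹ • quadFeature z

lemma inner_normFeature {k : ℕ} (γ : ℝ) (θ v : EuclideanSpace ℝ (UpperTri k)) (z : Fin k → ℝ) :
    inner ℝ v (normFeature γ θ z) =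
      inner ℝ v (quadFeature z) / (γ + inner ℝ θ (quadFeature z)) := by
  rw [normFeature, inner_smul_right]
  ring

lemma continuous_normFeature {k : ℕ} {γ : ℝ} (hγ : 0 < γ) {θ : EuclideanSpace ℝ (UpperTri k)}
    (hθ : θ ∈ posDefParams k) : Continuous (normFeature γ θ) := by
  unfold normFeature
  refine Continuous.smul (Continuous.inv₀ ?_ fun z => (add_inner_quadFeature_pos hγ hθ z).ne')
    continuous_quadFeature
  exact continuous_const.add (continuous_const.inner continuous_quadFeature)

/-- The score has mean zero, and its variance is the expected information. -/
lemma score_mean_and_information {k : ℕ} {γ : ℝ} (hγ : 0 < γ)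
    {θ : EuclideanSpace ℝ (UpperTri k)} (hθ : θ ∈ posDefParams k)
    (v : EuclideanSpace ℝ (UpperTri k)) :
    (1 / 2 * fderiv ℝ logDet θ v =
      (γ + k) / 2 * ∫ z, inner ℝ v (normFeature γ θ z) ∂(multivariateT γ (symMat θ))) ∧
    (-(1 / 2) * fderiv ℝ (fderiv ℝ logDet) θ v v -
        (γ + k) / 2 * ∫ z, inner ℝ v (normFeature γ θ z) ^ 2 ∂(multivariateT γ (symMat θ)) =
      ((γ + k) / 2) ^ 2 * (∫ z, inner ℝ v (normFeature γ θ z) ^ 2 ∂(multivariateT γ (symMat θ)) -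
        (∫ z, inner ℝ v (normFeature γ θ z) ∂(multivariateT γ (symMat θ))) ^ 2)) := by
  obtain ⟨C, hC, r, hr, hball, -, hbd⟩ := exists_local_bound hθ
  set a : ℝ := (γ + k) / 2 with ha_def
  have ha : 0 < a := by positivity
  set D : (Fin k → ℝ) → ℝ := fun z => γ + inner ℝ θ (quadFeature z) with hD
  set U : (Fin k → ℝ) → ℝ := fun z => inner ℝ v (quadFeature z) with hU
  set K : ℝ := ‖v‖ * C with hK
  have hDm : Measurable D :=
    (continuous_const.add (continuous_const.inner continuous_quadFeature)).measurable
  have hUm : Measurable U := (continuous_const.inner continuous_quadFeature).measurable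
  have hDpos : ∀ z, 0 < D z := add_inner_quadFeature_pos hγ hθ
  have hUK : ∀ z, |U z| ≤ K * D z := by
    intro z
    have h1 : ‖quadFeature z‖ ≤ C * D z := by
      refine (hbd θ (Metric.mem_closedBall_self hr.le) z).trans ?_
      gcongr
      simp only [hD]; linarith
    calc |U z| ≤ ‖v‖ * ‖quadFeature z‖ := abs_real_inner_le_norm _ _
      _ ≤ ‖v‖ * (C * D z) := by gcongr
      _ = K * D z := by rw [hK]; ring
  have hint : Integrable (fun z => D z ^ (-a)) := integrable_quadForm_rpow hγ hθ
  -- `J m s` is the unnormalized `m`-th moment of `⟪v, y⟫` at the parameter `θ + s • v`; in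
  -- particular `J 0` is the normalizing integral along this line.
  set J : ℕ → ℝ → ℝ := fun m s => ∫ z, U z ^ m * (D z + s * U z) ^ (-(a + m)) with hJ
  have hJd : ∀ (m : ℕ) {t : ℝ}, |t| * K < 1 / 2 →
      HasDerivAt (J m) (-(a + m) * J (m + 1) t) t := fun m t ht =>
    hasDerivAt_integral_pow_mul_rpow hDm hUm hDpos (by positivity) hUK ha hint m ht
  have hline : Continuous fun t : ℝ => θ + t • v := by fun_prop
  have hN : ∀ᶠ t : ℝ in 𝓝 0, |t| * K < 1 / 2 ∧ θ + t • v ∈ posDefParams k := by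
    refine Filter.Eventually.and ?_ ?_
    · exact (isOpen_lt (by fun_prop) continuous_const).mem_nhds (by simp)
    · exact hline.continuousAt.eventually_mem ((isOpen_posDefParams k).mem_nhds (by simpa using hθ))
  have hlined : ∀ t : ℝ, HasDerivAt (fun t : ℝ => θ + t • v) v t := fun t => by
    simpa using ((hasDerivAt_id t).smul_const v).const_add θ
  set c : ℝ := (tConst k γ)⁻¹ with hc
  have hJ0 : ∀ t : ℝ, θ + t • v ∈ posDefParams k →
      J 0 t = c * Real.exp (-(logDet (θ + t • v) / 2)) := by
    intro t ht
    rw [← normalization_logDet hγ ht]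
    simp only [hJ, hD, hU, pow_zero, one_mul, Nat.cast_zero, add_zero]
    congr 1
    ext z
    rw [inner_add_left, real_inner_smul_left, add_assoc]
  -- The two expressions for the derivative of `J 0` are compared. The identity is recorded on a
  -- whole neighbourhood of `0` because it is differentiated once more in `hJ2`.
  have hJ1 : ∀ᶠ t : ℝ in 𝓝 0,
      J 1 t = (2 * a)⁻¹ * (fderiv ℝ logDet (θ + t • v) v * J 0 t) := by
    filter_upwards [hN, hN.eventually_nhds] with t ht ht'
    have h1 := hJd 0 ht.1
    have h2 : HasDerivAt (fun t : ℝ => c * Real.exp (-(logDet (θ + t • v) / 2)))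
        (c * (Real.exp (-(logDet (θ + t • v) / 2)) *
          (-(fderiv ℝ logDet (θ + t • v) v / 2)))) t :=
      ((((hasFDerivAt_logDet ht.2).comp_hasDerivAt t (hlined t)).div_const 2).neg.exp).const_mul c
    have h3 : J 0 =ᶠ[𝓝 t] fun t : ℝ => c * Real.exp (-(logDet (θ + t • v) / 2)) := by
      filter_upwards [ht'] with s hs using hJ0 s hs.2
    have h4 := h1.unique (h2.congr_of_eventuallyEq h3)
    rw [hJ0 t ht.2]
    simp only [Nat.cast_zero, add_zero, zero_add] at h4
    field_simp
    linarith
  have hN0 := hN.self_of_nhds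
  have hJ10 := hJ1.self_of_nhds
  have hJ2 : -(a + 1) * J 2 0 = (2 * a)⁻¹ * (fderiv ℝ (fderiv ℝ logDet) θ v v * J 0 0 +
      fderiv ℝ logDet θ v * (-a * J 1 0)) := by
    have h1 := hJd 1 hN0.1
    have h5 := hasFDerivAt_fderiv_logDet (θ := θ + (0 : ℝ) • v) hN0.2
    have h6 : HasDerivAt (fun t : ℝ => fderiv ℝ logDet (θ + t • v) v)
        (fderiv ℝ (fderiv ℝ logDet) (θ + (0 : ℝ) • v) v v) 0 :=
      (ContinuousLinearMap.apply ℝ ℝ v).hasFDerivAt.comp_hasDerivAt 0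
        (h5.comp_hasDerivAt 0 (hlined 0))
    have h2 := (h6.mul (hJd 0 hN0.1)).const_mul (2 * a)⁻¹
    have h4 := h1.unique (h2.congr_of_eventuallyEq hJ1)
    simpa using h4
  have hc0 : 0 < c := inv_pos.2 (tConst_pos k hγ)
  have hJ00 : 0 < J 0 0 := by
    rw [hJ0 0 hN0.2]; positivity
  have hnorm : tConst k γ * √(symMat θ).det = (J 0 0)⁻¹ := by
    have hp := isProbabilityMeasure_multivariateT hγ hθ
    have h := integral_multivariateT hγ hθ (fun _ => 1)
    simp only [mul_one, integral_const, probReal_univ, smul_eq_mul] at h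
    have : J 0 0 = ∫ z : Fin k → ℝ, (γ + inner ℝ θ (quadFeature z)) ^ (-((γ + k) / 2)) := by
      simp [hJ, hD, ha_def]
    rw [this]
    exact eq_inv_of_mul_eq_one_left h.symm
  have hmom : ∀ m : ℕ, ∫ z, inner ℝ v (normFeature γ θ z) ^ m ∂(multivariateT γ (symMat θ)) =
      (J 0 0)⁻¹ * J m 0 := by
    intro m
    rw [integral_multivariateT hγ hθ, hnorm]
    congr 1
    simp only [hJ, zero_mul, add_zero]
    congr 1
    ext z
    rw [inner_normFeature, div_pow, neg_add, Real.rpow_add (hDpos z), Real.rpow_neg (hDpos z).le m,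
      Real.rpow_natCast]
    simp only [hD, hU, ha_def]
    ring
  have hm1 : ∫ z, inner ℝ v (normFeature γ θ z) ∂(multivariateT γ (symMat θ)) =
      (J 0 0)⁻¹ * J 1 0 := by simpa using hmom 1
  rw [hm1, hmom 2]
  simp only [zero_smul, add_zero] at hJ10
  have e1 : fderiv ℝ logDet θ v = 2 * a * ((J 0 0)⁻¹ * J 1 0) := by
    rw [hJ10]; field_simp
  -- With `mⱼ` the normalized moments this reads `D² log det (v, v) = -2a(a+1) m₂ + 2a² m₁²`. Hence
  -- `-D² log det (v, v) / 2 - a m₂` collapses to `a² (m₂ - m₁²)`.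
  have e2 : fderiv ℝ (fderiv ℝ logDet) θ v v =
      -(2 * a * (a + 1)) * ((J 0 0)⁻¹ * J 2 0) + 2 * a ^ 2 * ((J 0 0)⁻¹ * J 1 0) ^ 2 := by
    have h7 : fderiv ℝ (fderiv ℝ logDet) θ v v * J 0 0 =
        -(2 * a * (a + 1)) * J 2 0 + a * fderiv ℝ logDet θ v * J 1 0 := by
      field_simp at hJ2
      linarith
    rw [e1] at h7
    field_simp
    field_simp at h7
    linarith
  constructor
  · rw [e1]; ring
  · rw [e2]; ring

lemma norm_normFeature_le {k : ℕ} {γ C : ℝ} (hγ : 0 < γ) {θ : EuclideanSpace ℝ (UpperTri k)}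
    (hθ : θ ∈ posDefParams k) (hC : 0 ≤ C) {z : Fin k → ℝ}
    (h : ‖quadFeature z‖ ≤ C * inner ℝ θ (quadFeature z)) : ‖normFeature γ θ z‖ ≤ C := by
  have hD := add_inner_quadFeature_pos hγ hθ z
  rw [normFeature, norm_smul, norm_inv, Real.norm_of_nonneg hD.le, inv_mul_le_iff₀ hD]
  refine h.trans ?_
  nlinarith

/-- The expected information of one observation is positive definite. -/
lemma exists_information_lower_bound {k : ℕ} {γ : ℝ} (hγ : 0 < γ)
    {θ : EuclideanSpace ℝ (UpperTri k)} (hθ : θ ∈ posDefParams k) :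
    ∃ c > 0, ∀ v : EuclideanSpace ℝ (UpperTri k), c * ‖v‖ ^ 2 ≤
      -(1 / 2) * fderiv ℝ (fderiv ℝ logDet) θ v v -
        (γ + k) / 2 * ∫ z, inner ℝ v (normFeature γ θ z) ^ 2 ∂(multivariateT γ (symMat θ)) := by
  have hP := isProbabilityMeasure_multivariateT hγ hθ
  set P := multivariateT γ (symMat θ) with hPdef
  set a : ℝ := (γ + k) / 2 with ha_def
  have ha : 0 < a := by positivity
  obtain ⟨C, hC, r, hr, -, -, hbd⟩ := exists_local_bound hθ
  have hyC : ∀ z, ‖normFeature γ θ z‖ ≤ C := fun z =>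
    norm_normFeature_le hγ hθ hC.le (hbd θ (Metric.mem_closedBall_self hr.le) z)
  have hcont : ∀ v, Continuous fun z => inner ℝ v (normFeature γ θ z) := fun v =>
    continuous_const.inner (continuous_normFeature hγ hθ)
  have hbdd : ∀ v z, ‖inner ℝ v (normFeature γ θ z)‖ ≤ ‖v‖ * C := fun v z =>
    (norm_inner_le_norm _ _).trans (by gcongr; exact hyC z)
  have hmem : ∀ v, MemLp (fun z => inner ℝ v (normFeature γ θ z)) 2 P := fun v =>
    MemLp.of_bound (hcont v).aestronglyMeasurable (‖v‖ * C) (Eventually.of_forall (hbdd v))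
  set q : EuclideanSpace ℝ (UpperTri k) → ℝ := fun v =>
    -(1 / 2) * fderiv ℝ (fderiv ℝ logDet) θ v v -
        a * ∫ z, inner ℝ v (normFeature γ θ z) ^ 2 ∂P with hq
  -- No limit theorem for integrals is needed: the information identity can be solved for the second
  -- moment in terms of the derivatives of `log det`, which are polynomial in `v`.
  have hqcont : Continuous q := by
    have h1 : q = fun v => -(1 / 2) * fderiv ℝ (fderiv ℝ logDet) θ v v - a * ((a ^ 2 + a)⁻¹ *
        (-(1 / 2) * fderiv ℝ (fderiv ℝ logDet) θ v v + (1 / 2 * fderiv ℝ logDet θ v) ^ 2)) := by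
      ext v
      obtain ⟨e1, e2⟩ := score_mean_and_information hγ hθ v
      rw [← hPdef, ← ha_def] at e1 e2
      simp only [hq]
      congr 2
      rw [e1]
      field_simp
      linarith
    rw [h1]
    fun_prop
  have hqpos : ∀ v ∈ Metric.sphere (0 : EuclideanSpace ℝ (UpperTri k)) 1, 0 < q v := by
    intro v hv
    have hvar := variance_eq_sub (hmem v)
    obtain ⟨-, e2⟩ := score_mean_and_information hγ hθ v
    rw [← hPdef] at e2
    have e3 : q v = a ^ 2 * Var[fun z => inner ℝ v (normFeature γ θ z); P] := by
      rw [hvar]; exact e2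
    rw [e3]
    refine mul_pos (by positivity) ((variance_nonneg _ _).lt_of_ne' fun h0 => ?_)
    have hae : (fun z => inner ℝ v (normFeature γ θ z)) =ᵐ[P]
        fun _ => P[fun z => inner ℝ v (normFeature γ θ z)] := by
      rw [← evariance_eq_zero_iff (hmem v).aestronglyMeasurable.aemeasurable,
        ← ofReal_variance (hmem v), h0, ENNReal.ofReal_zero]
    -- The density is positive, so an identity that holds almost surely under `P` holds
    -- Lebesgue-almost everywhere, and by continuity everywhere. Evaluation at the origin then shows
    -- that the constant is zero.
    have hac : (volume : Measure (Fin k → ℝ)) ≪ P :=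
      withDensity_absolutelyContinuous'
        (continuous_tDensity hγ (Matrix.PosDef.posSemidef hθ)).measurable.ennreal_ofReal.aemeasurable
        (Eventually.of_forall fun z => (ENNReal.ofReal_pos.2 (tDensity_pos hγ hθ z)).ne')
    have heq := Measure.eq_of_ae_eq (hac.ae_eq hae) (hcont v) continuous_const
    have hzero : P[fun z => inner ℝ v (normFeature γ θ z)] = 0 := by
      have := congrFun heq 0
      simpa [normFeature, quadFeature_zero] using this.symm
    have hv0 : v = 0 := eq_zero_of_inner_quadFeature_eq_zero fun z => by
      have : inner ℝ v (normFeature γ θ z) = 0 := (congrFun heq z).trans hzero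
      rw [inner_normFeature] at this
      exact (div_eq_zero_iff.1 this).resolve_right (add_inner_quadFeature_pos hγ hθ z).ne'
    simp [hv0] at hv
  obtain ⟨c, hc, hle⟩ := (isCompact_sphere (0 : EuclideanSpace ℝ (UpperTri k)) 1).exists_forall_le'
    hqcont.continuousOn hqpos
  refine ⟨c, hc, fun v => ?_⟩
  rcases eq_or_ne v 0 with rfl | hv
  · simp
  have hvn : 0 < ‖v‖ := norm_pos_iff.2 hv
  have h1 := hle (‖v‖⁻¹ • v) (by simp [norm_smul, hvn.ne'])
  have h2 : q (‖v‖⁻¹ • v) = (‖v‖ ^ 2)⁻¹ * q v := by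
    simp only [hq, real_inner_smul_left, map_smul, smul_apply, smul_eq_mul, mul_pow,
      integral_const_mul]
    ring
  rw [h2, ← div_eq_inv_mul, le_div_iff₀ (by positivity)] at h1
  exact h1

/-! ### Concentration for sums and U-statistics -/

lemma HasSubgaussianMGF.mono {Ω : Type*} [MeasurableSpace Ω] {P : Measure Ω} {X : Ω → ℝ}
    {c c' : ℝ≥0} (h : HasSubgaussianMGF X c P) (hc : c ≤ c') : HasSubgaussianMGF X c' P :=
  ⟨h.integrable_exp_mul, fun t => (h.mgf_le t).trans (Real.exp_le_exp.2 (by gcongr))⟩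

/-- At `t = A √(n log n)` the sub-Gaussian exponent is `-A² log n / (2 b²)`, so `A² ≥ 2 p b²` is
exactly the condition for a tail of order `n⁻ᵖ`. -/
lemma measure_lt_abs_le_of_hasSubgaussianMGF {Ω : Type*} [MeasurableSpace Ω] {P : Measure Ω}
    [IsProbabilityMeasure P] {X : Ω → ℝ} {b : ℝ≥0} {n : ℕ} (hn : 1 ≤ n)
    (h : HasSubgaussianMGF X (n * b ^ 2) P) (hb : 0 < b) (p : ℕ) {A : ℝ} (hA : 0 ≤ A)
    (hAp : 2 * p * b ^ 2 ≤ A ^ 2) :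
    P {ω | A * √(n * Real.log n) < |X ω|} ≤ ENNReal.ofReal (2 * ((n : ℝ) ^ p)⁻¹) := by
  have hn0 : (0 : ℝ) < n := by exact_mod_cast hn
  have hlog : 0 ≤ Real.log n := Real.log_nonneg (by exact_mod_cast hn)
  have hb' : (0 : ℝ) < b := by exact_mod_cast hb
  set t := A * √(n * Real.log n) with ht
  have ht0 : 0 ≤ t := by positivity
  have hexp : Real.exp (-t ^ 2 / (2 * ((n * b ^ 2 : ℝ≥0) : ℝ))) ≤ ((n : ℝ) ^ p)⁻¹ := by
    have h1 : ((n : ℝ) ^ p)⁻¹ = Real.exp (-(p * Real.log n)) := by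
      rw [Real.exp_neg, mul_comm, Real.exp_mul, Real.exp_log hn0, Real.rpow_natCast]
    rw [h1]
    refine Real.exp_le_exp.2 ?_
    push_cast
    rw [ht, mul_pow, Real.sq_sqrt (by positivity), neg_div, neg_le_neg_iff,
      le_div_iff₀ (by positivity)]
    have := mul_le_mul_of_nonneg_right hAp (by positivity : 0 ≤ n * Real.log n)
    linarith
  have e1 := (h.measure_ge_le ht0).trans hexp
  have e2 := (h.neg.measure_ge_le ht0).trans hexp
  have hsub : {ω | t < |X ω|} ⊆ {ω | t ≤ X ω} ∪ {ω | t ≤ (-X) ω} := by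
    intro ω hω
    rcases lt_abs.1 (show t < |X ω| from hω) with h | h
    · exact Or.inl h.le
    · exact Or.inr h.le
  calc P {ω | t < |X ω|} ≤ P {ω | t ≤ X ω} + P {ω | t ≤ (-X) ω} :=
        (measure_mono hsub).trans (measure_union_le _ _)
    _ ≤ ENNReal.ofReal ((n : ℝ) ^ p)⁻¹ + ENNReal.ofReal ((n : ℝ) ^ p)⁻¹ := by
        gcongr
        · rw [← ofReal_measureReal]; exact ENNReal.ofReal_le_ofReal e1
        · rw [← ofReal_measureReal]; exact ENNReal.ofReal_le_ofReal e2
    _ = _ := by rw [← ENNReal.ofReal_add (by positivity) (by positivity), two_mul]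

lemma card_filter_lt (n : ℕ) :
    (Finset.univ.filter fun p : Fin n × Fin n => p.1 < p.2).card = n.choose 2 := by
  rw [Finset.card_filter, Fintype.sum_prod_type_right]
  have h : ∀ j : Fin n, ∑ i : Fin n, (if i < j then 1 else 0) = (j : ℕ) := fun j => by
    rw [← Finset.card_filter, Finset.filter_gt_eq_Iio, Fin.card_Iio]
  simp only [h]
  rw [Fin.sum_univ_eq_sum_range (fun i => i) n, Finset.sum_range_id, Nat.choose_two_right]

/-! ### I.i.d. samples: Hoeffding's inequality and U-statistics of order two. -/

section Pi

variable {E : Type*} [MeasurableSpace E] {μ : Measure E} [IsProbabilityMeasure μ]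

lemma integral_comp_eval {n : ℕ} (i : Fin n) {g : E → ℝ} (hg : Measurable g) :
    ∫ x, g (x i) ∂(Measure.pi fun _ : Fin n => μ) = ∫ z, g z ∂μ := by
  have h := (measurePreserving_eval (fun _ : Fin n => μ) i)
  exact (integral_map h.measurable.aemeasurable hg.aestronglyMeasurable).symm.trans
    (by rw [h.map_eq])

/-- Hoeffding's inequality for i.i.d. bounded summands. -/
lemma hoeffding_pi {n : ℕ} (hn : 1 ≤ n) {g : E → ℝ} (hg : Measurable g) {B : ℝ} (hB : 0 < B)
    (hgB : ∀ z, |g z| ≤ B) (p : ℕ) {A : ℝ} (hA : 0 ≤ A) (hAp : 2 * p * B ^ 2 ≤ A ^ 2) :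
    (Measure.pi fun _ : Fin n => μ)
      {x | A * √(n * Real.log n) < |∑ i, g (x i) - n * ∫ z, g z ∂μ|} ≤
      ENNReal.ofReal (2 * ((n : ℝ) ^ p)⁻¹) := by
  set P := Measure.pi fun _ : Fin n => μ with hP
  have hsub : ∀ i : Fin n, HasSubgaussianMGF (fun x : Fin n → E => g (x i) - ∫ z, g z ∂μ)
      ((Real.toNNReal B) ^ 2) P := by
    intro i
    have h := hasSubgaussianMGF_of_mem_Icc (μ := P) (X := fun x : Fin n → E => g (x i))
      (a := -B) (b := B) (hg.comp (measurable_pi_apply i)).aemeasurable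
      (Eventually.of_forall fun x => abs_le.1 (hgB (x i)))
    rw [integral_comp_eval i hg] at h
    refine HasSubgaussianMGF.mono h (le_of_eq ?_)
    congr 1
    ext
    push_cast
    rw [Real.coe_toNNReal B hB.le, Real.norm_of_nonneg (by linarith)]
    ring
  have hind : iIndepFun (fun (i : Fin n) (x : Fin n → E) => g (x i) - ∫ z, g z ∂μ) P :=
    iIndepFun_pi (X := fun _ z => g z - ∫ z, g z ∂μ) (fun _ => by fun_prop)
  have hsum := HasSubgaussianMGF.sum_of_iIndepFun hind (s := Finset.univ) (fun i _ => hsub i)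
  simp only [Finset.sum_const, Finset.card_univ, Fintype.card_fin, Finset.sum_sub_distrib,
    nsmul_eq_mul] at hsum
  refine measure_lt_abs_le_of_hasSubgaussianMGF hn hsum (Real.toNNReal_pos.2 hB) p hA ?_
  rwa [Real.coe_toNNReal B hB.le]

lemma map_pair_pi {n : ℕ} {i j : Fin n} (hij : i ≠ j) :
    (Measure.pi fun _ : Fin n => μ).map (fun x => (x i, x j)) = μ.prod μ := by
  have hind : IndepFun (fun x : Fin n → E => x i) (fun x : Fin n → E => x j)
      (Measure.pi fun _ : Fin n => μ) :=
    (iIndepFun_pi (μ := fun _ : Fin n => μ) (X := fun _ z => z) (fun _ => aemeasurable_id)).indepFun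
      hij
  rw [(indepFun_iff_map_prod_eq_prod_map_map (measurable_pi_apply i).aemeasurable
    (measurable_pi_apply j).aemeasurable).1 hind]
  exact congrArg₂ _ (measurePreserving_eval (fun _ : Fin n => μ) i).map_eq
    (measurePreserving_eval (fun _ : Fin n => μ) j).map_eq

/-- Terms attached to disjoint pairs of indices depend on disjoint blocks of coordinates, hence are
independent and their sub-Gaussian parameters add. -/
lemma hasSubgaussianMGF_sum_disjoint_pairs {n : ℕ} {f : E × E → ℝ} (hf : Measurable f) {c : ℝ≥0}
    (s : Finset (Fin n × Fin n))
    (hs : ∀ p ∈ s, ∀ q ∈ s, p ≠ q → p.1 ≠ q.1 ∧ p.1 ≠ q.2 ∧ p.2 ≠ q.1 ∧ p.2 ≠ q.2)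
    (hsub : ∀ p ∈ s, HasSubgaussianMGF (fun x : Fin n → E => f (x p.1, x p.2)) c
      (Measure.pi fun _ : Fin n => μ)) :
    HasSubgaussianMGF (fun x : Fin n → E => ∑ p ∈ s, f (x p.1, x p.2)) (s.card * c)
      (Measure.pi fun _ : Fin n => μ) := by
  classical
  induction s using Finset.induction_on with
  | empty => simp
  | insert p s hp ih =>
    have ih' := ih (fun a ha b hb => hs a (Finset.mem_insert_of_mem ha) b
      (Finset.mem_insert_of_mem hb)) (fun a ha => hsub a (Finset.mem_insert_of_mem ha))
    have hcoord := iIndepFun_pi (μ := fun _ : Fin n => μ) (X := fun _ z => z)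
      (fun _ => aemeasurable_id)
    set S : Finset (Fin n) := s.image Prod.fst ∪ s.image Prod.snd with hS
    have hST : Disjoint ({p.1, p.2} : Finset (Fin n)) S := by
      rw [Finset.disjoint_left]
      intro a ha haS
      simp only [Finset.mem_insert, Finset.mem_singleton] at ha
      simp only [hS, Finset.mem_union, Finset.mem_image] at haS
      have hne : ∀ q ∈ s, p ≠ q := fun q hq h => hp (h ▸ hq)
      rcases haS with ⟨q, hq, rfl⟩ | ⟨q, hq, rfl⟩ <;>
        have := hs p (Finset.mem_insert_self _ _) q (Finset.mem_insert_of_mem hq) (hne q hq) <;>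
        rcases ha with h | h <;> simp_all
    have hI := hcoord.indepFun_finset _ _ hST (fun i => measurable_pi_apply i)
    have h1 : Measurable fun y : ({p.1, p.2} : Finset (Fin n)) → E =>
        f (y ⟨p.1, by simp⟩, y ⟨p.2, by simp⟩) := by fun_prop
    have h2 : Measurable fun y : S → E => ∑ q ∈ s.attach,
        f (y ⟨q.1.1, Finset.mem_union_left _ (Finset.mem_image_of_mem _ q.2)⟩,
          y ⟨q.1.2, Finset.mem_union_right _ (Finset.mem_image_of_mem _ q.2)⟩) :=
      Finset.measurable_sum _ fun q _ => by fun_prop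
    have hI2 := hI.comp h1 h2
    have key := (hsub p (Finset.mem_insert_self _ _)).add_of_indepFun ih' (by
      refine hI2.congr EventuallyEq.rfl (Eventually.of_forall fun x => ?_)
      exact Finset.sum_attach s (fun q => f (x q.1, x q.2)))
    refine (HasSubgaussianMGF.mono key (le_of_eq ?_)).congr (Eventually.of_forall fun x => ?_)
    · rw [Finset.card_insert_of_notMem hp]; push_cast; ring
    · simp [Finset.sum_insert hp]

/-- Concentration of a U-statistic of order two with a kernel bounded by `1`. -/
lemma ustatistic_concentration {n : ℕ} (hn : 2 ≤ n) {f : E × E → ℝ} (hf : Measurable f)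
    (hfB : ∀ z, |f z| ≤ 1) :
    (Measure.pi fun _ : Fin n => μ)
      {x | 16 * √(Real.log n / n) < |(n.choose 2 : ℝ)⁻¹ *
        ∑ p : Fin n × Fin n with p.1 < p.2, f (x p.1, x p.2) - ∫ z, f z ∂(μ.prod μ)|} ≤
      ENNReal.ofReal (4 * (n : ℝ)⁻¹) := by
  classical
  set P := Measure.pi fun _ : Fin n => μ with hP
  set τ := ∫ z, f z ∂(μ.prod μ) with hτ
  have hn0 : (0 : ℝ) < n := by exact_mod_cast (by omega : 0 < n)
  have hn2 : (2 : ℝ) ≤ n := by exact_mod_cast hn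
  have hlog : 0 ≤ Real.log n := Real.log_nonneg (by linarith)
  -- Two different increasing pairs with the same index sum are disjoint. This splits all pairs into
  -- at most `2n` classes, each carrying a sum of at most `n` independent terms.
  set cls : ℕ → Finset (Fin n × Fin n) := fun s =>
    Finset.univ.filter fun p => p.1 < p.2 ∧ (p.1 : ℕ) + p.2 = s with hcls
  have hsub : ∀ p : Fin n × Fin n, p.1 < p.2 →
      HasSubgaussianMGF (fun x : Fin n → E => f (x p.1, x p.2) - τ) 1 P := by
    intro p hp
    have h := hasSubgaussianMGF_of_mem_Icc (μ := P) (X := fun x : Fin n → E => f (x p.1, x p.2))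
      (a := -1) (b := 1) (by fun_prop) (Eventually.of_forall fun x => abs_le.1 (hfB _))
    have hint : ∫ x, f (x p.1, x p.2) ∂P = τ := by
      rw [hτ, ← map_pair_pi (μ := μ) hp.ne, integral_map (by fun_prop) hf.aestronglyMeasurable]
    rw [hint] at h
    refine HasSubgaussianMGF.mono h (le_of_eq ?_)
    ext
    push_cast
    norm_num
  have hclass : ∀ s : ℕ, HasSubgaussianMGF
      (fun x : Fin n → E => ∑ p ∈ cls s, (f (x p.1, x p.2) - τ)) (n * 1 ^ 2) P := by
    intro s
    have h := hasSubgaussianMGF_sum_disjoint_pairs (μ := μ) (f := fun z => f z - τ) (c := 1)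
      (by fun_prop) (cls s) (by
        intro p hp q hq hpq
        simp only [hcls, Finset.mem_filter, Finset.mem_univ, true_and] at hp hq
        refine ⟨fun h => hpq ?_, fun h => ?_, fun h => ?_, fun h => hpq ?_⟩
        · refine Prod.ext h (Fin.ext ?_); rw [h] at hp; omega
        · rw [h] at hp; omega
        · rw [h] at hp; omega
        · refine Prod.ext (Fin.ext ?_) h; rw [h] at hp; omega) (by
        intro p hp
        simp only [hcls, Finset.mem_filter, Finset.mem_univ, true_and] at hp
        exact hsub p hp.1)
    refine HasSubgaussianMGF.mono h ?_
    have hcard : (cls s).card ≤ n := by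
      have : (cls s).card ≤ (Finset.univ : Finset (Fin n)).card := by
        refine Finset.card_le_card_of_injOn Prod.fst (fun _ _ => Finset.mem_coe.2 (Finset.mem_univ _))
          ?_
        intro p hp q hq hpq
        simp only [hcls, Finset.coe_filter, Finset.mem_univ, true_and, Set.mem_ofPred_eq] at hp hq
        refine Prod.ext hpq (Fin.ext ?_)
        rw [hpq] at hp; omega
      simpa using this
    simp only [mul_one, one_pow]
    exact_mod_cast hcard
  -- The exponent 2 pays for the union over `2n` classes and still leaves a total of order `n⁻¹`.
  have htail : ∀ s : ℕ, P {x | 2 * √(n * Real.log n) <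
      |∑ p ∈ cls s, (f (x p.1, x p.2) - τ)|} ≤ ENNReal.ofReal (2 * ((n : ℝ) ^ 2)⁻¹) := fun s =>
    measure_lt_abs_le_of_hasSubgaussianMGF (by omega) (hclass s) one_pos 2 (by norm_num)
      (by norm_num)
  have hincl : {x : Fin n → E | 16 * √(Real.log n / n) < |(n.choose 2 : ℝ)⁻¹ *
        ∑ p : Fin n × Fin n with p.1 < p.2, f (x p.1, x p.2) - τ|} ⊆
      ⋃ s ∈ Finset.range (2 * n), {x | 2 * √(n * Real.log n) <
        |∑ p ∈ cls s, (f (x p.1, x p.2) - τ)|} := by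
    intro x hx
    by_contra hnot
    simp only [Set.mem_iUnion, Set.mem_ofPred_eq, not_exists, not_lt] at hnot hx
    have hcount := card_filter_lt n
    have hch : (n.choose 2 : ℝ) = n * (n - 1) / 2 := Nat.cast_choose_two ℝ n
    have hchpos : (0 : ℝ) < n.choose 2 := by rw [hch]; nlinarith
    have hdecomp : ∑ p : Fin n × Fin n with p.1 < p.2, (f (x p.1, x p.2) - τ) =
        ∑ s ∈ Finset.range (2 * n), ∑ p ∈ cls s, (f (x p.1, x p.2) - τ) := by
      rw [← Finset.sum_fiberwise_of_maps_to (g := fun p : Fin n × Fin n => (p.1 : ℕ) + p.2)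
        (t := Finset.range (2 * n)) (by
          intro p _
          rw [Finset.mem_range]
          omega)]
      refine Finset.sum_congr rfl fun s _ => ?_
      rw [Finset.filter_filter]
    have hb : |∑ p : Fin n × Fin n with p.1 < p.2, (f (x p.1, x p.2) - τ)| ≤
        2 * n * (2 * √(n * Real.log n)) := by
      rw [hdecomp]
      refine (Finset.abs_sum_le_sum_abs _ _).trans
        ((Finset.sum_le_card_nsmul _ _ _ fun s hs => hnot s hs).trans (le_of_eq ?_))
      simp
    have hrew : (n.choose 2 : ℝ)⁻¹ *
        ∑ p : Fin n × Fin n with p.1 < p.2, f (x p.1, x p.2) - τ =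
        (n.choose 2 : ℝ)⁻¹ * ∑ p : Fin n × Fin n with p.1 < p.2, (f (x p.1, x p.2) - τ) := by
      rw [Finset.sum_sub_distrib, Finset.sum_const, hcount, nsmul_eq_mul]
      field_simp
    rw [hrew, abs_mul, abs_inv, abs_of_pos hchpos, lt_inv_mul_iff₀ hchpos] at hx
    have hsq : √(n * Real.log n) = n * √(Real.log n / n) := by
      rw [show (n : ℝ) * Real.log n = n ^ 2 * (Real.log n / n) by field_simp,
        Real.sqrt_mul (by positivity), Real.sqrt_sq hn0.le]
    rw [hsq] at hb
    have hlt := hx.trans_le hb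
    rw [hch] at hlt
    have hr : 0 ≤ √(Real.log n / n) := Real.sqrt_nonneg _
    -- The classes add up to at most `4 n² √(log n / n)`; division by `n (n - 1) / 2` gives the
    -- factor `8 n / (n - 1)`, which is at most 16 for `n ≥ 2`.
    nlinarith [mul_nonneg (mul_nonneg hn0.le (by linarith : (0 : ℝ) ≤ n - 2)) hr]
  calc _ ≤ ∑ s ∈ Finset.range (2 * n), P {x | 2 * √(n * Real.log n) <
        |∑ p ∈ cls s, (f (x p.1, x p.2) - τ)|} :=
        (measure_mono hincl).trans (measure_biUnion_finset_le _ _)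
    _ ≤ ∑ s ∈ Finset.range (2 * n), ENNReal.ofReal (2 * ((n : ℝ) ^ 2)⁻¹) :=
        Finset.sum_le_sum fun s _ => htail s
    _ = ENNReal.ofReal (4 * (n : ℝ)⁻¹) := by
        rw [Finset.sum_const, Finset.card_range, nsmul_eq_mul, ← ENNReal.ofReal_natCast,
          ← ENNReal.ofReal_mul (by positivity)]
        congr 1
        push_cast
        field_simp
        ring

end Pi

/-! ### The spherical t law and its marginals -/

/-- The spherical law `t_γ(0, I)` on Euclidean space. -/
noncomputable def sphericalT (k : ℕ) (γ : ℝ) : Measure (EuclideanSpace ℝ (Fin k)) :=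
  volume.withDensity fun z =>
    ENNReal.ofReal (tConst k γ * (γ + ‖z‖ ^ 2) ^ (-((γ + k) / 2)))

lemma map_withDensity_equiv {α β : Type*} [MeasurableSpace α] [MeasurableSpace β] {μ : Measure α}
    {ν : Measure β} (e : α ≃ᵐ β) (he : MeasurePreserving e μ ν) {f : α → ℝ≥0∞} {g : β → ℝ≥0∞}
    (hfg : ∀ x, f x = g (e x)) (hg : Measurable g) :
    (μ.withDensity f).map e = ν.withDensity g := by
  ext s hs
  rw [e.map_apply, withDensity_apply _ (e.measurable hs), withDensity_apply _ hs, ← he.map_eq,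
    setLIntegral_map hs hg e.measurable]
  simp only [hfg]

lemma measurable_sphericalT_density (k : ℕ) (γ : ℝ) :
    Measurable fun z : EuclideanSpace ℝ (Fin k) =>
      ENNReal.ofReal (tConst k γ * (γ + ‖z‖ ^ 2) ^ (-((γ + k) / 2))) := by
  fun_prop

lemma map_toLp_multivariateT_one (k : ℕ) (γ : ℝ) :
    (multivariateT γ (1 : Matrix (Fin k) (Fin k) ℝ)).map (WithLp.toLp 2) = sphericalT k γ := by
  refine map_withDensity_equiv (MeasurableEquiv.toLp 2 (Fin k → ℝ))
    (PiLp.volume_preserving_toLp (Fin k)) (fun z => ?_) (measurable_sphericalT_density k γ)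
  simp [tDensity, EuclideanSpace.norm_sq_eq, dotProduct, ← sq]

lemma map_ofLp_sphericalT (k : ℕ) (γ : ℝ) :
    (sphericalT k γ).map WithLp.ofLp = multivariateT γ (1 : Matrix (Fin k) (Fin k) ℝ) := by
  rw [← map_toLp_multivariateT_one, Measure.map_map (WithLp.measurable_ofLp 2 _)
    (WithLp.measurable_toLp 2 _)]
  exact Measure.map_id

lemma isProbabilityMeasure_sphericalT (k : ℕ) {γ : ℝ} (hγ : 0 < γ) :
    IsProbabilityMeasure (sphericalT k γ) := by
  have := isProbabilityMeasure_multivariateT_one k hγ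
  rw [← map_toLp_multivariateT_one]
  exact Measure.isProbabilityMeasure_map (WithLp.measurable_toLp 2 _).aemeasurable

/-- Lebesgue measure and a density depending on `‖z‖` alone are both invariant under linear
isometries. -/
lemma measurePreserving_sphericalT {k : ℕ} (γ : ℝ)
    (e : EuclideanSpace ℝ (Fin k) ≃ₗᵢ[ℝ] EuclideanSpace ℝ (Fin k)) :
    MeasurePreserving e (sphericalT k γ) (sphericalT k γ) := by
  refine ⟨e.continuous.measurable, ?_⟩
  exact map_withDensity_equiv e.toMeasurableEquiv e.measurePreserving
    (fun z => by simp) (measurable_sphericalT_density k γ)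

/-- The t law is a linear image of the spherical one. -/
lemma exists_multivariateT_eq_map {k : ℕ} {γ : ℝ} (hγ : 0 < γ) {A : Matrix (Fin k) (Fin k) ℝ}
    (hA : A.PosDef) : ∃ b : Fin k → EuclideanSpace ℝ (Fin k),
      (∀ j j', inner ℝ (b j) (b j') = A⁻¹ j j') ∧
      multivariateT γ A = (sphericalT k γ).map fun z j => inner ℝ (b j) z := by
  obtain ⟨B, hB, rfl⟩ := exists_transpose_mul_self hA
  have hmeas : Measurable (fun z : Fin k → ℝ => B⁻¹ *ᵥ z) :=
    (Matrix.toLin' B⁻¹).continuous_of_finiteDimensional.measurable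
  refine ⟨fun j => WithLp.toLp 2 fun i => B⁻¹ j i, fun j j' => ?_, ?_⟩
  · rw [Matrix.mul_inv_rev, ← Matrix.transpose_nonsing_inv, Matrix.mul_apply, PiLp.inner_apply]
    refine Finset.sum_congr rfl fun i _ => ?_
    simp [mul_comm]
  · rw [multivariateT_transpose_mul_self hγ hB, ← map_ofLp_sphericalT,
      Measure.map_map hmeas (WithLp.measurable_ofLp 2 _)]
    congr 1
    ext z j
    simp [Matrix.mulVec, dotProduct, PiLp.inner_apply, mul_comm]

/-- The kernel of the univariate t density. -/
noncomputable def tKernelOne (γ s : ℝ) : ℝ := (γ + s ^ 2) ^ (-((γ + 1) / 2))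

/-- The univariate t law. -/
noncomputable def univariateT (γ : ℝ) : Measure ℝ :=
  volume.withDensity fun s => ENNReal.ofReal ((∫ t, tKernelOne γ t)⁻¹ * tKernelOne γ s)

lemma tKernelOne_pos {γ : ℝ} (hγ : 0 < γ) (s : ℝ) : 0 < tKernelOne γ s :=
  Real.rpow_pos_of_pos (by positivity) _

lemma continuous_tKernelOne {γ : ℝ} (hγ : 0 < γ) : Continuous (tKernelOne γ) := by
  unfold tKernelOne
  exact Continuous.rpow_const (by fun_prop) fun s => Or.inl (by positivity)

/-- Rescaling `y` by `R = √(γ + s²)` produces the Jacobian `R ^ m` against `R ^ (-(γ + m + 1))`;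
what remains, `R ^ (-(γ + 1))`, is the univariate kernel. -/
lemma integral_tKernel_section (m : ℕ) {γ : ℝ} (hγ : 0 < γ) (s : ℝ) :
    ∫ y : Fin m → ℝ, (γ + s ^ 2 + y ⬝ᵥ y) ^ (-((γ + (m + 1 : ℕ)) / 2)) =
      tKernelOne γ s * ∫ y : Fin m → ℝ, (1 + y ⬝ᵥ y) ^ (-((γ + (m + 1 : ℕ)) / 2)) := by
  set R := √(γ + s ^ 2) with hR
  have hpos : 0 < γ + s ^ 2 := by positivity
  have hRpos : 0 < R := Real.sqrt_pos.2 hpos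
  have hRsq : R ^ 2 = γ + s ^ 2 := Real.sq_sqrt hpos.le
  have h := Measure.integral_comp_smul_of_nonneg (volume : Measure (Fin m → ℝ))
    (fun y => (γ + s ^ 2 + y ⬝ᵥ y) ^ (-((γ + (m + 1 : ℕ)) / 2))) R (hR := hRpos.le)
  have h2 : ∀ y : Fin m → ℝ, (γ + s ^ 2 + (R • y) ⬝ᵥ (R • y)) ^ (-((γ + (m + 1 : ℕ)) / 2)) =
      (R ^ 2) ^ (-((γ + (m + 1 : ℕ)) / 2)) * (1 + y ⬝ᵥ y) ^ (-((γ + (m + 1 : ℕ)) / 2)) := by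
    intro y
    have hy := dotProduct_self_nonneg' y
    rw [← Real.mul_rpow (by positivity) (by positivity), ← hRsq]
    congr 1
    rw [smul_dotProduct, dotProduct_smul, smul_eq_mul, smul_eq_mul]
    ring
  simp only [h2] at h
  rw [integral_const_mul, Module.finrank_fin_fun, smul_eq_mul, eq_comm,
    inv_mul_eq_iff_eq_mul₀ (by positivity)] at h
  rw [h, ← mul_assoc, tKernelOne, ← hRsq]
  congr 1
  rw [← Real.rpow_natCast R 2, ← Real.rpow_natCast R m, ← Real.rpow_mul hRpos.le,
    ← Real.rpow_mul hRpos.le, ← Real.rpow_add hRpos]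
  congr 1
  push_cast
  ring

/-- Integrating out the other coordinates gives a multiple of the univariate kernel. The multiple is
never computed: it is forced by total mass one. -/
lemma map_eval_zero_multivariateT_one (m : ℕ) {γ : ℝ} (hγ : 0 < γ) :
    (multivariateT γ (1 : Matrix (Fin (m + 1)) (Fin (m + 1)) ℝ)).map (fun z => z 0) =
      univariateT γ := by
  set M := (multivariateT γ (1 : Matrix (Fin (m + 1)) (Fin (m + 1)) ℝ)).map (fun z => z 0) with hM
  have hprob := isProbabilityMeasure_multivariateT_one (m + 1) hγ
  have hMprob : IsProbabilityMeasure M :=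
    Measure.isProbabilityMeasure_map (measurable_pi_apply 0).aemeasurable
  set K := tConst (m + 1) γ * ∫ y : Fin m → ℝ, (1 + y ⬝ᵥ y) ^ (-((γ + (m + 1 : ℕ)) / 2)) with hK
  have hK0 : 0 ≤ K := mul_nonneg (tConst_pos _ hγ).le (integral_nonneg fun y => by
    have := dotProduct_self_nonneg' y
    positivity)
  have hsec : ∀ s : ℝ, ∫⁻ y : Fin m → ℝ, ENNReal.ofReal (tConst (m + 1) γ *
      (γ + s ^ 2 + y ⬝ᵥ y) ^ (-((γ + (m + 1 : ℕ)) / 2))) =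
      ENNReal.ofReal (K * tKernelOne γ s) := by
    intro s
    have hi := integrable_tKernel m (g := γ + s ^ 2) (γ := γ + 1) (by positivity) (by positivity)
    have he : γ + 1 + (m : ℝ) = γ + (m + 1 : ℕ) := by push_cast; ring
    rw [he] at hi
    rw [← ofReal_integral_eq_lintegral_ofReal (hi.const_mul _)
      (Eventually.of_forall fun y => mul_nonneg (tConst_pos _ hγ).le (by
        have := dotProduct_self_nonneg' y
        positivity)), integral_const_mul, integral_tKernel_section m hγ s]
    congr 1
    rw [hK]; ring
  have hdens : M = volume.withDensity fun s => ENNReal.ofReal (K * tKernelOne γ s) := by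
    have e := volume_preserving_piFinSuccAbove (fun _ : Fin (m + 1) => ℝ) 0
    have hmeasG : Measurable fun p : ℝ × (Fin m → ℝ) => ENNReal.ofReal (tConst (m + 1) γ *
        (γ + p.1 ^ 2 + p.2 ⬝ᵥ p.2) ^ (-((γ + (m + 1 : ℕ)) / 2))) := by
      simp only [dotProduct]
      fun_prop
    have h1 : (multivariateT γ (1 : Matrix (Fin (m + 1)) (Fin (m + 1)) ℝ)).map
        (MeasurableEquiv.piFinSuccAbove (fun _ : Fin (m + 1) => ℝ) 0) =
        (volume : Measure (ℝ × (Fin m → ℝ))).withDensity fun p =>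
          ENNReal.ofReal (tConst (m + 1) γ *
            (γ + p.1 ^ 2 + p.2 ⬝ᵥ p.2) ^ (-((γ + (m + 1 : ℕ)) / 2))) := by
      refine map_withDensity_equiv _ e (fun z => ?_) hmeasG
      simp only [tDensity, Matrix.det_one, Real.sqrt_one, mul_one, Matrix.one_mulVec, dotProduct,
        Fin.sum_univ_succ, MeasurableEquiv.piFinSuccAbove_apply, Fin.insertNthEquiv_zero,
        Fin.consEquiv_symm_apply, Fin.tail, sq, add_assoc]
    have h2 : M = ((multivariateT γ (1 : Matrix (Fin (m + 1)) (Fin (m + 1)) ℝ)).map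
        (MeasurableEquiv.piFinSuccAbove (fun _ : Fin (m + 1) => ℝ) 0)).map Prod.fst := by
      rw [Measure.map_map measurable_fst (MeasurableEquiv.measurable _)]
      rfl
    rw [h2, h1]
    ext s hs
    rw [Measure.map_apply measurable_fst hs, withDensity_apply _ (measurable_fst hs),
      withDensity_apply _ hs, ← Set.prod_univ, Measure.volume_eq_prod,
      ← Measure.prod_restrict, Measure.restrict_univ, lintegral_prod _ hmeasG.aemeasurable]
    simp only [hsec]
  have hmeasK : Measurable (tKernelOne γ) := (continuous_tKernelOne hγ).measurable
  have hone : ∫ s, K * tKernelOne γ s = 1 := by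
    rw [integral_eq_lintegral_of_nonneg_ae
      (Eventually.of_forall fun s => mul_nonneg hK0 (tKernelOne_pos hγ s).le)
      (hmeasK.const_mul K).aestronglyMeasurable, ← setLIntegral_univ,
      ← withDensity_apply _ MeasurableSet.univ, ← hdens]
    simp
  rw [integral_const_mul] at hone
  rw [hdens, univariateT, eq_inv_of_mul_eq_one_left hone]

lemma isProbabilityMeasure_univariateT {γ : ℝ} (hγ : 0 < γ) :
    IsProbabilityMeasure (univariateT γ) := by
  have := isProbabilityMeasure_multivariateT_one 1 hγ
  rw [← map_eval_zero_multivariateT_one 0 hγ]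
  exact Measure.isProbabilityMeasure_map (measurable_pi_apply 0).aemeasurable

/-- Every one-dimensional projection of the spherical t law is the univariate t law. -/
lemma map_inner_sphericalT {k : ℕ} {γ : ℝ} (hγ : 0 < γ) {u : EuclideanSpace ℝ (Fin k)}
    (hu : ‖u‖ = 1) : (sphericalT k γ).map (fun z => inner ℝ u z) = univariateT γ := by
  obtain _ | m := k
  · have : u = 0 := Subsingleton.elim _ _
    simp [this] at hu
  set e₀ : EuclideanSpace ℝ (Fin (m + 1)) := EuclideanSpace.single 0 1 with he₀
  have he₀n : ‖e₀‖ = 1 := by simp [he₀]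
  -- A single reflection carries `u` to the first basis vector, and the spherical law is invariant
  -- under it.
  set R := (ℝ ∙ (u - e₀))ᗮ.reflection with hR
  have hRu : R u = e₀ := Submodule.reflection_sub (hu.trans he₀n.symm)
  have hfun : (fun z => inner ℝ u z) = (fun z : EuclideanSpace ℝ (Fin (m + 1)) => inner ℝ e₀ z) ∘ R := by
    ext z
    rw [Function.comp_apply, ← hRu, LinearIsometryEquiv.inner_map_map]
  have hm : Measurable fun z : EuclideanSpace ℝ (Fin (m + 1)) => inner ℝ e₀ z :=
    (continuous_const.inner continuous_id).measurable
  rw [hfun, ← Measure.map_map hm R.continuous.measurable,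
    (measurePreserving_sphericalT γ R).map_eq, ← map_toLp_multivariateT_one,
    Measure.map_map hm (WithLp.measurable_toLp 2 _), ← map_eval_zero_multivariateT_one m hγ]
  congr 1
  ext z
  simp [he₀, EuclideanSpace.inner_single_left]

lemma univariateT_absolutelyContinuous (γ : ℝ) : univariateT γ ≪ volume :=
  withDensity_absolutelyContinuous _ _

/-! ### The expectation of Kendall's tau -/

lemma measurable_realSign : Measurable Real.sign := by
  unfold Real.sign
  exact Measurable.ite measurableSet_Iio measurable_const
    (Measurable.ite measurableSet_Ioi measurable_const measurable_const)

lemma abs_realSign_le (x : ℝ) : |Real.sign x| ≤ 1 := by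
  rcases Real.sign_apply_eq x with h | h | h <;> simp [h]

lemma realSign_mul_of_pos {r : ℝ} (hr : 0 < r) (x : ℝ) : Real.sign (r * x) = Real.sign x := by
  rcases lt_trichotomy x 0 with hx | rfl | hx
  · rw [Real.sign_of_neg hx, Real.sign_of_neg (mul_neg_of_pos_of_neg hr hx)]
  · simp
  · rw [Real.sign_of_pos hx, Real.sign_of_pos (mul_pos hr hx)]

lemma intervalIntegral_eq_of_eq_const {f : ℝ → ℝ} {a b c : ℝ} (hab : a ≤ b)
    (h : ∀ x ∈ Set.Ioo a b, f x = c) : ∫ x in a..b, f x = (b - a) * c := by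
  rw [intervalIntegral.integral_of_le hab, integral_Ioc_eq_integral_Ioo,
    setIntegral_congr_fun measurableSet_Ioo h, setIntegral_const,
    Real.volume_real_Ioo_of_le hab, smul_eq_mul]

/-- The mean of `sign (cos φ cos (φ + α))` over a period. -/
lemma integral_sign_cos_mul_cos {α : ℝ} (h0 : 0 ≤ α) (hπ : α ≤ Real.pi) :
    ∫ φ in (0)..(2 * Real.pi), Real.sign (Real.cos φ * Real.cos (φ + α)) =
      2 * Real.pi - 4 * α := by
  have hpi := Real.pi_pos
  set g : ℝ → ℝ := fun φ => Real.sign (Real.cos φ * Real.cos (φ + α)) with hg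
  have hper : Function.Periodic g Real.pi := fun φ => by
    simp only [hg, add_right_comm φ Real.pi α, Real.cos_add_pi, neg_mul_neg]
  have hgm : Measurable g := measurable_realSign.comp (by fun_prop)
  have hint : ∀ a b : ℝ, IntervalIntegrable g volume a b := fun a b =>
    (intervalIntegrable_const (c := (1 : ℝ))).mono_fun' hgm.aestronglyMeasurable
      (Eventually.of_forall fun φ => by simpa [hg] using abs_realSign_le _)
  -- Both cosines change sign under a shift by `π`, so the integrand is `π`-periodic. The period
  -- `(-π/2, π/2)` is convenient because `cos φ > 0` there and the other cosine changes sign only at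
  -- `π/2 - α`.
  have h1 : ∫ φ in (0)..(2 * Real.pi), g φ = 2 * ∫ φ in (-(Real.pi / 2))..(Real.pi / 2), g φ := by
    rw [← intervalIntegral.integral_add_adjacent_intervals (hint 0 Real.pi) (hint _ _)]
    have e1 := hper.intervalIntegral_add_eq 0 (-(Real.pi / 2))
    have e2 := hper.intervalIntegral_add_eq Real.pi (-(Real.pi / 2))
    rw [zero_add] at e1
    rw [show -(Real.pi / 2) + Real.pi = Real.pi / 2 by ring] at e1 e2
    rw [show Real.pi + Real.pi = 2 * Real.pi by ring] at e2
    rw [e1, e2]; ring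
  have h2 : ∫ φ in (-(Real.pi / 2))..(Real.pi / 2 - α), g φ = Real.pi - α := by
    rw [intervalIntegral_eq_of_eq_const (c := 1) (by linarith) fun φ hφ => ?_]
    · ring
    · refine Real.sign_of_pos (mul_pos (Real.cos_pos_of_mem_Ioo ⟨hφ.1, ?_⟩)
        (Real.cos_pos_of_mem_Ioo ⟨?_, ?_⟩)) <;> linarith [hφ.1, hφ.2]
  have h3 : ∫ φ in (Real.pi / 2 - α)..(Real.pi / 2), g φ = -α := by
    rw [intervalIntegral_eq_of_eq_const (c := -1) (by linarith) fun φ hφ => ?_]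
    · ring
    · refine Real.sign_of_neg (mul_neg_of_pos_of_neg (Real.cos_pos_of_mem_Ioo ⟨?_, ?_⟩)
        (Real.cos_neg_of_pi_div_two_lt_of_lt ?_ ?_)) <;> linarith [hφ.1, hφ.2]
  rw [h1, ← intervalIntegral.integral_add_adjacent_intervals (hint _ (Real.pi / 2 - α)) (hint _ _),
    h2, h3]
  ring

/-- Averaging over rotations in the plane. -/
lemma integral_sign_rotation {α : ℝ} (h0 : 0 ≤ α) (hπ : α ≤ Real.pi) {U V : ℝ}
    (hUV : U ≠ 0 ∨ V ≠ 0) :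
    ∫ φ in (0)..(2 * Real.pi), Real.sign ((Real.cos φ * U - Real.sin φ * V) *
      (Real.cos α * (Real.cos φ * U - Real.sin φ * V) -
        Real.sin α * (Real.sin φ * U + Real.cos φ * V))) = 2 * Real.pi - 4 * α := by
  -- In polar coordinates `U + iV = ρ e^{iψ}` the two factors are `ρ cos(φ + ψ)` and `ρ cos(φ + ψ +
  -- α)`: the radius drops out of the sign and the phase out of the integral over a period.
  set w : ℂ := ⟨U, V⟩ with hw
  have hw0 : w ≠ 0 := by
    intro h
    have h1 := congrArg Complex.re h
    have h2 := congrArg Complex.im h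
    simp only [hw, Complex.zero_re, Complex.zero_im] at h1 h2
    tauto
  set ρ := ‖w‖ with hρ
  have hρpos : 0 < ρ := norm_pos_iff.2 hw0
  set ψ := Complex.arg w with hψ
  have hU : U = ρ * Real.cos ψ := by
    rw [hρ, hψ, Complex.norm_mul_cos_arg]
  have hV : V = ρ * Real.sin ψ := by
    rw [hρ, hψ, Complex.norm_mul_sin_arg]
  set g : ℝ → ℝ := fun φ => Real.sign (Real.cos φ * Real.cos (φ + α)) with hg
  have hper : Function.Periodic g (2 * Real.pi) := fun φ => by
    simp only [hg, add_right_comm φ _ α, Real.cos_add_two_pi]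
  have h1 : ∀ φ : ℝ, Real.sign ((Real.cos φ * U - Real.sin φ * V) *
      (Real.cos α * (Real.cos φ * U - Real.sin φ * V) -
        Real.sin α * (Real.sin φ * U + Real.cos φ * V))) = g (φ + ψ) := by
    intro φ
    simp only [hg]
    rw [hU, hV, ← realSign_mul_of_pos (sq_pos_of_pos hρpos) (Real.cos (φ + ψ) * _)]
    congr 1
    rw [Real.cos_add (φ + ψ) α, Real.cos_add, Real.sin_add]
    ring
  simp only [h1]
  rw [intervalIntegral.integral_comp_add_right, zero_add, add_comm (2 * Real.pi) ψ,
    hper.intervalIntegral_add_eq ψ 0, zero_add]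
  exact integral_sign_cos_mul_cos h0 hπ

/-- The rotation by `φ` in the plane spanned by the orthonormal vectors `a` and `c`. -/
lemma exists_planeRotation {k : ℕ} {a c : EuclideanSpace ℝ (Fin k)} (ha : ‖a‖ = 1) (hc : ‖c‖ = 1)
    (hac : inner ℝ a c = (0 : ℝ)) (φ : ℝ) :
    ∃ e : EuclideanSpace ℝ (Fin k) ≃ₗᵢ[ℝ] EuclideanSpace ℝ (Fin k), ∀ z,
      inner ℝ a (e z) = Real.cos φ * inner ℝ a z - Real.sin φ * inner ℝ c z ∧
      inner ℝ c (e z) = Real.sin φ * inner ℝ a z + Real.cos φ * inner ℝ c z := by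
  have haa : inner ℝ a a = (1 : ℝ) := by rw [real_inner_self_eq_norm_sq, ha]; norm_num
  have hcc : inner ℝ c c = (1 : ℝ) := by rw [real_inner_self_eq_norm_sq, hc]; norm_num
  have hca : inner ℝ c a = (0 : ℝ) := by rw [real_inner_comm, hac]
  -- The rotation is written as the identity plus a correction in the span of `a` and `c`, so no
  -- complement of the plane is needed; norm preservation is a direct expansion, and equal finite
  -- dimensions give bijectivity.
  set L : EuclideanSpace ℝ (Fin k) →ₗ[ℝ] EuclideanSpace ℝ (Fin k) :=
    LinearMap.id + ((Real.cos φ - 1) • (innerₛₗ ℝ a) - Real.sin φ • (innerₛₗ ℝ c)).smulRight a +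
      (Real.sin φ • (innerₛₗ ℝ a) + (Real.cos φ - 1) • (innerₛₗ ℝ c)).smulRight c with hL
  have hLz : ∀ z, L z = z + ((Real.cos φ - 1) * inner ℝ a z - Real.sin φ * inner ℝ c z) • a +
      (Real.sin φ * inner ℝ a z + (Real.cos φ - 1) * inner ℝ c z) • c := fun z => by
    simp [hL]
  have hnorm : ∀ z, ‖L z‖ = ‖z‖ := by
    intro z
    rw [← sq_eq_sq₀ (norm_nonneg _) (norm_nonneg _), ← real_inner_self_eq_norm_sq,
      ← real_inner_self_eq_norm_sq, hLz]
    simp only [inner_add_left, inner_add_right, real_inner_smul_left, real_inner_smul_right, haa,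
      hcc, hac, hca, real_inner_comm a z, real_inner_comm c z]
    have := Real.sin_sq_add_cos_sq φ
    ring_nf
    linear_combination ((inner ℝ a z) ^ 2 + (inner ℝ c z) ^ 2) * this
  refine ⟨LinearIsometry.toLinearIsometryEquiv ⟨L, hnorm⟩ rfl, fun z => ?_⟩
  have he : (LinearIsometry.toLinearIsometryEquiv (⟨L, hnorm⟩ :
    EuclideanSpace ℝ (Fin k) →ₗᵢ[ℝ] EuclideanSpace ℝ (Fin k)) rfl) z = L z := rfl
  rw [he, hLz]
  simp only [inner_add_right, real_inner_smul_right, haa, hcc, hac, hca]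
  constructor <;> ring

/-- With one point fixed, the exceptional set is a level set of `⟪a, ·⟫`, and the law of this
projection has a density. -/
lemma ae_inner_sub_ne_zero {k : ℕ} {γ : ℝ} (hγ : 0 < γ) {a : EuclideanSpace ℝ (Fin k)}
    (ha : ‖a‖ = 1) :
    ∀ᵐ p ∂((sphericalT k γ).prod (sphericalT k γ)), inner ℝ a (p.1 - p.2) ≠ (0 : ℝ) := by
  have := isProbabilityMeasure_sphericalT k hγ
  have hm : Measurable fun z : EuclideanSpace ℝ (Fin k) => (inner ℝ a z : ℝ) :=
    (continuous_const.inner continuous_id).measurable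
  have hset : MeasurableSet {p : EuclideanSpace ℝ (Fin k) × EuclideanSpace ℝ (Fin k) |
      inner ℝ a (p.1 - p.2) = (0 : ℝ)} := by
    have : Measurable fun p : EuclideanSpace ℝ (Fin k) × EuclideanSpace ℝ (Fin k) =>
        (inner ℝ a (p.1 - p.2) : ℝ) := by
      exact Continuous.measurable (by fun_prop)
    exact this (measurableSet_singleton 0)
  rw [ae_iff]
  simp only [ne_eq, not_not]
  rw [Measure.measure_prod_null hset]
  refine Eventually.of_forall fun z => ?_
  have hpre : (Prod.mk z ⁻¹' {p : EuclideanSpace ℝ (Fin k) × EuclideanSpace ℝ (Fin k) |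
      inner ℝ a (p.1 - p.2) = (0 : ℝ)}) = (fun y => (inner ℝ a y : ℝ)) ⁻¹' {inner ℝ a z} := by
    ext y
    simp only [Set.mem_preimage, Set.mem_ofPred_eq, Set.mem_singleton_iff, inner_sub_right]
    constructor <;> intro h <;> linarith
  change sphericalT k γ (Prod.mk z ⁻¹' _) = 0
  rw [hpre, ← Measure.map_apply hm (measurableSet_singleton _), map_inner_sphericalT hγ ha]
  exact univariateT_absolutelyContinuous γ (by simp)

/-- The product law is unchanged when both points are rotated by the same angle in the plane of `a`
and `c`. The integral thus equals its average over the angle, and after Fubini the planar average is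
the same for almost every pair of points. The radial law never enters, whence the independence of
`γ`. -/
lemma integral_sign_plane {k : ℕ} {γ : ℝ} (hγ : 0 < γ) {a c : EuclideanSpace ℝ (Fin k)}
    (ha : ‖a‖ = 1) (hc : ‖c‖ = 1) (hac : inner ℝ a c = (0 : ℝ)) {α : ℝ} (h0 : 0 ≤ α)
    (hπ : α ≤ Real.pi) :
    ∫ p, Real.sign (inner ℝ a (p.1 - p.2) *
      (Real.cos α * inner ℝ a (p.1 - p.2) - Real.sin α * inner ℝ c (p.1 - p.2)))
      ∂((sphericalT k γ).prod (sphericalT k γ)) = 1 - 2 * α / Real.pi := by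
  have := isProbabilityMeasure_sphericalT k hγ
  set P := (sphericalT k γ).prod (sphericalT k γ) with hP
  set G : ℝ → ℝ → ℝ := fun U V => Real.sign (U * (Real.cos α * U - Real.sin α * V)) with hG
  set I := ∫ p, G (inner ℝ a (p.1 - p.2)) (inner ℝ c (p.1 - p.2)) ∂P with hI
  have hpi := Real.pi_pos
  have hrot : ∀ φ : ℝ, ∫ p, G (Real.cos φ * inner ℝ a (p.1 - p.2) - Real.sin φ *
      inner ℝ c (p.1 - p.2)) (Real.sin φ * inner ℝ a (p.1 - p.2) + Real.cos φ *
      inner ℝ c (p.1 - p.2)) ∂P = I := by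
    intro φ
    obtain ⟨e, he⟩ := exists_planeRotation ha hc hac φ
    have hpres := (measurePreserving_sphericalT γ e).prod (measurePreserving_sphericalT γ e)
    have hcomp := hpres.integral_comp' (f := (e.toMeasurableEquiv.prodCongr e.toMeasurableEquiv))
      (fun p => G (inner ℝ a (p.1 - p.2)) (inner ℝ c (p.1 - p.2)))
    rw [hI, ← hcomp]
    refine integral_congr_ae (Eventually.of_forall fun p => ?_)
    have h1 : (e.toMeasurableEquiv.prodCongr e.toMeasurableEquiv p).1 -
        (e.toMeasurableEquiv.prodCongr e.toMeasurableEquiv p).2 = e (p.1 - p.2) := by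
      rw [map_sub]; rfl
    simp only [h1]
    rw [(he _).1, (he _).2]
  have hmeas : Measurable fun q : ℝ × (EuclideanSpace ℝ (Fin k) × EuclideanSpace ℝ (Fin k)) =>
      G (Real.cos q.1 * inner ℝ a (q.2.1 - q.2.2) - Real.sin q.1 * inner ℝ c (q.2.1 - q.2.2))
        (Real.sin q.1 * inner ℝ a (q.2.1 - q.2.2) + Real.cos q.1 * inner ℝ c (q.2.1 - q.2.2)) := by
    refine measurable_realSign.comp (Continuous.measurable ?_)
    fun_prop
  have hintg : Integrable (fun q : ℝ × (EuclideanSpace ℝ (Fin k) × EuclideanSpace ℝ (Fin k)) =>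
      G (Real.cos q.1 * inner ℝ a (q.2.1 - q.2.2) - Real.sin q.1 * inner ℝ c (q.2.1 - q.2.2))
        (Real.sin q.1 * inner ℝ a (q.2.1 - q.2.2) + Real.cos q.1 * inner ℝ c (q.2.1 - q.2.2)))
      ((volume.restrict (Set.Ioc 0 (2 * Real.pi))).prod P) :=
    Integrable.of_bound hmeas.aestronglyMeasurable 1
      (Eventually.of_forall fun q => by rw [Real.norm_eq_abs]; exact abs_realSign_le _)
  have hswap := integral_integral_swap (f := fun φ (p : EuclideanSpace ℝ (Fin k) ×
    EuclideanSpace ℝ (Fin k)) => G (Real.cos φ * inner ℝ a (p.1 - p.2) -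
      Real.sin φ * inner ℝ c (p.1 - p.2)) (Real.sin φ * inner ℝ a (p.1 - p.2) + Real.cos φ *
      inner ℝ c (p.1 - p.2))) hintg
  have hleft : ∫ φ in Set.Ioc 0 (2 * Real.pi), ∫ p, G (Real.cos φ * inner ℝ a (p.1 - p.2) -
      Real.sin φ * inner ℝ c (p.1 - p.2)) (Real.sin φ * inner ℝ a (p.1 - p.2) + Real.cos φ *
      inner ℝ c (p.1 - p.2)) ∂P = 2 * Real.pi * I := by
    simp only [hrot]
    rw [setIntegral_const, Real.volume_real_Ioc_of_le (by positivity), smul_eq_mul, sub_zero]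
  have hright : ∫ p, (∫ φ in Set.Ioc 0 (2 * Real.pi), G (Real.cos φ * inner ℝ a (p.1 - p.2) -
      Real.sin φ * inner ℝ c (p.1 - p.2)) (Real.sin φ * inner ℝ a (p.1 - p.2) + Real.cos φ *
      inner ℝ c (p.1 - p.2))) ∂P = 2 * Real.pi - 4 * α := by
    have : ∀ᵐ p ∂P, ∫ φ in Set.Ioc 0 (2 * Real.pi), G (Real.cos φ * inner ℝ a (p.1 - p.2) -
      Real.sin φ * inner ℝ c (p.1 - p.2)) (Real.sin φ * inner ℝ a (p.1 - p.2) + Real.cos φ *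
      inner ℝ c (p.1 - p.2)) = 2 * Real.pi - 4 * α := by
      filter_upwards [ae_inner_sub_ne_zero hγ ha] with p hp
      rw [← intervalIntegral.integral_of_le (by positivity)]
      exact integral_sign_rotation h0 hπ (Or.inl hp)
    rw [integral_congr_ae this]
    simp
  have hfin : 2 * Real.pi * I = 2 * Real.pi - 4 * α := by
    rw [← hleft, ← hright]; exact hswap
  change I = _
  field_simp
  linarith

/-- The expectation of Kendall's tau under the spherical t law. -/
lemma sin_integral_sign {k : ℕ} {γ : ℝ} (hγ : 0 < γ) {u v : EuclideanSpace ℝ (Fin k)}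
    (hu : u ≠ 0) (hv : v ≠ 0) :
    Real.sin (Real.pi / 2 * ∫ p, Real.sign (inner ℝ u (p.1 - p.2) * inner ℝ v (p.1 - p.2))
      ∂((sphericalT k γ).prod (sphericalT k γ))) = inner ℝ u v / (‖u‖ * ‖v‖) := by
  have := isProbabilityMeasure_sphericalT k hγ
  have hun : 0 < ‖u‖ := norm_pos_iff.2 hu
  have hvn : 0 < ‖v‖ := norm_pos_iff.2 hv
  set a := ‖u‖⁻¹ • u with ha
  set b := ‖v‖⁻¹ • v with hb
  have han : ‖a‖ = 1 := by simp [ha, norm_smul, hun.ne']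
  have hbn : ‖b‖ = 1 := by simp [hb, norm_smul, hvn.ne']
  set r : ℝ := inner ℝ a b with hr
  have hruv : inner ℝ u v / (‖u‖ * ‖v‖) = r := by
    rw [hr, ha, hb, real_inner_smul_left, real_inner_smul_right]
    field_simp
  have hnormalize : ∀ d : EuclideanSpace ℝ (Fin k),
      Real.sign (inner ℝ u d * inner ℝ v d) = Real.sign (inner ℝ a d * inner ℝ b d) := by
    intro d
    have hpos : 0 < ‖u‖⁻¹ * ‖v‖⁻¹ := by positivity
    rw [← realSign_mul_of_pos hpos, ha, hb, real_inner_smul_left, real_inner_smul_left]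
    congr 1; ring
  simp only [hnormalize, hruv]
  clear_value a b
  have hr1 : |r| ≤ 1 := by
    have := abs_real_inner_le_norm a b
    rwa [han, hbn, mul_one] at this
  have haa : inner ℝ a a = (1 : ℝ) := by rw [real_inner_self_eq_norm_sq, han]; norm_num
  have hbb : inner ℝ b b = (1 : ℝ) := by rw [real_inner_self_eq_norm_sq, hbn]; norm_num
  -- If `b` is a multiple of `a` there is no second direction to rotate into; then `r = ±1` and the
  -- sign is almost surely the constant `r`.
  rcases eq_or_ne b (r • a) with hcol | hcol
  · have hr2 : r * r = 1 := by
      have h2 : inner ℝ b b = r * r := by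
        conv_lhs => rw [hcol]
        rw [real_inner_smul_left, real_inner_smul_right, haa]; ring
      rw [← h2, hbb]
    have hsign : ∀ᵐ p ∂((sphericalT k γ).prod (sphericalT k γ)),
        Real.sign (inner ℝ a (p.1 - p.2) * inner ℝ b (p.1 - p.2)) = r := by
      filter_upwards [ae_inner_sub_ne_zero hγ han] with p hp
      have hsq : 0 < (inner ℝ a (p.1 - p.2) : ℝ) * inner ℝ a (p.1 - p.2) := mul_self_pos.2 hp
      rw [hcol, real_inner_smul_left]
      rcases mul_self_eq_one_iff.1 hr2 with h | h
      · rw [h, one_mul, Real.sign_of_pos hsq]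
      · rw [h, neg_one_mul, mul_neg, Real.sign_neg, Real.sign_of_pos hsq]
    rw [integral_congr_ae hsign]
    simp only [integral_const, probReal_univ, smul_eq_mul, one_mul]
    rcases mul_self_eq_one_iff.1 hr2 with h | h <;> rw [h] <;> simp
  · set α := Real.arccos r with hα
    have hcos : Real.cos α = r := Real.cos_arccos (abs_le.1 hr1).1 (abs_le.1 hr1).2
    -- This orientation yields `b = cos α • a - sin α • c` with `‖c'‖ = sin α`, the form required by
    -- the planar computation.
    set c' := r • a - b with hc'
    have hc'0 : 0 < ‖c'‖ := norm_pos_iff.2 (sub_ne_zero.2 hcol.symm)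
    have hc'n : ‖c'‖ = Real.sin α := by
      rw [hα, Real.sin_arccos, ← Real.sqrt_sq hc'0.le, ← real_inner_self_eq_norm_sq, hc']
      congr 1
      simp only [inner_sub_left, inner_sub_right, real_inner_smul_left, real_inner_smul_right, haa,
        hbb, real_inner_comm a b, ← hr]
      ring
    set c := ‖c'‖⁻¹ • c' with hc
    have hcn : ‖c‖ = 1 := by simp [hc, norm_smul, hc'0.ne']
    have hac : inner ℝ a c = (0 : ℝ) := by
      rw [hc, hc', real_inner_smul_right, inner_sub_right, real_inner_smul_right, haa, ← hr]
      ring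
    have hbexp : ∀ d : EuclideanSpace ℝ (Fin k), (inner ℝ b d : ℝ) =
        Real.cos α * inner ℝ a d - Real.sin α * inner ℝ c d := by
      intro d
      have e1 : ‖c'‖ * inner ℝ c d = (inner ℝ c' d : ℝ) := by
        rw [hc, real_inner_smul_left, mul_inv_cancel_left₀ hc'0.ne']
      rw [hcos, ← hc'n, e1, hc', inner_sub_left, real_inner_smul_left]
      ring
    simp only [hbexp]
    rw [integral_sign_plane hγ han hcn hac (Real.arccos_nonneg r) (Real.arccos_le_pi r)]
    rw [show Real.pi / 2 * (1 - 2 * α / Real.pi) = Real.pi / 2 - α by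
      have := Real.pi_pos
      field_simp, Real.sin_pi_div_two_sub, hcos]

/-! ### The quantile of the univariate t law -/

/-- Were the integral zero, the normalized density would vanish, contradicting total mass one. -/
lemma integral_tKernelOne_pos {γ : ℝ} (hγ : 0 < γ) : 0 < ∫ t, tKernelOne γ t := by
  have hP := isProbabilityMeasure_univariateT hγ
  refine (integral_nonneg fun t => (tKernelOne_pos hγ t).le).lt_of_ne' fun h0 => ?_
  have h1 := measure_univ (μ := univariateT γ)
  rw [univariateT, h0] at h1
  simp at h1

lemma tKernelOne_le_of_abs_le {γ : ℝ} (hγ : 0 < γ) {s R : ℝ} (h : |s| ≤ R) :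
    tKernelOne γ R ≤ tKernelOne γ s := by
  refine Real.rpow_le_rpow_of_nonpos (by positivity) ?_ (by linarith)
  have := sq_le_sq' (by linarith [neg_abs_le s, abs_nonneg s]) ((le_abs_self s).trans h)
  linarith

lemma le_univariateT_Ioc {γ : ℝ} (hγ : 0 < γ) {s t R : ℝ} (hs : -R ≤ s) (ht : t ≤ R) :
    (∫ t, tKernelOne γ t)⁻¹ * tKernelOne γ R * (t - s) ≤ (univariateT γ).real (Set.Ioc s t) := by
  have hP := isProbabilityMeasure_univariateT hγ
  have hI := integral_tKernelOne_pos hγ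
  have hR := tKernelOne_pos hγ R
  have hc : 0 ≤ (∫ t, tKernelOne γ t)⁻¹ * tKernelOne γ R := by positivity
  rw [measureReal_def, ← ENNReal.ofReal_le_iff_le_toReal (measure_ne_top _ _)]
  rw [univariateT, withDensity_apply _ measurableSet_Ioc, ENNReal.ofReal_mul hc,
    ← Real.volume_Ioc, ← setLIntegral_const]
  refine setLIntegral_mono' measurableSet_Ioc fun x hx => ENNReal.ofReal_le_ofReal ?_
  refine mul_le_mul_of_nonneg_left (tKernelOne_le_of_abs_le hγ (abs_le.2 ⟨?_, ?_⟩)) (by positivity)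
  · linarith [hx.1]
  · linarith [hx.2]

lemma univariateT_Ioc_le {γ : ℝ} (hγ : 0 < γ) {s t : ℝ} (hst : s ≤ t) :
    (univariateT γ).real (Set.Ioc s t) ≤ (∫ t, tKernelOne γ t)⁻¹ * tKernelOne γ 0 * (t - s) := by
  have hI := integral_tKernelOne_pos hγ
  have hR := tKernelOne_pos hγ 0
  have hc : 0 ≤ (∫ t, tKernelOne γ t)⁻¹ * tKernelOne γ 0 := by positivity
  have h0 : 0 ≤ t - s := sub_nonneg.2 hst
  refine ENNReal.toReal_le_of_le_ofReal (by positivity) ?_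
  rw [univariateT, withDensity_apply _ measurableSet_Ioc, ENNReal.ofReal_mul hc,
    ← Real.volume_Ioc, ← setLIntegral_const]
  refine setLIntegral_mono' measurableSet_Ioc fun x hx => ENNReal.ofReal_le_ofReal ?_
  refine mul_le_mul_of_nonneg_left ?_ (by positivity)
  refine Real.rpow_le_rpow_of_nonpos (by positivity) ?_ (by linarith)
  nlinarith [sq_nonneg x]

lemma nullSingletonClass_univariateT (γ : ℝ) : NullSingletonClass (univariateT γ) :=
  ⟨fun s => univariateT_absolutelyContinuous γ (by simp)⟩

lemma univariateT_map_neg (γ : ℝ) : (univariateT γ).map (fun s => -s) = univariateT γ := by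
  refine map_withDensity_equiv (MeasurableEquiv.neg ℝ) (Measure.measurePreserving_neg volume)
    (fun s => ?_) ?_
  · simp [tKernelOne]
  · unfold tKernelOne; fun_prop

lemma univariateT_Iic_neg {γ : ℝ} (hγ : 0 < γ) (t : ℝ) :
    (univariateT γ).real (Set.Iic (-t)) = 1 - (univariateT γ).real (Set.Iic t) := by
  have hP := isProbabilityMeasure_univariateT hγ
  have hA := nullSingletonClass_univariateT γ
  have h1 : (univariateT γ).real (Set.Iic (-t)) = (univariateT γ).real (Set.Ici t) := by
    conv_lhs => rw [← univariateT_map_neg γ]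
    rw [map_measureReal_apply measurable_neg measurableSet_Iic]
    congr 1
    ext s; simp
  rw [h1, ← probReal_compl_eq_one_sub measurableSet_Iic, Set.compl_Iic]
  exact measureReal_congr Ioi_ae_eq_Ici.symm

lemma univariateT_Iic_sub {γ : ℝ} (hγ : 0 < γ) {s t : ℝ} (hst : s ≤ t) :
    (univariateT γ).real (Set.Iic t) - (univariateT γ).real (Set.Iic s) =
      (univariateT γ).real (Set.Ioc s t) := by
  have hP := isProbabilityMeasure_univariateT hγ
  rw [← Set.Iic_union_Ioc_eq_Iic hst, measureReal_union (Set.Iic_disjoint_Ioc le_rfl)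
    measurableSet_Ioc]
  ring

lemma strictMono_univariateT_Iic {γ : ℝ} (hγ : 0 < γ) :
    StrictMono fun t => (univariateT γ).real (Set.Iic t) := by
  intro s t hst
  have h := le_univariateT_Ioc hγ (s := s) (t := t) (R := max |s| |t|)
    (by linarith [neg_abs_le s, le_max_left |s| |t|])
    ((le_abs_self t).trans (le_max_right _ _))
  have := integral_tKernelOne_pos hγ
  have := tKernelOne_pos hγ (max |s| |t|)
  have h2 : 0 < (∫ t, tKernelOne γ t)⁻¹ * tKernelOne γ (max |s| |t|) * (t - s) :=
    mul_pos (by positivity) (sub_pos.2 hst)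
  have := univariateT_Iic_sub hγ hst.le
  change (univariateT γ).real (Set.Iic s) < (univariateT γ).real (Set.Iic t)
  linarith

lemma continuous_univariateT_Iic {γ : ℝ} (hγ : 0 < γ) :
    Continuous fun t => (univariateT γ).real (Set.Iic t) := by
  refine LipschitzWith.continuous
    (K := Real.toNNReal ((∫ t, tKernelOne γ t)⁻¹ * tKernelOne γ 0)) ?_
  refine LipschitzWith.of_le_add_mul _ fun s t => ?_
  have := integral_tKernelOne_pos hγ
  have := tKernelOne_pos hγ 0
  rw [Real.coe_toNNReal _ (by positivity), Real.dist_eq]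
  rcases le_total s t with h | h
  · have h1 := (strictMono_univariateT_Iic hγ).monotone h
    have h2 : 0 ≤ (∫ t, tKernelOne γ t)⁻¹ * tKernelOne γ 0 * |s - t| := by positivity
    change (univariateT γ).real (Set.Iic s) ≤ (univariateT γ).real (Set.Iic t) at h1
    linarith
  · have h1 := univariateT_Ioc_le hγ h
    rw [← univariateT_Iic_sub hγ h] at h1
    rw [abs_of_nonneg (sub_nonneg.2 h)]
    linarith

/-- Symmetry gives the distribution function the value `1/2` at the origin. Continuity and strict
monotonicity then produce a positive point with value `3/4`, and the set whose infimum is the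
quantile is the half-line starting there. -/
lemma tQuantile_three_quarters {γ : ℝ} (hγ : 0 < γ) :
    0 < tQuantile γ (3 / 4) ∧ (univariateT γ).real (Set.Iic (tQuantile γ (3 / 4))) = 3 / 4 := by
  have hP := isProbabilityMeasure_univariateT hγ
  have hmono := strictMono_univariateT_Iic hγ
  have h0 : (univariateT γ).real (Set.Iic 0) = 1 / 2 := by
    have := univariateT_Iic_neg hγ 0
    rw [neg_zero] at this
    linarith
  obtain ⟨t, ht⟩ : ∃ t, 3 / 4 < (univariateT γ).real (Set.Iic t) := by
    have h1 := tendsto_cdf_atTop (univariateT γ)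
    obtain ⟨t, ht⟩ := (h1.eventually_const_lt (by norm_num : (3 / 4 : ℝ) < 1)).exists
    exact ⟨t, by rwa [cdf_eq_real] at ht⟩
  have ht0 : 0 ≤ t := by
    by_contra hneg
    have := hmono (not_le.1 hneg)
    simp only at this
    linarith
  obtain ⟨q, hq, hFq⟩ := intermediate_value_Icc ht0 (continuous_univariateT_Iic hγ).continuousOn
    (show (3 / 4 : ℝ) ∈ _ from ⟨by rw [h0]; norm_num, ht.le⟩)
  simp only at hFq
  have hquant : tQuantile γ (3 / 4) = q := by
    have hset : {t : ℝ | (3 / 4 : ℝ) ≤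
        (multivariateT γ (1 : Matrix (Fin 1) (Fin 1) ℝ)).real {z | z 0 ≤ t}} = Set.Ici q := by
      ext s
      have : (multivariateT γ (1 : Matrix (Fin 1) (Fin 1) ℝ)).real {z | z 0 ≤ s} =
          (univariateT γ).real (Set.Iic s) := by
        rw [← map_eval_zero_multivariateT_one 0 hγ,
          map_measureReal_apply (measurable_pi_apply 0) measurableSet_Iic]
        rfl
      simp only [Set.mem_ofPred_eq, this, Set.mem_Ici]
      rw [← hFq]
      exact hmono.le_iff_le
    rw [tQuantile, hset, csInf_Ici]
  rw [hquant]
  refine ⟨hq.1.lt_of_ne ?_, hFq⟩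
  rintro rfl
  rw [h0] at hFq
  norm_num at hFq

/-- The absolute value of a univariate t variable has median `q`, with a linear rate. -/
lemma exists_univariateT_median_rate {γ : ℝ} (hγ : 0 < γ) :
    ∃ c > 0, ∃ h₀ > 0, ∀ h ∈ Set.Icc 0 h₀,
      (univariateT γ).real {s | |s| ≤ tQuantile γ (3 / 4) - h} ≤ 1 / 2 - c * h ∧
      (univariateT γ).real {s | tQuantile γ (3 / 4) + h ≤ |s|} ≤ 1 / 2 - c * h := by
  have hP := isProbabilityMeasure_univariateT hγ
  have hA := nullSingletonClass_univariateT γ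
  obtain ⟨hq0, hFq⟩ := tQuantile_three_quarters hγ
  set q := tQuantile γ (3 / 4) with hq
  set F := fun t => (univariateT γ).real (Set.Iic t) with hF
  -- This is a lower bound for the density on `[-2q, 2q]`, which contains `q ± h` for every `h ≤ q`.
  -- Symmetry, in the form `P(|s| ≤ t) = 2 F t - 1`, later doubles the rate.
  set c := (∫ t, tKernelOne γ t)⁻¹ * tKernelOne γ (2 * q) with hc
  have hcpos : 0 < c := mul_pos (inv_pos.2 (integral_tKernelOne_pos hγ)) (tKernelOne_pos hγ _)
  have habs : ∀ t, 0 ≤ t → (univariateT γ).real {s | |s| ≤ t} = 2 * F t - 1 := by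
    intro t ht
    have h1 : {s : ℝ | |s| ≤ t} = Set.Icc (-t) t := by
      ext s; simp [abs_le]
    rw [h1, ← measureReal_congr (Ioc_ae_eq_Icc (μ := univariateT γ)),
      ← univariateT_Iic_sub hγ (by linarith), univariateT_Iic_neg hγ]
    simp only [hF]; ring
  refine ⟨2 * c, by positivity, q, hq0, fun h hh => ⟨?_, ?_⟩⟩
  · rw [habs _ (by linarith [hh.2])]
    have h1 := le_univariateT_Ioc hγ (s := q - h) (t := q) (R := 2 * q)
      (by linarith [hh.2]) (by linarith)
    rw [← univariateT_Iic_sub hγ (by linarith [hh.1])] at h1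
    simp only [hF] at *
    linarith
  · have hcompl : {s : ℝ | q + h ≤ |s|} = {s : ℝ | |s| < q + h}ᶜ := by
      ext s; simp
    have hlt : (univariateT γ).real {s : ℝ | |s| < q + h} = 2 * F (q + h) - 1 := by
      rw [← habs _ (by linarith [hh.1])]
      have e1 : {s : ℝ | |s| < q + h} = Set.Ioo (-(q + h)) (q + h) := by ext s; simp [abs_lt]
      have e2 : {s : ℝ | |s| ≤ q + h} = Set.Icc (-(q + h)) (q + h) := by ext s; simp [abs_le]
      rw [e1, e2]
      exact measureReal_congr Ioo_ae_eq_Icc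
    rw [hcompl, probReal_compl_eq_one_sub (measurableSet_lt (by fun_prop) measurable_const), hlt]
    have h1 := le_univariateT_Ioc hγ (s := q) (t := q + h) (R := 2 * q)
      (by linarith [hh.2]) (by linarith [hh.2])
    rw [← univariateT_Iic_sub hγ (by linarith [hh.1])] at h1
    simp only [hF] at *
    linarith

/-! ### Concentration of the sample median -/

/-- The strict minorities trap both the least and the greatest median between `l` and `u`, hence
also their midpoint; the parity of `n` never enters. -/
lemma sampleMedian_mem_Icc {n : ℕ} {y : Fin n → ℝ} {l u : ℝ}
    (hl : 2 * (Finset.univ.filter fun i => y i ≤ l).card < n)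
    (hu : 2 * (Finset.univ.filter fun i => u ≤ y i).card < n) :
    sampleMedian y ∈ Set.Icc l u := by
  have hcl : (Finset.univ.filter fun i => y i ≤ l).card +
      (Finset.univ.filter fun i => l < y i).card = n := by
    have := Finset.card_filter_add_card_filter_not (s := (Finset.univ : Finset (Fin n)))
      (fun i => y i ≤ l)
    simpa using this
  have hcu : (Finset.univ.filter fun i => u ≤ y i).card +
      (Finset.univ.filter fun i => y i < u).card = n := by
    have := Finset.card_filter_add_card_filter_not (s := (Finset.univ : Finset (Fin n)))
      (fun i => u ≤ y i)
    simpa using this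
  have hle : ∀ {s t : ℝ}, s ≤ t → (Finset.univ.filter fun i => y i ≤ s).card ≤
      (Finset.univ.filter fun i => y i ≤ t).card := fun hst =>
    Finset.card_le_card (Finset.monotone_filter_right _ fun i _ hi => hi.trans hst)
  have hge : ∀ {s t : ℝ}, s ≤ t → (Finset.univ.filter fun i => t ≤ y i).card ≤
      (Finset.univ.filter fun i => s ≤ y i).card := fun hst =>
    Finset.card_le_card (Finset.monotone_filter_right _ fun i _ hi => hst.trans hi)
  have hlt_u : (Finset.univ.filter fun i => y i < u).card ≤
      (Finset.univ.filter fun i => y i ≤ u).card :=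
    Finset.card_le_card (Finset.monotone_filter_right _ fun i _ hi => le_of_lt hi)
  have hlt_l : (Finset.univ.filter fun i => l < y i).card ≤
      (Finset.univ.filter fun i => l ≤ y i).card :=
    Finset.card_le_card (Finset.monotone_filter_right _ fun i _ hi => le_of_lt hi)
  set S₁ := {t : ℝ | n ≤ 2 * (Finset.univ.filter fun i => y i ≤ t).card} with hS₁
  set S₂ := {t : ℝ | n ≤ 2 * (Finset.univ.filter fun i => t ≤ y i).card} with hS₂
  have hu1 : u ∈ S₁ := by
    change n ≤ 2 * (Finset.univ.filter fun i => y i ≤ u).card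
    omega
  have hl1 : l ∈ lowerBounds S₁ := by
    intro t ht
    change n ≤ 2 * (Finset.univ.filter fun i => y i ≤ t).card at ht
    by_contra hlt
    have := hle (not_le.1 hlt).le
    omega
  have hl2 : l ∈ S₂ := by
    change n ≤ 2 * (Finset.univ.filter fun i => l ≤ y i).card
    omega
  have hu2 : u ∈ upperBounds S₂ := by
    intro t ht
    change n ≤ 2 * (Finset.univ.filter fun i => t ≤ y i).card at ht
    by_contra hlt
    have := hge (not_le.1 hlt).le
    omega
  have e1 := csInf_le ⟨l, hl1⟩ hu1
  have e2 := le_csInf ⟨u, hu1⟩ hl1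
  have e3 := le_csSup ⟨u, hu2⟩ hl2
  have e4 := csSup_le ⟨l, hl2⟩ hu2
  unfold sampleMedian
  exact ⟨by linarith, by linarith⟩

lemma tendsto_sqrt_log_div : Tendsto (fun n : ℕ => √(Real.log n / n)) atTop (𝓝 0) := by
  have h : Tendsto (fun x : ℝ => Real.log x / x) atTop (𝓝 0) :=
    Real.isLittleO_log_id_atTop.tendsto_div_nhds_zero
  have := (Real.continuous_sqrt.tendsto 0).comp (h.comp tendsto_natCast_atTop_atTop)
  simpa [Function.comp_def] using this

lemma sqrt_mul_log_eq {n : ℕ} (hn : 1 ≤ n) :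
    √(n * Real.log n) = n * √(Real.log n / n) := by
  have hn0 : (0 : ℝ) < n := by exact_mod_cast hn
  rw [show (n : ℝ) * Real.log n = n ^ 2 * (Real.log n / n) by field_simp,
    Real.sqrt_mul (by positivity), Real.sqrt_sq hn0.le]

/-- If the sample median is off by more than `h`, one of two counts reaches `n / 2` and so exceeds
its mean by at least `n c h`. Hoeffding's inequality for indicators makes this improbable. -/
lemma median_concentration {E : Type*} [MeasurableSpace E] {μ : Measure E} [IsProbabilityMeasure μ]
    {g : E → ℝ} (hg : Measurable g) {m₀ c h₀ : ℝ} (hc : 0 < c) (hh₀ : 0 < h₀)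
    (hrate : ∀ h ∈ Set.Icc 0 h₀, μ.real {z | g z ≤ m₀ - h} ≤ 1 / 2 - c * h ∧
      μ.real {z | m₀ + h ≤ g z} ≤ 1 / 2 - c * h) :
    ∃ A > 0, ∀ᶠ n : ℕ in atTop, (Measure.pi fun _ : Fin n => μ)
      {x | A * √(Real.log n / n) < |sampleMedian (fun i => g (x i)) - m₀|} ≤
      ENNReal.ofReal (4 * (n : ℝ)⁻¹) := by
  -- The excess becomes `3 √(n log n)`, while the tail bound of order `n⁻¹` needs only an excess
  -- strictly above `2 √(n log n)`.
  refine ⟨3 / c, by positivity, ?_⟩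
  have hev : ∀ᶠ n : ℕ in atTop, 3 / c * √(Real.log n / n) < h₀ := by
    have := (tendsto_sqrt_log_div.const_mul (3 / c))
    rw [mul_zero] at this
    exact this.eventually_lt_const hh₀
  filter_upwards [hev, eventually_ge_atTop 2] with n hn hn2
  have hn0 : (0 : ℝ) < n := by exact_mod_cast (by omega : 0 < n)
  have hlog : 0 < Real.log n := Real.log_pos (by exact_mod_cast (by omega : 1 < n))
  set h := 3 / c * √(Real.log n / n) with hh
  have hhpos : 0 ≤ h := by positivity
  have hroot : 0 < √(n * Real.log n) := by positivity
  have hch : n * (c * h) = 3 * √(n * Real.log n) := by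
    rw [sqrt_mul_log_eq (by omega), hh]; field_simp
  obtain ⟨r1, r2⟩ := hrate h ⟨hhpos, hn.le⟩
  have hbad : ∀ s : Set E, MeasurableSet s → μ.real s ≤ 1 / 2 - c * h →
      (Measure.pi fun _ : Fin n => μ) {x | ¬ 2 * (∑ i, s.indicator 1 (x i) : ℝ) < n} ≤
        ENNReal.ofReal (2 * (n : ℝ)⁻¹) := by
    intro s hs hsr
    have hoef := hoeffding_pi (μ := μ) (n := n) (by omega) (g := s.indicator 1)
      (measurable_one.indicator hs) one_pos
      (fun z => by by_cases hz : z ∈ s <;> simp [hz]) 1 (A := 2) (by norm_num) (by norm_num)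
    rw [pow_one] at hoef
    refine (measure_mono fun x hx => ?_).trans hoef
    rw [Set.mem_ofPred_eq, not_lt] at hx
    rw [Set.mem_ofPred_eq, integral_indicator_one hs]
    refine lt_of_lt_of_le ?_ (le_abs_self _)
    have := mul_le_mul_of_nonneg_left hsr hn0.le
    linarith
  have hms1 : MeasurableSet {z | g z ≤ m₀ - h} := measurableSet_le hg measurable_const
  have hms2 : MeasurableSet {z | m₀ + h ≤ g z} := measurableSet_le measurable_const hg
  have hcard : ∀ (s : Set E) [DecidablePred (· ∈ s)] (x : Fin n → E),
      (∑ i, s.indicator 1 (x i) : ℝ) = (Finset.univ.filter fun i => x i ∈ s).card := by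
    intro s _ x
    rw [Finset.card_filter]
    push_cast
    refine Finset.sum_congr rfl fun i _ => ?_
    by_cases hz : x i ∈ s <;> simp [hz]
  classical
  have hsub : {x : Fin n → E | h < |sampleMedian (fun i => g (x i)) - m₀|} ⊆
      {x | ¬ 2 * (∑ i, {z | g z ≤ m₀ - h}.indicator 1 (x i) : ℝ) < n} ∪
      {x | ¬ 2 * (∑ i, {z | m₀ + h ≤ g z}.indicator 1 (x i) : ℝ) < n} := by
    intro x hx
    by_contra hnot
    simp only [Set.mem_union, Set.mem_ofPred_eq, not_or, not_not, hcard] at hnot hx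
    have hmem := sampleMedian_mem_Icc (y := fun i => g (x i)) (l := m₀ - h) (u := m₀ + h)
      (by exact_mod_cast hnot.1) (by exact_mod_cast hnot.2)
    have : |sampleMedian (fun i => g (x i)) - m₀| ≤ h :=
      abs_le.2 ⟨by linarith [hmem.1], by linarith [hmem.2]⟩
    linarith
  calc _ ≤ ENNReal.ofReal (2 * (n : ℝ)⁻¹) + ENNReal.ofReal (2 * (n : ℝ)⁻¹) :=
        (measure_mono hsub).trans ((measure_union_le _ _).trans
          (add_le_add (hbad _ hms1 r1) (hbad _ hms2 r2)))
    _ = _ := by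
        rw [← ENNReal.ofReal_add (by positivity) (by positivity)]
        congr 1; ring

/-! ### Concentration of the initial estimator -/

lemma differentiableAt_det {V : Type*} [NormedAddCommGroup V] [NormedSpace ℝ V] {k : ℕ}
    {G : V → Matrix (Fin k) (Fin k) ℝ} {p : V}
    (hG : ∀ i j, DifferentiableAt ℝ (fun v => G v i j) p) :
    DifferentiableAt ℝ (fun v => (G v).det) p := by
  simp only [Matrix.det_apply]
  refine DifferentiableAt.fun_sum fun τ _ => DifferentiableAt.const_smul ?_ _
  refine (HasFDerivAt.finsetProd (u := Finset.univ) (g := fun i v => G v (τ i) i)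
    fun i _ => (hG _ _).hasFDerivAt).differentiableAt

lemma differentiableAt_inv_apply {V : Type*} [NormedAddCommGroup V] [NormedSpace ℝ V] {k : ℕ}
    {G : V → Matrix (Fin k) (Fin k) ℝ} {p : V}
    (hG : ∀ i j, DifferentiableAt ℝ (fun v => G v i j) p) (hp : (G p).det ≠ 0) (i j : Fin k) :
    DifferentiableAt ℝ (fun v => (G v)⁻¹ i j) p := by
  simp only [Matrix.inv_def, Matrix.smul_apply, Ring.inverse_eq_inv', Matrix.adjugate_apply,
    smul_eq_mul]
  refine ((differentiableAt_det hG).inv hp).mul (differentiableAt_det fun i' j' => ?_)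
  simp only [Matrix.updateRow_apply]
  split_ifs
  · exact differentiableAt_const _
  · exact hG _ _

/-- The covariance estimate as a function of the rank correlations and of the medians. -/
noncomputable def covOf {k : ℕ} (q : ℝ) (p : (Fin k → Fin k → ℝ) × (Fin k → ℝ)) :
    Matrix (Fin k) (Fin k) ℝ :=
  Matrix.of fun j j' =>
    Real.sin (Real.pi / 2 * p.1 j j') * √((p.2 j / q) ^ 2 * (p.2 j' / q) ^ 2)

lemma differentiableAt_covOf {k : ℕ} {q : ℝ} (hq : q ≠ 0)
    {p : (Fin k → Fin k → ℝ) × (Fin k → ℝ)} (hp : ∀ j, p.2 j ≠ 0) (j j' : Fin k) :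
    DifferentiableAt ℝ (fun v => covOf q v j j') p := by
  simp only [covOf, Matrix.of_apply]
  have h1 : ∀ i, DifferentiableAt ℝ (fun v : (Fin k → Fin k → ℝ) × (Fin k → ℝ) => v.2 i) p :=
    fun i => by fun_prop
  have h1' : ∀ i, DifferentiableAt ℝ
      (fun v : (Fin k → Fin k → ℝ) × (Fin k → ℝ) => v.2 i / q) p := fun i => by fun_prop
  have h2 : DifferentiableAt ℝ (fun v : (Fin k → Fin k → ℝ) × (Fin k → ℝ) => v.1 j j') p := by
    fun_prop
  refine (h2.const_mul _).sin.mul (DifferentiableAt.sqrt ?_ ?_)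
  · exact ((h1' j).pow 2).mul ((h1' j').pow 2)
  · have := hp j
    have := hp j'
    positivity

/-- Differentiability at the single point `p` gives a linear bound centred there, which is all that
consistency with a rate needs. Nonzero medians keep the square root away from its singularity, and a
nonzero determinant makes the inverse differentiable. -/
lemma exists_lipschitz_covOf {k : ℕ} {q : ℝ} (hq : q ≠ 0)
    {p : (Fin k → Fin k → ℝ) × (Fin k → ℝ)} (hp : ∀ j, p.2 j ≠ 0) (hdet : (covOf q p).det ≠ 0) :
    ∃ C > 0, ∃ ε > 0, ∀ v, ‖v - p‖ ≤ ε →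
      ‖upperTri (covOf q v)⁻¹ - upperTri (covOf q p)⁻¹‖ ≤ C * ‖v - p‖ := by
  have hd : DifferentiableAt ℝ (fun v => upperTri (covOf q v)⁻¹) p := by
    rw [differentiableAt_euclidean]
    intro r
    exact differentiableAt_inv_apply (fun i j => differentiableAt_covOf hq hp i j) hdet _ _
  obtain ⟨C, hC, hb⟩ := hd.isBigO_sub.exists_pos
  rw [isBigOWith_iff, Metric.eventually_nhds_iff_ball] at hb
  obtain ⟨ε, hε, hb⟩ := hb
  refine ⟨C, hC, ε / 2, by positivity, fun v hv => hb v ?_⟩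
  rw [mem_ball_iff_norm]
  linarith

section Sample

variable {k : ℕ} {γ : ℝ} {θ₀ : EuclideanSpace ℝ (UpperTri k)} {b : Fin k → EuclideanSpace ℝ (Fin k)}

lemma measurable_innerFamily (b : Fin k → EuclideanSpace ℝ (Fin k)) :
    Measurable fun (z : EuclideanSpace ℝ (Fin k)) (j : Fin k) => (inner ℝ (b j) z : ℝ) :=
  measurable_pi_lambda _ fun _ => (continuous_const.inner continuous_id).measurable

lemma measurable_kendallKernel (j j' : Fin k) :
    Measurable fun p : (Fin k → ℝ) × (Fin k → ℝ) =>
      Real.sign ((p.1 j - p.2 j) * (p.1 j' - p.2 j')) :=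
  measurable_realSign.comp (by fun_prop)

lemma kendallTau_concentration {μ : Measure (Fin k → ℝ)} [IsProbabilityMeasure μ] {n : ℕ}
    (hn : 2 ≤ n) (j j' : Fin k) :
    (Measure.pi fun _ : Fin n => μ) {x | 16 * √(Real.log n / n) < |kendallTau x j j' -
      ∫ p, Real.sign ((p.1 j - p.2 j) * (p.1 j' - p.2 j')) ∂(μ.prod μ)|} ≤
      ENNReal.ofReal (4 * (n : ℝ)⁻¹) := by
  have h := ustatistic_concentration (μ := μ) hn (measurable_kendallKernel j j')
    (fun z => abs_realSign_le _)
  unfold kendallTau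
  exact h

lemma sin_kendall_mean (hγ : 0 < γ) (hb : ∀ j, b j ≠ 0) {μ : Measure (Fin k → ℝ)}
    (hμ : μ = (sphericalT k γ).map fun z j => inner ℝ (b j) z) (j j' : Fin k) :
    Real.sin (Real.pi / 2 * ∫ p, Real.sign ((p.1 j - p.2 j) * (p.1 j' - p.2 j')) ∂(μ.prod μ)) =
      inner ℝ (b j) (b j') / (‖b j‖ * ‖b j'‖) := by
  have := isProbabilityMeasure_sphericalT k hγ
  rw [← sin_integral_sign hγ (hb j) (hb j'), hμ, Measure.map_prod_map _ _
    (measurable_innerFamily b) (measurable_innerFamily b), integral_map]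
  · simp only [Prod.map_fst, Prod.map_snd, inner_sub_right]
  · exact ((measurable_innerFamily b).prodMap (measurable_innerFamily b)).aemeasurable
  · exact (measurable_kendallKernel j j').aestronglyMeasurable

/-- Divided by `‖b j‖`, the `j`-th coordinate is a univariate t variable; the rate is transported by
this scaling. -/
lemma exists_median_rate (hγ : 0 < γ) {μ : Measure (Fin k → ℝ)}
    (hμ : μ = (sphericalT k γ).map fun z j => inner ℝ (b j) z) {j : Fin k} (hb : b j ≠ 0) :
    ∃ c > 0, ∃ h₀ > 0, ∀ h ∈ Set.Icc 0 h₀,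
      μ.real {z | |z j| ≤ ‖b j‖ * tQuantile γ (3 / 4) - h} ≤ 1 / 2 - c * h ∧
      μ.real {z | ‖b j‖ * tQuantile γ (3 / 4) + h ≤ |z j|} ≤ 1 / 2 - c * h := by
  obtain ⟨c, hc, h₀, hh₀, hrate⟩ := exists_univariateT_median_rate hγ
  have hn : 0 < ‖b j‖ := norm_pos_iff.2 hb
  have hmap : μ.map (fun z => z j / ‖b j‖) = univariateT γ := by
    rw [hμ, Measure.map_map (by fun_prop) (measurable_innerFamily b),
      ← map_inner_sphericalT hγ (u := ‖b j‖⁻¹ • b j) (by simp [norm_smul, hn.ne'])]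
    congr 1
    ext z
    simp only [Function.comp_apply, real_inner_smul_left]
    ring
  have hlaw : ∀ s : Set ℝ, MeasurableSet s →
      (univariateT γ).real s = μ.real {z | z j / ‖b j‖ ∈ s} := fun s hs => by
    rw [← hmap, map_measureReal_apply (by fun_prop) hs]; rfl
  refine ⟨c / ‖b j‖, by positivity, h₀ * ‖b j‖, by positivity, fun h hh => ?_⟩
  have hmem : h / ‖b j‖ ∈ Set.Icc 0 h₀ :=
    ⟨div_nonneg hh.1 hn.le, (div_le_iff₀ hn).2 hh.2⟩
  obtain ⟨r1, r2⟩ := hrate _ hmem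
  rw [hlaw _ (measurableSet_le (by fun_prop) measurable_const)] at r1
  rw [hlaw _ (measurableSet_le measurable_const (by fun_prop))] at r2
  have e1 : {z : Fin k → ℝ | z j / ‖b j‖ ∈ {s : ℝ | |s| ≤ tQuantile γ (3 / 4) - h / ‖b j‖}} =
      {z | |z j| ≤ ‖b j‖ * tQuantile γ (3 / 4) - h} := by
    ext z
    simp only [Set.mem_ofPred_eq, abs_div, abs_of_pos hn]
    rw [div_le_iff₀ hn, sub_mul, div_mul_cancel₀ _ hn.ne', mul_comm]
  have e2 : {z : Fin k → ℝ | z j / ‖b j‖ ∈ {s : ℝ | tQuantile γ (3 / 4) + h / ‖b j‖ ≤ |s|}} =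
      {z | ‖b j‖ * tQuantile γ (3 / 4) + h ≤ |z j|} := by
    ext z
    simp only [Set.mem_ofPred_eq, abs_div, abs_of_pos hn]
    rw [le_div_iff₀ hn, add_mul, div_mul_cancel₀ _ hn.ne', mul_comm]
  rw [e1] at r1
  rw [e2] at r2
  rw [div_mul_eq_mul_div, mul_div_assoc]
  exact ⟨r1, r2⟩

/-- The initial estimator is within `O(√(log n / n))` of the truth with probability
`1 - O(1/n)`. -/
lemma initEst_concentration (hγ : 0 < γ) (hθ₀ : θ₀ ∈ posDefParams k) :
    ∃ C > 0, ∃ K ≥ 0, ∀ᶠ n : ℕ in atTop,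
      sampleLaw γ n θ₀ {x | C * √(Real.log n / n) < ‖initEst γ x - θ₀‖} ≤
        ENNReal.ofReal (K * (n : ℝ)⁻¹) := by
  have hA : (symMat θ₀).PosDef := hθ₀
  obtain ⟨b, hbinner, hμ⟩ := exists_multivariateT_eq_map hγ hA
  have hP := isProbabilityMeasure_multivariateT hγ hA
  obtain ⟨hq, -⟩ := tQuantile_three_quarters hγ
  have hb : ∀ j, b j ≠ 0 := by
    intro j hj
    have h1 := hbinner j j
    rw [hj, inner_zero_left] at h1
    exact (hA.inv.diag_pos (i := j)).ne h1
  have hbn : ∀ j, 0 < ‖b j‖ := fun j => norm_pos_iff.2 (hb j)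
  unfold sampleLaw
  set μ := multivariateT γ (symMat θ₀) with hμdef
  set q := tQuantile γ (3 / 4) with hqdef
  -- The population counterparts of the rank correlations and of the medians. At `p₀` the plug-in
  -- formula returns exactly `θ₀⁻¹`: the norms contributed by the medians cancel the denominator of
  -- the correlation.
  set p₀ : (Fin k → Fin k → ℝ) × (Fin k → ℝ) :=
    (fun j j' => ∫ p, Real.sign ((p.1 j - p.2 j) * (p.1 j' - p.2 j')) ∂(μ.prod μ),
      fun j => ‖b j‖ * q) with hp₀
  have hcov : covOf q p₀ = (symMat θ₀)⁻¹ := by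
    ext j j'
    have h1 := hbn j
    have h2 := hbn j'
    simp only [covOf, hp₀, Matrix.of_apply]
    rw [sin_kendall_mean hγ hb hμ, ← hbinner, mul_div_cancel_right₀ _ hq.ne',
      mul_div_cancel_right₀ _ hq.ne', ← mul_pow, Real.sqrt_sq (by positivity),
      div_mul_cancel₀ _ (by positivity)]
  have hp1 : ∀ j j', p₀.1 j j' =
      ∫ p, Real.sign ((p.1 j - p.2 j) * (p.1 j' - p.2 j')) ∂(μ.prod μ) := fun _ _ => rfl
  have hp2 : ∀ j, p₀.2 j = ‖b j‖ * q := fun _ => rfl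
  have hp2' : ∀ j, p₀.2 j ≠ 0 := fun j => (mul_pos (hbn j) hq).ne'
  clear_value p₀
  have hF0 : upperTri (covOf q p₀)⁻¹ = θ₀ := by
    rw [hcov, Matrix.nonsing_inv_nonsing_inv _ hA.det_pos.ne'.isUnit, upperTri_symMat]
  have hinit : ∀ {n : ℕ} (x : Fin n → Fin k → ℝ), initEst γ x =
      upperTri (covOf q (fun j j' => kendallTau x j j',
        fun j => sampleMedian fun i => |x i j|))⁻¹ := fun x => rfl
  obtain ⟨C, hC, ε, hε, hlip⟩ := exists_lipschitz_covOf hq.ne' (p := p₀)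
    hp2' (by rw [hcov]; exact hA.inv.det_pos.ne')
  have hmed : ∀ j : Fin k, ∃ A > 0, ∀ᶠ n : ℕ in atTop, (Measure.pi fun _ : Fin n => μ)
      {x | A * √(Real.log n / n) < |sampleMedian (fun i => |x i j|) - ‖b j‖ * q|} ≤
      ENNReal.ofReal (4 * (n : ℝ)⁻¹) := fun j => by
    obtain ⟨c, hc, h₀, hh₀, hr⟩ := exists_median_rate hγ hμ (hb j)
    exact median_concentration (μ := μ) (g := fun z => |z j|) (by fun_prop) hc hh₀ hr
  choose A hApos hAmed using hmed
  -- One constant dominating the deviation constants of all rank correlations and all medians.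
  set B : ℝ := 16 + ∑ j, A j with hB
  have hBpos : 0 < B := by
    have : 0 ≤ ∑ j, A j := Finset.sum_nonneg fun j _ => (hApos j).le
    linarith
  have hAB : ∀ j, A j ≤ B := fun j => by
    have := Finset.single_le_sum (f := A) (fun j _ => (hApos j).le) (Finset.mem_univ j)
    linarith
  refine ⟨C * B, by positivity, 4 * k ^ 2 + 4 * k, by positivity, ?_⟩
  have hsmall : ∀ᶠ n : ℕ in atTop, B * √(Real.log n / n) < ε := by
    have := tendsto_sqrt_log_div.const_mul B
    rw [mul_zero] at this
    exact this.eventually_lt_const hε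
  filter_upwards [hsmall, eventually_all.2 hAmed, eventually_ge_atTop 2] with n hn1 hn2 hn3
  set P := Measure.pi fun _ : Fin n => μ with hPdef
  have hroot : 0 ≤ √(Real.log n / n) := Real.sqrt_nonneg _
  have hsub : {x : Fin n → Fin k → ℝ | C * B * √(Real.log n / n) < ‖initEst γ x - θ₀‖} ⊆
      (⋃ j : Fin k, ⋃ j' : Fin k, {x | 16 * √(Real.log n / n) < |kendallTau x j j' - p₀.1 j j'|}) ∪
      ⋃ j : Fin k, {x | A j * √(Real.log n / n) <
        |sampleMedian (fun i => |x i j|) - ‖b j‖ * q|} := by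
    intro x hx
    by_contra hnot
    simp only [Set.mem_union, Set.mem_iUnion, Set.mem_ofPred_eq, not_or, not_exists, not_lt] at hnot
    obtain ⟨h1, h2⟩ := hnot
    set v : (Fin k → Fin k → ℝ) × (Fin k → ℝ) := (fun j j' => kendallTau x j j',
        fun j => sampleMedian fun i => |x i j|) with hv
    have hvp : ‖v - p₀‖ ≤ B * √(Real.log n / n) := by
      rw [Prod.norm_def, max_le_iff]
      constructor
      · refine (pi_norm_le_iff_of_nonneg (by positivity)).2 fun j =>
          (pi_norm_le_iff_of_nonneg (by positivity)).2 fun j' => ?_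
        refine (h1 j j').trans ?_
        gcongr
        have : 0 ≤ ∑ j, A j := Finset.sum_nonneg fun j _ => (hApos j).le
        linarith
      · refine (pi_norm_le_iff_of_nonneg (by positivity)).2 fun j => ?_
        have h3 := h2 j
        rw [← hp2] at h3
        refine h3.trans ?_
        gcongr
        exact hAB j
    have hfin := hlip v (hvp.trans hn1.le)
    rw [hF0, ← hinit] at hfin
    have : C * ‖v - p₀‖ ≤ C * (B * √(Real.log n / n)) := by gcongr
    have hx' : C * B * √(Real.log n / n) < ‖initEst γ x - θ₀‖ := hx
    linarith
  have hken : ∀ j j' : Fin k, P {x | 16 * √(Real.log n / n) < |kendallTau x j j' - p₀.1 j j'|} ≤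
      ENNReal.ofReal (4 * (n : ℝ)⁻¹) := fun j j' => by
    rw [hp1]
    exact kendallTau_concentration hn3 j j'
  calc P _ ≤ (∑ j : Fin k, ∑ j' : Fin k, ENNReal.ofReal (4 * (n : ℝ)⁻¹)) +
        ∑ j : Fin k, ENNReal.ofReal (4 * (n : ℝ)⁻¹) := by
        refine (measure_mono hsub).trans ((measure_union_le _ _).trans (add_le_add ?_ ?_))
        · refine (measure_iUnion_fintype_le _ _).trans (Finset.sum_le_sum fun j _ => ?_)
          exact (measure_iUnion_fintype_le _ _).trans (Finset.sum_le_sum fun j' _ => hken j j')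
        · exact (measure_iUnion_fintype_le _ _).trans (Finset.sum_le_sum fun j _ => hn2 j)
    _ = _ := by
        simp only [Finset.sum_const, Finset.card_univ, Fintype.card_fin, nsmul_eq_mul]
        rw [← ENNReal.ofReal_natCast k, ← ENNReal.ofReal_mul (by positivity),
          ← ENNReal.ofReal_mul (by positivity), ← ENNReal.ofReal_add (by positivity) (by positivity)]
        congr 1
        ring

end Sample

/-! ### The Hessian condition -/

/-- An eigenvalue is bounded by the operator norm for the sup norm, hence by the absolute row sums.
Symmetry is not needed, and nonnegativity of the bound covers an empty spectrum, whose `sSup` is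
`0`. -/
lemma lamMax_le_sum_abs {ι : Type*} [Fintype ι] [DecidableEq ι] (A : Matrix ι ι ℝ) :
    lamMax A ≤ ∑ i, ∑ j, |A i j| := by
  refine Real.sSup_le (fun μ hμ => ?_) (by positivity)
  rw [spectrum.mem_iff, Matrix.isUnit_iff_isUnit_det, isUnit_iff_ne_zero, not_not] at hμ
  obtain ⟨v, hv, hv0⟩ := Matrix.exists_mulVec_eq_zero_iff.2 hμ
  have hvn : 0 < ‖v‖ := norm_pos_iff.2 hv
  have hAv : A *ᵥ v = μ • v := by
    rw [Matrix.sub_mulVec, sub_eq_zero, Algebra.algebraMap_eq_smul_one, Matrix.smul_mulVec,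
      Matrix.one_mulVec] at hv0
    exact hv0.symm
  have h1 : ‖A *ᵥ v‖ ≤ (∑ i, ∑ j, |A i j|) * ‖v‖ := by
    refine (pi_norm_le_iff_of_nonneg (by positivity)).2 fun i => ?_
    calc ‖(A *ᵥ v) i‖ ≤ ∑ j, ‖A i j * v j‖ := norm_sum_le _ _
      _ ≤ ∑ j, |A i j| * ‖v‖ := Finset.sum_le_sum fun j _ => by
          rw [norm_mul, Real.norm_eq_abs]; gcongr; exact norm_le_pi_norm v j
      _ = (∑ j, |A i j|) * ‖v‖ := by rw [Finset.sum_mul]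
      _ ≤ _ := mul_le_mul_of_nonneg_right (Finset.single_le_sum (f := fun i => ∑ j, |A i j|)
            (fun i _ => by positivity) (Finset.mem_univ i)) (norm_nonneg v)
  rw [hAv, norm_smul, Real.norm_eq_abs] at h1
  exact (le_abs_self μ).trans (le_of_mul_le_mul_right h1 hvn)

lemma normFeature_apply {k : ℕ} (γ : ℝ) (θ : EuclideanSpace ℝ (UpperTri k)) (z : Fin k → ℝ)
    (p : UpperTri k) :
    normFeature γ θ z p = quadFeature z p / (γ + inner ℝ θ (quadFeature z)) := by
  simp only [normFeature, PiLp.smul_apply, smul_eq_mul]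
  ring

lemma abs_apply_le_norm {ι : Type*} [Fintype ι] (y : EuclideanSpace ℝ ι) (p : ι) :
    |y p| ≤ ‖y‖ := by
  rw [← Real.norm_eq_abs]
  exact PiLp.norm_apply_le y p

/-- The normalized feature is Lipschitz in the parameter. -/
lemma norm_normFeature_sub_le {k : ℕ} {γ C : ℝ} (hγ : 0 < γ) (hC : 0 ≤ C)
    {θ θ₀ : EuclideanSpace ℝ (UpperTri k)} (hθ : θ ∈ posDefParams k) (hθ₀ : θ₀ ∈ posDefParams k)
    {z : Fin k → ℝ} (h : ‖quadFeature z‖ ≤ C * inner ℝ θ (quadFeature z))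
    (h₀ : ‖quadFeature z‖ ≤ C * inner ℝ θ₀ (quadFeature z)) :
    ‖normFeature γ θ z - normFeature γ θ₀ z‖ ≤ C ^ 2 * ‖θ - θ₀‖ := by
  have hD := add_inner_quadFeature_pos hγ hθ z
  have hD₀ := add_inner_quadFeature_pos hγ hθ₀ z
  have hy := norm_normFeature_le hγ hθ hC h
  have hy₀ := norm_normFeature_le hγ hθ₀ hC h₀
  -- The identity `1/D - 1/D₀ = (D₀ - D) / (D D₀)`, with the numerator linear in `θ₀ - θ`.
  have e : normFeature γ θ z - normFeature γ θ₀ z =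
      (inner ℝ (θ₀ - θ) (normFeature γ θ₀ z)) • normFeature γ θ z := by
    rw [inner_normFeature, inner_sub_left, normFeature, normFeature, ← sub_smul, smul_smul]
    congr 1
    field_simp
    ring
  rw [e, norm_smul]
  calc ‖(inner ℝ (θ₀ - θ) (normFeature γ θ₀ z) : ℝ)‖ * ‖normFeature γ θ z‖
      ≤ (‖θ₀ - θ‖ * C) * C := by
        gcongr
        exact (norm_inner_le_norm _ _).trans (by gcongr)
    _ = C ^ 2 * ‖θ - θ₀‖ := by rw [norm_sub_rev]; ring

/-! ### Empirical second moments of the normalized features and their link to the Hessian. -/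

section Deviation

variable {k : ℕ} {γ C : ℝ} {θ θ₀ : EuclideanSpace ℝ (UpperTri k)}

lemma hessian_tNLL_eq_normFeature (hγ : 0 < γ) {n : ℕ} (x : Fin n → Fin k → ℝ)
    (hθ : θ ∈ posDefParams k) (p q : UpperTri k) :
    hessian (tNLL γ n x) θ p q =
      -((γ + k) / 2) * (∑ i, normFeature γ θ (x i) p * normFeature γ θ (x i) q) -
        n / 2 * fderiv ℝ (fderiv ℝ logDet) θ (EuclideanSpace.single p 1)
          (EuclideanSpace.single q 1) := by
  rw [hessian_tNLL hγ x hθ]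
  congr 2
  refine Finset.sum_congr rfl fun i _ => ?_
  rw [normFeature_apply, normFeature_apply, div_mul_div_comm, sq]

lemma measurable_normFeature_apply (hγ : 0 < γ) (hθ : θ ∈ posDefParams k) (p : UpperTri k) :
    Measurable fun z : Fin k → ℝ => normFeature γ θ z p := by
  have h := (EuclideanSpace.proj (𝕜 := ℝ) p).continuous.comp (continuous_normFeature hγ hθ)
  exact h.measurable

lemma abs_normFeature_mul_le (hC : 0 ≤ C) {y : EuclideanSpace ℝ (UpperTri k)} (hy : ‖y‖ ≤ C)
    (p q : UpperTri k) : |y p * y q| ≤ C ^ 2 := by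
  rw [abs_mul, sq]
  exact mul_le_mul ((abs_apply_le_norm _ _).trans hy) ((abs_apply_le_norm _ _).trans hy)
    (abs_nonneg _) hC

lemma abs_normFeature_mul_sub_le {δ : ℝ} (hC : 0 ≤ C)
    {y y' : EuclideanSpace ℝ (UpperTri k)} (hy : ‖y‖ ≤ C) (hy' : ‖y'‖ ≤ C) (hyy : ‖y - y'‖ ≤ δ)
    (p q : UpperTri k) : |y p * y q - y' p * y' q| ≤ 2 * C * δ := by
  have e : y p * y q - y' p * y' q = (y - y') p * y q + y' p * (y - y') q := by
    simp only [PiLp.sub_apply]; ring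
  have hp := (abs_apply_le_norm (y - y') p).trans hyy
  have hq := (abs_apply_le_norm (y - y') q).trans hyy
  rw [e]
  refine (abs_add_le _ _).trans ?_
  rw [abs_mul, abs_mul]
  have h1 : |(y - y') p| * |y q| ≤ δ * C :=
    mul_le_mul hp ((abs_apply_le_norm _ _).trans hy) (abs_nonneg _) ((abs_nonneg _).trans hp)
  have h2 : |y' p| * |(y - y') q| ≤ C * δ :=
    mul_le_mul ((abs_apply_le_norm _ _).trans hy') hq (abs_nonneg _) hC
  linarith

/-- The centred sum `∑ᵢ y_p(xᵢ) y_q(xᵢ) - n 𝔼[y_p y_q]` of the normalized features. -/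
noncomputable def momentDeviation (γ : ℝ) (μ : Measure (Fin k → ℝ))
    (θ : EuclideanSpace ℝ (UpperTri k)) {n : ℕ} (x : Fin n → Fin k → ℝ) (p q : UpperTri k) : ℝ :=
  ∑ i, normFeature γ θ (x i) p * normFeature γ θ (x i) q -
    n * ∫ z, normFeature γ θ z p * normFeature γ θ z q ∂μ

/-- A deterministic bound, valid for every sample: only the deviations at the single point `θ₀` have
to be controlled in probability, and no covering of the ball is required. -/
lemma abs_momentDeviation_sub_le (hγ : 0 < γ) (hC : 0 ≤ C) (hθ : θ ∈ posDefParams k)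
    (hθ₀ : θ₀ ∈ posDefParams k) (h : ∀ z : Fin k → ℝ, ‖quadFeature z‖ ≤ C * inner ℝ θ (quadFeature z))
    (h₀ : ∀ z : Fin k → ℝ, ‖quadFeature z‖ ≤ C * inner ℝ θ₀ (quadFeature z))
    {μ : Measure (Fin k → ℝ)} [IsProbabilityMeasure μ] {n : ℕ} (x : Fin n → Fin k → ℝ)
    (p q : UpperTri k) :
    |momentDeviation γ μ θ x p q - momentDeviation γ μ θ₀ x p q| ≤
      n * (4 * C ^ 3 * ‖θ - θ₀‖) := by
  have hy := fun z => norm_normFeature_le hγ hθ hC (h z)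
  have hy₀ := fun z => norm_normFeature_le hγ hθ₀ hC (h₀ z)
  have hd : ∀ z, |normFeature γ θ z p * normFeature γ θ z q -
      normFeature γ θ₀ z p * normFeature γ θ₀ z q| ≤ 2 * C * (C ^ 2 * ‖θ - θ₀‖) := fun z =>
    abs_normFeature_mul_sub_le hC (hy z) (hy₀ z)
      (norm_normFeature_sub_le hγ hC hθ hθ₀ (h z) (h₀ z)) p q
  have hint : ∀ {t}, t ∈ posDefParams k → (∀ z, ‖normFeature γ t z‖ ≤ C) →
      Integrable (fun z => normFeature γ t z p * normFeature γ t z q) μ := fun ht hb =>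
    Integrable.of_bound ((measurable_normFeature_apply hγ ht p).mul
      (measurable_normFeature_apply hγ ht q)).aestronglyMeasurable (C ^ 2)
      (Eventually.of_forall fun z => abs_normFeature_mul_le hC (hb z) p q)
  have e : momentDeviation γ μ θ x p q - momentDeviation γ μ θ₀ x p q =
      ∑ i, (normFeature γ θ (x i) p * normFeature γ θ (x i) q -
        normFeature γ θ₀ (x i) p * normFeature γ θ₀ (x i) q) -
      n * ∫ z, (normFeature γ θ z p * normFeature γ θ z q -
        normFeature γ θ₀ z p * normFeature γ θ₀ z q) ∂μ := by
    rw [integral_sub (hint hθ hy) (hint hθ₀ hy₀), Finset.sum_sub_distrib, momentDeviation,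
      momentDeviation]
    ring
  rw [e]
  have h1 : |∑ i, (normFeature γ θ (x i) p * normFeature γ θ (x i) q -
        normFeature γ θ₀ (x i) p * normFeature γ θ₀ (x i) q)| ≤
      n * (2 * C * (C ^ 2 * ‖θ - θ₀‖)) := by
    refine (Finset.abs_sum_le_sum_abs _ _).trans
      ((Finset.sum_le_card_nsmul _ _ _ fun i _ => hd (x i)).trans (le_of_eq ?_))
    simp
  have h2 : |∫ z, (normFeature γ θ z p * normFeature γ θ z q -
        normFeature γ θ₀ z p * normFeature γ θ₀ z q) ∂μ| ≤ 2 * C * (C ^ 2 * ‖θ - θ₀‖) := by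
    have := norm_integral_le_of_norm_le_const (μ := μ) (f := fun z =>
      normFeature γ θ z p * normFeature γ θ z q - normFeature γ θ₀ z p * normFeature γ θ₀ z q)
      (Eventually.of_forall fun z => (Real.norm_eq_abs _).trans_le (hd z))
    simpa using this
  calc _ ≤ _ := abs_sub _ _
    _ ≤ n * (2 * C * (C ^ 2 * ‖θ - θ₀‖)) + n * (2 * C * (C ^ 2 * ‖θ - θ₀‖)) := by
        refine add_le_add h1 ?_
        rw [abs_mul, Nat.abs_cast]
        gcongr
    _ = _ := by ring

lemma abs_momentDeviation_le (hC : 0 ≤ C) (hy : ∀ z, ‖normFeature γ θ z‖ ≤ C)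
    {μ : Measure (Fin k → ℝ)} [IsProbabilityMeasure μ] {n : ℕ} (x : Fin n → Fin k → ℝ)
    (p q : UpperTri k) : |momentDeviation γ μ θ x p q| ≤ n * (2 * C ^ 2) := by
  have hb := fun z => abs_normFeature_mul_le hC (hy z) p q
  have h1 : |∑ i, normFeature γ θ (x i) p * normFeature γ θ (x i) q| ≤ n * C ^ 2 := by
    refine (Finset.abs_sum_le_sum_abs _ _).trans
      ((Finset.sum_le_card_nsmul _ _ _ fun i _ => hb (x i)).trans (le_of_eq ?_))
    simp
  have h2 : |∫ z, normFeature γ θ z p * normFeature γ θ z q ∂μ| ≤ C ^ 2 := by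
    have := norm_integral_le_of_norm_le_const (μ := μ)
      (f := fun z => normFeature γ θ z p * normFeature γ θ z q)
      (Eventually.of_forall fun z => (Real.norm_eq_abs _).trans_le (hb z))
    simpa using this
  calc _ ≤ _ := abs_sub _ _
    _ ≤ n * C ^ 2 + n * C ^ 2 := by
        refine add_le_add h1 ?_
        rw [abs_mul, Nat.abs_cast]
        gcongr
    _ = _ := by ring

lemma measurable_momentDeviation (hγ : 0 < γ) (hθ : θ ∈ posDefParams k) (μ : Measure (Fin k → ℝ))
    (n : ℕ) (p q : UpperTri k) :
    Measurable fun x : Fin n → Fin k → ℝ => momentDeviation γ μ θ x p q := by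
  refine (Finset.measurable_sum _ fun i _ => ?_).sub measurable_const
  exact ((measurable_normFeature_apply hγ hθ p).comp (measurable_pi_apply i)).mul
    ((measurable_normFeature_apply hγ hθ q).comp (measurable_pi_apply i))

lemma integrable_obsInfo (hγ : 0 < γ) (hC : 0 ≤ C) (hθ : θ ∈ posDefParams k)
    (hy : ∀ z, ‖normFeature γ θ z‖ ≤ C) {n : ℕ} {P : Measure (Fin n → Fin k → ℝ)}
    [IsProbabilityMeasure P] (p q : UpperTri k) :
    Integrable (fun x => obsInfo (sampleDensity γ n) θ x p q) P := by
  simp only [obsInfo_sampleDensity hγ _ hθ, hessian_tNLL_eq_normFeature hγ _ hθ]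
  refine ((integrable_finsetSum _ fun i _ => ?_).const_mul _).sub (integrable_const _)
  exact Integrable.of_bound (((measurable_normFeature_apply hγ hθ p).comp
    (measurable_pi_apply i)).mul ((measurable_normFeature_apply hγ hθ q).comp
      (measurable_pi_apply i))).aestronglyMeasurable (C ^ 2)
      (Eventually.of_forall fun x => abs_normFeature_mul_le hC (hy (x i)) p q)

/-- The second derivative of `log det` does not depend on the data and cancels, also for `θ ≠ θ₀`.
-/
lemma obsInfo_sub_expInfo (hγ : 0 < γ) (hC : 0 ≤ C) (hθ : θ ∈ posDefParams k)
    (hθ₀ : θ₀ ∈ posDefParams k) (hy : ∀ z, ‖normFeature γ θ z‖ ≤ C) {n : ℕ}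
    (x : Fin n → Fin k → ℝ) (p q : UpperTri k) :
    (obsInfo (sampleDensity γ n) θ x - expInfo (sampleLaw γ n θ₀) (sampleDensity γ n) θ) p q =
      -((γ + k) / 2) * momentDeviation γ (multivariateT γ (symMat θ₀)) θ x p q := by
  have hμ := isProbabilityMeasure_multivariateT hγ hθ₀
  have hP := isProbabilityMeasure_sampleLaw hγ n hθ₀
  have hm : Measurable fun z => normFeature γ θ z p * normFeature γ θ z q :=
    (measurable_normFeature_apply hγ hθ p).mul (measurable_normFeature_apply hγ hθ q)
  have hint : ∀ i : Fin n, Integrable (fun x : Fin n → Fin k → ℝ =>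
      normFeature γ θ (x i) p * normFeature γ θ (x i) q) (sampleLaw γ n θ₀) := fun i =>
    Integrable.of_bound (hm.comp (measurable_pi_apply i)).aestronglyMeasurable (C ^ 2)
      (Eventually.of_forall fun x => abs_normFeature_mul_le hC (hy (x i)) p q)
  have he : expInfo (sampleLaw γ n θ₀) (sampleDensity γ n) θ p q =
      -((γ + k) / 2) * (n * ∫ z, normFeature γ θ z p * normFeature γ θ z q
        ∂(multivariateT γ (symMat θ₀))) -
        n / 2 * fderiv ℝ (fderiv ℝ logDet) θ (EuclideanSpace.single p 1)
          (EuclideanSpace.single q 1) := by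
    simp only [expInfo, Matrix.of_apply, obsInfo_sampleDensity hγ _ hθ,
      hessian_tNLL_eq_normFeature hγ _ hθ]
    rw [integral_sub ((integrable_finsetSum _ fun i _ => hint i).const_mul _) (integrable_const _),
      integral_const_mul, integral_finsetSum _ fun i _ => hint i]
    have hi : ∀ i : Fin n, ∫ x, normFeature γ θ (x i) p * normFeature γ θ (x i) q
        ∂(sampleLaw γ n θ₀) = ∫ z, normFeature γ θ z p * normFeature γ θ z q
        ∂(multivariateT γ (symMat θ₀)) := fun i => integral_comp_eval i hm
    simp only [hi]
    simp
  rw [Matrix.sub_apply, he, obsInfo_sampleDensity hγ _ hθ, hessian_tNLL_eq_normFeature hγ _ hθ,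
    momentDeviation]
  ring

end Deviation

/-! ### From tail bounds to exponential moments. -/

section ExpMoment

variable {Ω : Type*} [MeasurableSpace Ω] {P : Measure Ω} [IsProbabilityMeasure P] {Y : Ω → ℝ}
  {M : ℝ}

lemma integrable_exp_of_le (hYm : Measurable Y) (hYM : ∀ x, Y x ≤ M) :
    Integrable (fun x => Real.exp (Y x)) P :=
  Integrable.of_bound hYm.exp.aestronglyMeasurable (Real.exp M) (Eventually.of_forall fun x => by
    rw [Real.norm_eq_abs, Real.abs_exp]
    exact Real.exp_le_exp.2 (hYM x))

/-- By `y ≤ eʸ - 1`. Together with `lintegral_ofReal_exp_le` it lets the single number `E[e^Y - 1]`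
serve as the error in both Hessian bounds. -/
lemma lintegral_ofReal_le_integral_exp_sub_one (hYm : Measurable Y) (hY0 : ∀ x, 0 ≤ Y x)
    (hYM : ∀ x, Y x ≤ M) :
    ∫⁻ x, ENNReal.ofReal (Y x) ∂P ≤ ENNReal.ofReal (∫ x, (Real.exp (Y x) - 1) ∂P) := by
  have hle : ∀ x, Y x ≤ Real.exp (Y x) - 1 := fun x => by linarith [Real.add_one_le_exp (Y x)]
  have hint : Integrable (fun x => Real.exp (Y x) - 1) P :=
    (integrable_exp_of_le hYm hYM).sub (integrable_const 1)
  rw [ofReal_integral_eq_lintegral_ofReal hint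
    (Eventually.of_forall fun x => (hY0 x).trans (hle x))]
  exact lintegral_mono fun x => ENNReal.ofReal_le_ofReal (hle x)

/-- If `ε = E[e^Y - 1]`, then `E[e^Y] = 1 + ε ≤ e^ε`. -/
lemma lintegral_ofReal_exp_le (hYm : Measurable Y) (hYM : ∀ x, Y x ≤ M) :
    ∫⁻ x, ENNReal.ofReal (Real.exp (Y x)) ∂P ≤
      ENNReal.ofReal (Real.exp (∫ x, (Real.exp (Y x) - 1) ∂P)) := by
  have hint := integrable_exp_of_le (P := P) hYm hYM
  rw [← ofReal_integral_eq_lintegral_ofReal hint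
    (Eventually.of_forall fun x => (Real.exp_pos _).le)]
  refine ENNReal.ofReal_le_ofReal ?_
  have h := Real.add_one_le_exp (∫ x, (Real.exp (Y x) - 1) ∂P)
  rw [integral_sub hint (integrable_const 1)] at h ⊢
  simpa using h

/-- On the event `Y ≤ y` the bound `eᵗ - 1 ≤ 2t` on `[0, 1]` applies; on its complement the
integrand is at most `e^M`. -/
lemma integral_exp_sub_one_le (hYm : Measurable Y) (hY0 : ∀ x, 0 ≤ Y x) (hYM : ∀ x, Y x ≤ M)
    {y β : ℝ} (hy0 : 0 ≤ y) (hy1 : y ≤ 1) (hβ : 0 ≤ β)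
    (hbad : P {x | y < Y x} ≤ ENNReal.ofReal β) :
    ∫ x, (Real.exp (Y x) - 1) ∂P ≤ 2 * y + Real.exp M * β := by
  have hms : MeasurableSet {x | y < Y x} := measurableSet_lt measurable_const hYm
  have hle : ∀ x, Real.exp (Y x) - 1 ≤
      2 * y + Set.indicator {x | y < Y x} (fun _ => Real.exp M) x := by
    intro x
    by_cases hx : y < Y x
    · rw [Set.indicator_of_mem (by exact hx)]
      linarith [Real.exp_le_exp.2 (hYM x)]
    · rw [Set.indicator_of_notMem (by exact hx), add_zero]
      have h1 : Y x ≤ y := not_lt.1 hx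
      have h2 := Real.abs_exp_sub_one_le (x := Y x)
        (by rw [abs_of_nonneg (hY0 x)]; linarith)
      rw [abs_of_nonneg (hY0 x)] at h2
      linarith [le_abs_self (Real.exp (Y x) - 1)]
  calc ∫ x, (Real.exp (Y x) - 1) ∂P
      ≤ ∫ x, (2 * y + Set.indicator {x | y < Y x} (fun _ => Real.exp M) x) ∂P :=
        integral_mono ((integrable_exp_of_le hYm hYM).sub (integrable_const 1))
          ((integrable_const _).add ((integrable_const _).indicator hms)) hle
    _ = 2 * y + P.real {x | y < Y x} * Real.exp M := by
        rw [integral_add (integrable_const _) ((integrable_const _).indicator hms),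
          integral_indicator_const _ hms]
        simp
    _ ≤ 2 * y + Real.exp M * β := by
        rw [mul_comm (P.real _)]
        gcongr
        exact ENNReal.toReal_le_of_le_ofReal hβ hbad

end ExpMoment

lemma supDeviation_le {ι : Type*} [Fintype ι] [DecidableEq ι] {Θ : Set (EuclideanSpace ℝ ι)}
    {θ₀ : EuclideanSpace ℝ ι} {r y : ℝ} {D : EuclideanSpace ℝ ι → Matrix ι ι ℝ} (hy : 0 ≤ y)
    (h : ∀ θ ∈ Metric.closedBall θ₀ r ∩ Θ, ∑ i, ∑ j, |D θ i j| ≤ y) :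
    supDeviation Θ θ₀ r D ≤ ENNReal.ofReal (r ^ 2 * y) := by
  refine iSup₂_le fun θ hθ => ENNReal.ofReal_le_ofReal ?_
  gcongr
  exact max_le ((lamMax_le_sum_abs _).trans (h θ hθ)) hy

/-- An envelope for the entries of the Hessian deviations over a ball of radius `r`. -/
noncomputable def hessianEnvelope {k : ℕ} (γ C r : ℝ) (θ₀ : EuclideanSpace ℝ (UpperTri k)) {n : ℕ}
    (x : Fin n → Fin k → ℝ) : ℝ :=
  ∑ p : UpperTri k, ∑ q : UpperTri k, (γ + k) / 2 *
    (|momentDeviation γ (multivariateT γ (symMat θ₀)) θ₀ x p q| + n * (4 * C ^ 3 * r))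

/-! ### A measurable envelope for the Hessian deviations over a ball. -/

section Envelope

variable {k : ℕ} {γ C r : ℝ} {θ₀ : EuclideanSpace ℝ (UpperTri k)} {n : ℕ}

lemma measurable_hessianEnvelope (hγ : 0 < γ) (hθ₀ : θ₀ ∈ posDefParams k) :
    Measurable fun x : Fin n → Fin k → ℝ => hessianEnvelope γ C r θ₀ x :=
  Finset.measurable_sum _ fun p _ => Finset.measurable_sum _ fun q _ =>
    (((measurable_momentDeviation hγ hθ₀ _ n p q).abs).add_const _).const_mul _

lemma hessianEnvelope_nonneg (hγ : 0 < γ) (hC : 0 ≤ C) (hr : 0 ≤ r) (x : Fin n → Fin k → ℝ) :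
    0 ≤ hessianEnvelope γ C r θ₀ x := by
  unfold hessianEnvelope
  positivity

lemma hessianEnvelope_le (hγ : 0 < γ) {x : Fin n → Fin k → ℝ} {b : ℝ}
    (hb : ∀ p q, |momentDeviation γ (multivariateT γ (symMat θ₀)) θ₀ x p q| ≤ b) :
    hessianEnvelope γ C r θ₀ x ≤
      (Fintype.card (UpperTri k)) ^ 2 * ((γ + k) / 2 * (b + n * (4 * C ^ 3 * r))) := by
  unfold hessianEnvelope
  calc _ ≤ ∑ p : UpperTri k, ∑ q : UpperTri k, (γ + k) / 2 * (b + n * (4 * C ^ 3 * r)) := by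
        gcongr with p _ q _
        exact hb p q
    _ = _ := by simp [sq, mul_assoc]

/-- The envelope involves the data only through deviations at `θ₀`, so it is measurable in `x`;
measurability of the supremum over the ball never has to be addressed. -/
lemma sum_abs_obsInfo_sub_expInfo_le (hγ : 0 < γ) (hC : 0 ≤ C) (hθ₀ : θ₀ ∈ posDefParams k)
    (hb : ∀ θ ∈ Metric.closedBall θ₀ r, ∀ z : Fin k → ℝ,
      ‖quadFeature z‖ ≤ C * inner ℝ θ (quadFeature z)) (hr : 0 ≤ r)
    {θ : EuclideanSpace ℝ (UpperTri k)} (hθ : θ ∈ Metric.closedBall θ₀ r ∩ posDefParams k)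
    (x : Fin n → Fin k → ℝ) :
    ∑ p, ∑ q, |(obsInfo (sampleDensity γ n) θ x -
      expInfo (sampleLaw γ n θ₀) (sampleDensity γ n) θ) p q| ≤ hessianEnvelope γ C r θ₀ x := by
  have hμ := isProbabilityMeasure_multivariateT hγ hθ₀
  have hh := hb θ hθ.1
  have hh₀ := hb θ₀ (Metric.mem_closedBall_self hr)
  have hn : ‖θ - θ₀‖ ≤ r := by rw [← dist_eq_norm]; exact hθ.1
  refine Finset.sum_le_sum fun p _ => Finset.sum_le_sum fun q _ => ?_
  rw [obsInfo_sub_expInfo hγ hC hθ.2 hθ₀ (fun z => norm_normFeature_le hγ hθ.2 hC (hh z)),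
    abs_mul, abs_neg, abs_of_nonneg (by positivity)]
  gcongr
  have h1 := abs_momentDeviation_sub_le hγ hC hθ.2 hθ₀ hh hh₀
    (μ := multivariateT γ (symMat θ₀)) x p q
  have h2 : (n : ℝ) * (4 * C ^ 3 * ‖θ - θ₀‖) ≤ n * (4 * C ^ 3 * r) := by gcongr
  have h3 := abs_sub_abs_le_abs_sub (momentDeviation γ (multivariateT γ (symMat θ₀)) θ x p q)
    (momentDeviation γ (multivariateT γ (symMat θ₀)) θ₀ x p q)
  linarith

lemma measure_momentDeviation_le (hγ : 0 < γ) (hC : 0 < C) (hθ₀ : θ₀ ∈ posDefParams k)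
    (hh : ∀ z : Fin k → ℝ, ‖quadFeature z‖ ≤ C * inner ℝ θ₀ (quadFeature z)) (hn : 1 ≤ n) (p : ℕ)
    {A : ℝ} (hA : 0 ≤ A) (hAp : 2 * p * (C ^ 2) ^ 2 ≤ A ^ 2) :
    sampleLaw γ n θ₀ {x | ∃ i j, A * √(n * Real.log n) <
        |momentDeviation γ (multivariateT γ (symMat θ₀)) θ₀ x i j|} ≤
      ENNReal.ofReal (Fintype.card (UpperTri k) ^ 2 * (2 * ((n : ℝ) ^ p)⁻¹)) := by
  have hμ := isProbabilityMeasure_multivariateT hγ hθ₀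
  have h1 : ∀ i j : UpperTri k, sampleLaw γ n θ₀ {x | A * √(n * Real.log n) <
        |momentDeviation γ (multivariateT γ (symMat θ₀)) θ₀ x i j|} ≤
      ENNReal.ofReal (2 * ((n : ℝ) ^ p)⁻¹) := fun i j =>
    hoeffding_pi hn ((measurable_normFeature_apply hγ hθ₀ i).mul
      (measurable_normFeature_apply hγ hθ₀ j)) (by positivity)
      (fun z => abs_normFeature_mul_le hC.le (norm_normFeature_le hγ hθ₀ hC.le (hh z)) i j) p hA hAp
  simp only [Set.ofPred_exists]
  calc _ ≤ ∑ i : UpperTri k, ∑ j : UpperTri k, sampleLaw γ n θ₀ {x | A * √(n * Real.log n) <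
        |momentDeviation γ (multivariateT γ (symMat θ₀)) θ₀ x i j|} :=
        (measure_iUnion_fintype_le _ _).trans
          (Finset.sum_le_sum fun i _ => measure_iUnion_fintype_le _ _)
    _ ≤ ∑ i : UpperTri k, ∑ j : UpperTri k, ENNReal.ofReal (2 * ((n : ℝ) ^ p)⁻¹) :=
        Finset.sum_le_sum fun i _ => Finset.sum_le_sum fun j _ => h1 i j
    _ = _ := by
        rw [ENNReal.ofReal_mul (by positivity : (0 : ℝ) ≤ Fintype.card (UpperTri k) ^ 2),
          ENNReal.ofReal_pow (by positivity), ENNReal.ofReal_natCast]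
        simp only [Finset.sum_const, Finset.card_univ, nsmul_eq_mul, sq, mul_assoc]

end Envelope

/-- The Hessian conditions at `θ₀`, on balls whose radius is of order `√(log n / n)`. -/
lemma exists_hessian_error {k : ℕ} {γ : ℝ} (hγ : 0 < γ) {θ₀ : EuclideanSpace ℝ (UpperTri k)}
    (hθ₀ : θ₀ ∈ posDefParams k) {C r₀ : ℝ} (hC : 0 < C)
    (hb : ∀ θ ∈ Metric.closedBall θ₀ r₀, ∀ z : Fin k → ℝ,
      ‖quadFeature z‖ ≤ C * inner ℝ θ (quadFeature z))
    {r : ℕ → ℝ} (hr0 : ∀ n, 0 < r n) (hrr : ∀ n, r n ≤ r₀) {R : ℝ} (hR : 0 < R)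
    (hr : ∀ᶠ n : ℕ in atTop, r n = R * √(Real.log n / n)) :
    ∃ ε : ℕ → ℝ, (∀ n, 0 ≤ ε n) ∧ IsSoftO ε (fun n => (n : ℝ) ^ (-(1 / 2) : ℝ)) ∧
      ∀ n, (∀ θ ∈ Metric.closedBall θ₀ (r n) ∩ posDefParams k, ∀ i j,
          Integrable (fun x => obsInfo (sampleDensity γ n) θ x i j) (sampleLaw γ n θ₀)) ∧
        ∫⁻ x, supDeviation (posDefParams k) θ₀ (r n)
          (fun θ => expInfo (sampleLaw γ n θ₀) (sampleDensity γ n) θ -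
            obsInfo (sampleDensity γ n) θ x) ∂(sampleLaw γ n θ₀) ≤ ENNReal.ofReal (ε n) ∧
        ∫⁻ x, EReal.exp (supDeviation (posDefParams k) θ₀ (r n)
          (fun θ => obsInfo (sampleDensity γ n) θ x -
            expInfo (sampleLaw γ n θ₀) (sampleDensity γ n) θ)) ∂(sampleLaw γ n θ₀) ≤
          ENNReal.ofReal (Real.exp (ε n)) := by
  have hμ := isProbabilityMeasure_multivariateT hγ hθ₀
  have hP := fun n => isProbabilityMeasure_sampleLaw hγ n hθ₀
  have hbr : ∀ n, ∀ θ ∈ Metric.closedBall θ₀ (r n), ∀ z : Fin k → ℝ,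
      ‖quadFeature z‖ ≤ C * inner ℝ θ (quadFeature z) := fun n θ hθ =>
    hb θ (Metric.closedBall_subset_closedBall (hrr n) hθ)
  have hb₀ := hbr 0 θ₀ (Metric.mem_closedBall_self (hr0 0).le)
  have hy₀ := fun z => norm_normFeature_le hγ hθ₀ hC.le (hb₀ z)
  let Y : (n : ℕ) → (Fin n → Fin k → ℝ) → ℝ := fun n x =>
    r n ^ 2 * hessianEnvelope γ C (r n) θ₀ x
  have hYm : ∀ n, Measurable (Y n) := fun n => (measurable_hessianEnvelope hγ hθ₀).const_mul _
  have hY0 : ∀ n x, 0 ≤ Y n x := fun n x =>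
    mul_nonneg (sq_nonneg _) (hessianEnvelope_nonneg hγ hC.le (hr0 n).le x)
  set d : ℝ := (Fintype.card (UpperTri k) : ℝ) ^ 2 with hd
  have hd0 : 0 ≤ d := by positivity
  set a : ℝ := (γ + k) / 2 with ha
  have ha0 : 0 < a := by positivity
  have hYM : ∀ n x, Y n x ≤ r n ^ 2 * (d * (a * (n * (2 * C ^ 2) + n * (4 * C ^ 3 * r₀)))) := by
    intro n x
    refine mul_le_mul_of_nonneg_left ((hessianEnvelope_le hγ
      (fun p q => abs_momentDeviation_le hC.le hy₀ x p q)).trans ?_) (sq_nonneg _)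
    have := hrr n
    gcongr
  -- This `ε` makes both bounds hold for every `n` without asymptotics; only its rate needs large
  -- `n`.
  refine ⟨fun n => ∫ x, (Real.exp (Y n x) - 1) ∂(sampleLaw γ n θ₀), fun n => ?_, ?_, fun n =>
    ⟨?_, ?_, ?_⟩⟩
  · exact integral_nonneg fun x => sub_nonneg.2 (Real.one_le_exp (hY0 n x))
  · set M : ℝ := R ^ 2 * (d * (a * (2 * C ^ 2 + 4 * C ^ 3 * r₀))) with hM
    obtain ⟨m, hm⟩ := exists_nat_ge M
    set p := m + 1 with hp
    set A : ℝ := √(2 * p * (C ^ 2) ^ 2) with hA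
    have hA0 : 0 ≤ A := Real.sqrt_nonneg _
    have hA2 : 2 * p * (C ^ 2) ^ 2 ≤ A ^ 2 := by rw [hA, Real.sq_sqrt (by positivity)]
    set K : ℝ := R ^ 2 * (d * (a * (A + 4 * C ^ 3 * R))) with hK
    have hK0 : 0 ≤ K := by positivity
    clear_value K M A d a
    have hsmall : ∀ᶠ n : ℕ in atTop, K * (√(Real.log n / n) * Real.log n) ≤ 1 := by
      have h1 : Tendsto (fun x : ℝ => K * √(Real.log x ^ 3 / x)) atTop (𝓝 0) := by
        have h := (Real.isLittleO_pow_log_id_atTop (n := 3)).tendsto_div_nhds_zero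
        have h2 := (Real.continuous_sqrt.tendsto 0).comp h
        simpa [Function.comp_def] using h2.const_mul K
      have h2 := h1.comp tendsto_natCast_atTop_atTop
      filter_upwards [h2.eventually_le_const zero_lt_one, eventually_ge_atTop 1] with n hn hn1
      have hlog : 0 ≤ Real.log n := Real.log_nonneg (by exact_mod_cast hn1)
      have e : √(Real.log n / n) * Real.log n = √(Real.log n ^ 3 / n) := by
        rw [show Real.log n ^ 3 / n = Real.log n / n * Real.log n ^ 2 by ring,
          Real.sqrt_mul (by positivity), Real.sqrt_sq hlog]
      rw [e]
      exact hn
    have hlog1 : ∀ᶠ n : ℕ in atTop, 1 ≤ Real.log n :=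
      (Real.tendsto_log_atTop.comp tendsto_natCast_atTop_atTop).eventually_ge_atTop 1
    -- The true order on the good event is `log^{3/2} n / √n`; the exponent is rounded up to the
    -- integer 2.
    refine ⟨2, IsBigO.of_bound (2 * K + 2 * d) ?_⟩
    filter_upwards [hsmall, hlog1, hr, eventually_ge_atTop 1] with n hs hl hrn hn1
    have hn0 : (0 : ℝ) < n := by exact_mod_cast hn1
    set L := √(Real.log n / n) with hL
    have hL0 : 0 ≤ L := Real.sqrt_nonneg _
    have hL2 : n * L ^ 2 = Real.log n := by
      rw [hL, Real.sq_sqrt (by positivity)]; field_simp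
    have hMn : ∀ x, Y n x ≤ M * Real.log n := fun x => (hYM n x).trans (le_of_eq (by
      rw [hrn, hM, ← hL2]; ring))
    have hgood : ∀ x : Fin n → Fin k → ℝ, (∀ i j, |momentDeviation γ (multivariateT γ (symMat θ₀))
        θ₀ x i j| ≤ A * √(n * Real.log n)) → Y n x ≤ K * (L * Real.log n) := by
      intro x hx
      refine (mul_le_mul_of_nonneg_left (hessianEnvelope_le hγ hx) (sq_nonneg _)).trans
        (le_of_eq ?_)
      rw [sqrt_mul_log_eq hn1, ← hL, hrn, hK, ← hL2, hd, ha]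
      ring
    have hbad : sampleLaw γ n θ₀ {x | K * (L * Real.log n) < Y n x} ≤
        ENNReal.ofReal (d * (2 * ((n : ℝ) ^ p)⁻¹)) := by
      rw [hd]
      refine (measure_mono fun x hx => ?_).trans
        (measure_momentDeviation_le hγ hC hθ₀ hb₀ hn1 p hA0 hA2)
      by_contra hcon
      simp only [Set.mem_ofPred_eq, not_exists, not_lt] at hcon hx
      exact absurd hx (not_lt.2 (hgood x hcon))
    have hmain := integral_exp_sub_one_le (hYm n) (hY0 n) hMn (by positivity) hs (by positivity)
      hbad
    have hexp : Real.exp (M * Real.log n) * (d * (2 * ((n : ℝ) ^ p)⁻¹)) ≤ 2 * d * (n : ℝ)⁻¹ := by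
      have h1 : Real.exp (M * Real.log n) ≤ (n : ℝ) ^ m := by
        rw [← Real.exp_log (pow_pos hn0 m), Real.log_pow]
        exact Real.exp_le_exp.2 (by gcongr)
      calc _ ≤ (n : ℝ) ^ m * (d * (2 * ((n : ℝ) ^ p)⁻¹)) := by gcongr
        _ = _ := by rw [hp, pow_succ]; field_simp
    have hsq : (n : ℝ) ^ (-(1 / 2) : ℝ) = (√n)⁻¹ := by
      rw [Real.rpow_neg hn0.le, Real.sqrt_eq_rpow]
    have hL' : L * Real.log n ≤ (√n)⁻¹ * Real.log n ^ 2 := by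
      rw [hL, Real.sqrt_div (by linarith)]
      have : √(Real.log n) ≤ Real.log n := by
        rw [Real.sqrt_le_left (by linarith)]; nlinarith
      calc √(Real.log n) / √n * Real.log n ≤ Real.log n / √n * Real.log n := by gcongr
        _ = _ := by ring
    have hinv : (n : ℝ)⁻¹ ≤ (√n)⁻¹ * Real.log n ^ 2 := by
      have h1 : (n : ℝ)⁻¹ ≤ (√n)⁻¹ := by
        refine inv_anti₀ (Real.sqrt_pos.2 hn0) ?_
        rw [Real.sqrt_le_left hn0.le]
        have : (1 : ℝ) ≤ n := by exact_mod_cast hn1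
        nlinarith
      refine h1.trans (le_mul_of_one_le_right (by positivity) ?_)
      nlinarith
    rw [hsq, Real.norm_eq_abs, Real.norm_eq_abs, abs_of_nonneg (a := (√(n : ℝ))⁻¹ * _)
      (by positivity), abs_of_nonneg (integral_nonneg fun x =>
        sub_nonneg.2 (Real.one_le_exp (hY0 n x)))]
    calc _ ≤ 2 * (K * (L * Real.log n)) + 2 * d * (n : ℝ)⁻¹ := hmain.trans (by gcongr)
      _ ≤ 2 * (K * ((√n)⁻¹ * Real.log n ^ 2)) + 2 * d * ((√n)⁻¹ * Real.log n ^ 2) := by gcongr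
      _ = _ := by ring
  · intro θ hθ i j
    exact integrable_obsInfo hγ hC.le hθ.2
      (fun z => norm_normFeature_le hγ hθ.2 hC.le (hbr n θ hθ.1 z)) i j
  · refine (lintegral_mono fun x => ?_).trans
      (lintegral_ofReal_le_integral_exp_sub_one (hYm n) (hY0 n) (hYM n))
    refine supDeviation_le (hessianEnvelope_nonneg hγ hC.le (hr0 n).le x) fun θ hθ => ?_
    refine le_of_eq_of_le ?_ (sum_abs_obsInfo_sub_expInfo_le hγ hC.le hθ₀ (hbr n) (hr0 n).le hθ x)
    refine Finset.sum_congr rfl fun i _ => Finset.sum_congr rfl fun j _ => ?_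
    rw [Matrix.sub_apply, Matrix.sub_apply, abs_sub_comm]
  · refine (lintegral_mono fun x => ?_).trans (lintegral_ofReal_exp_le (hYm n) (hYM n))
    have h : supDeviation (posDefParams k) θ₀ (r n) (fun θ => obsInfo (sampleDensity γ n) θ x -
        expInfo (sampleLaw γ n θ₀) (sampleDensity γ n) θ) ≤ ENNReal.ofReal (Y n x) :=
      supDeviation_le (hessianEnvelope_nonneg hγ hC.le (hr0 n).le x) fun θ hθ =>
        sum_abs_obsInfo_sub_expInfo_le hγ hC.le hθ₀ (hbr n) (hr0 n).le hθ x
    calc _ ≤ EReal.exp ((ENNReal.ofReal (Y n x) : ℝ≥0∞) : EReal) :=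
          EReal.exp_monotone (by exact_mod_cast h)
      _ = _ := by rw [EReal.coe_ennreal_ofReal, max_eq_left (hY0 n x), EReal.exp_coe]

/-! ### The local behaviour of the likelihood around the true parameter -/

lemma inner_eq_sum_mul {ι : Type*} [Fintype ι] (v y : EuclideanSpace ℝ ι) :
    inner ℝ v y = ∑ p, v p * y p := by
  simp [PiLp.inner_apply, mul_comm]

lemma inner_sq_eq_sum_mul {ι : Type*} [Fintype ι] (v y : EuclideanSpace ℝ ι) :
    inner ℝ v y ^ 2 = ∑ p, ∑ q, v p * v q * (y p * y q) := by
  rw [inner_eq_sum_mul, sq, Finset.sum_mul_sum]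
  exact Finset.sum_congr rfl fun p _ => Finset.sum_congr rfl fun q _ => by ring

lemma eventually_norm_sub_lt {X F : Type*} [TopologicalSpace X] [NormedAddCommGroup F] {f : X → F}
    {a : X} (h : ContinuousAt f a) {c : ℝ} (hc : 0 < c) : ∀ᶠ x in 𝓝 a, ‖f x - f a‖ < c := by
  have h : ContinuousAt (fun θ => ‖f θ - f a‖) a := (h.sub continuousAt_const).norm
  exact h.tendsto.eventually_lt_const (by simpa using hc)

lemma eventually_abs_fderiv_fderiv_sub_le {E : Type*} [NormedAddCommGroup E] [NormedSpace ℝ E]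
    {g : E → ℝ} {a : E} (h : ContDiffAt ℝ 2 g a) {c : ℝ} (hc : 0 < c) :
    ∀ᶠ x in 𝓝 a, ∀ v : E,
      |fderiv ℝ (fderiv ℝ g) x v v - fderiv ℝ (fderiv ℝ g) a v v| ≤ c * ‖v‖ * ‖v‖ := by
  have hcont := eventually_norm_sub_lt (F := E →L[ℝ] E →L[ℝ] ℝ)
    ((h.fderiv_right (m := 1) (by norm_num)).fderiv_right (m := 0) (by norm_num)).continuousAt hc
  filter_upwards [hcont] with x hx v
  have h2 := ContinuousLinearMap.le_opNorm₂
    (fderiv ℝ (fderiv ℝ g) x - fderiv ℝ (fderiv ℝ g) a) v v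
  rw [Real.norm_eq_abs] at h2
  refine h2.trans ?_
  gcongr

section Local

variable {k : ℕ} {γ C : ℝ} {θ θ₀ : EuclideanSpace ℝ (UpperTri k)} {n : ℕ}

/-- The centred sum `∑ᵢ y_p(xᵢ) - n 𝔼[y_p]` of the normalized features. -/
noncomputable def scoreDeviation (γ : ℝ) (μ : Measure (Fin k → ℝ))
    (θ : EuclideanSpace ℝ (UpperTri k)) (x : Fin n → Fin k → ℝ) (p : UpperTri k) : ℝ :=
  ∑ i, normFeature γ θ (x i) p - n * ∫ z, normFeature γ θ z p ∂μ

lemma integrable_normFeature_apply (hγ : 0 < γ) (hθ : θ ∈ posDefParams k)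
    (hy : ∀ z, ‖normFeature γ θ z‖ ≤ C) {μ : Measure (Fin k → ℝ)} [IsProbabilityMeasure μ]
    (p : UpperTri k) : Integrable (fun z => normFeature γ θ z p) μ :=
  Integrable.of_bound (measurable_normFeature_apply hγ hθ p).aestronglyMeasurable C
    (Eventually.of_forall fun z => (abs_apply_le_norm _ p).trans (hy z))

lemma sum_inner_normFeature_sub (hγ : 0 < γ) (hθ : θ ∈ posDefParams k)
    (hy : ∀ z, ‖normFeature γ θ z‖ ≤ C) {μ : Measure (Fin k → ℝ)} [IsProbabilityMeasure μ]
    (x : Fin n → Fin k → ℝ) (v : EuclideanSpace ℝ (UpperTri k)) :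
    ∑ i, inner ℝ v (normFeature γ θ (x i)) - n * ∫ z, inner ℝ v (normFeature γ θ z) ∂μ =
      ∑ p, v p * scoreDeviation γ μ θ x p := by
  simp only [inner_eq_sum_mul]
  rw [integral_finsetSum _ fun p _ => (integrable_normFeature_apply hγ hθ hy p).const_mul (v p),
    Finset.sum_comm, Finset.mul_sum, ← Finset.sum_sub_distrib]
  refine Finset.sum_congr rfl fun p _ => ?_
  rw [integral_const_mul, ← Finset.mul_sum, scoreDeviation]
  ring

lemma sum_inner_normFeature_sq_sub (hγ : 0 < γ) (hC : 0 ≤ C) (hθ : θ ∈ posDefParams k)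
    (hy : ∀ z, ‖normFeature γ θ z‖ ≤ C) {μ : Measure (Fin k → ℝ)} [IsProbabilityMeasure μ]
    (x : Fin n → Fin k → ℝ) (v : EuclideanSpace ℝ (UpperTri k)) :
    ∑ i, inner ℝ v (normFeature γ θ (x i)) ^ 2 -
        n * ∫ z, inner ℝ v (normFeature γ θ z) ^ 2 ∂μ =
      ∑ p, ∑ q, v p * v q * momentDeviation γ μ θ x p q := by
  have hint : ∀ p q, Integrable (fun z => v p * v q *
      (normFeature γ θ z p * normFeature γ θ z q)) μ := fun p q =>
    (Integrable.of_bound ((measurable_normFeature_apply hγ hθ p).mul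
      (measurable_normFeature_apply hγ hθ q)).aestronglyMeasurable (C ^ 2)
      (Eventually.of_forall fun z => abs_normFeature_mul_le hC (hy z) p q)).const_mul _
  simp only [inner_sq_eq_sum_mul]
  rw [integral_finsetSum _ fun p _ => integrable_finsetSum _ fun q _ => hint p q,
    Finset.sum_comm, Finset.mul_sum, ← Finset.sum_sub_distrib]
  refine Finset.sum_congr rfl fun p _ => ?_
  rw [integral_finsetSum _ fun q _ => hint p q, Finset.sum_comm, Finset.mul_sum,
    ← Finset.sum_sub_distrib]
  refine Finset.sum_congr rfl fun q _ => ?_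
  rw [integral_const_mul, ← Finset.mul_sum, momentDeviation]
  ring

lemma abs_sum_mul_le {ι : Type*} [Fintype ι] (v : EuclideanSpace ℝ ι) {G : ι → ℝ} {b : ℝ}
    (hG : ∀ p, |G p| ≤ b) : |∑ p, v p * G p| ≤ Fintype.card ι * (‖v‖ * b) := by
  refine (Finset.abs_sum_le_sum_abs _ _).trans
    ((Finset.sum_le_card_nsmul _ _ (‖v‖ * b) fun p _ => ?_).trans (le_of_eq (by simp)))
  rw [abs_mul]
  exact mul_le_mul (abs_apply_le_norm v p) (hG p) (abs_nonneg _) (norm_nonneg _)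

lemma abs_sum_sum_mul_le {ι : Type*} [Fintype ι] (v : EuclideanSpace ℝ ι) {S : ι → ι → ℝ} {b : ℝ}
    (hS : ∀ p q, |S p q| ≤ b) :
    |∑ p, ∑ q, v p * v q * S p q| ≤ Fintype.card ι ^ 2 * (‖v‖ ^ 2 * b) := by
  have h : ∀ p, |∑ q, v q * S p q| ≤ Fintype.card ι * (‖v‖ * b) := fun p => abs_sum_mul_le v (hS p)
  have e : ∑ p, ∑ q, v p * v q * S p q = ∑ p, v p * ∑ q, v q * S p q := by
    simp only [Finset.mul_sum, mul_assoc]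
  rw [e]
  exact (abs_sum_mul_le v h).trans (le_of_eq (by ring))

lemma fderiv_tNLL_eq_inner_normFeature (hγ : 0 < γ) (x : Fin n → Fin k → ℝ)
    (hθ : θ ∈ posDefParams k) (v : EuclideanSpace ℝ (UpperTri k)) :
    fderiv ℝ (tNLL γ n x) θ v = (γ + k) / 2 * (∑ i, inner ℝ v (normFeature γ θ (x i))) -
      n / 2 * fderiv ℝ logDet θ v := by
  rw [fderiv_tNLL_apply hγ x hθ]
  simp only [normFeature, inner_smul_right]

/-- The score at the true parameter is centred. -/
lemma abs_fderiv_tNLL_le (hγ : 0 < γ) (hθ₀ : θ₀ ∈ posDefParams k)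
    (hy : ∀ z, ‖normFeature γ θ₀ z‖ ≤ C) (x : Fin n → Fin k → ℝ) {b : ℝ}
    (hb : ∀ p, |scoreDeviation γ (multivariateT γ (symMat θ₀)) θ₀ x p| ≤ b)
    (v : EuclideanSpace ℝ (UpperTri k)) :
    |fderiv ℝ (tNLL γ n x) θ₀ v| ≤ (γ + k) / 2 * (Fintype.card (UpperTri k) * (‖v‖ * b)) := by
  have hμ := isProbabilityMeasure_multivariateT hγ hθ₀
  have e : fderiv ℝ (tNLL γ n x) θ₀ v = (γ + k) / 2 *
      ∑ p, v p * scoreDeviation γ (multivariateT γ (symMat θ₀)) θ₀ x p := by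
    rw [← sum_inner_normFeature_sub hγ hθ₀ hy, fderiv_tNLL_eq_inner_normFeature hγ x hθ₀]
    linear_combination -(n : ℝ) * (score_mean_and_information hγ hθ₀ v).1
  rw [e, abs_mul, abs_of_nonneg (by positivity)]
  gcongr
  exact abs_sum_mul_le v hb

lemma inner_normFeature_sub_eq (hγ : 0 < γ) (hθ : θ ∈ posDefParams k) (hθ₀ : θ₀ ∈ posDefParams k)
    (v : EuclideanSpace ℝ (UpperTri k)) (z : Fin k → ℝ) :
    inner ℝ v (normFeature γ θ z) - inner ℝ v (normFeature γ θ₀ z) =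
      -(inner ℝ (θ - θ₀) (normFeature γ θ₀ z) * inner ℝ v (normFeature γ θ z)) := by
  have hD := add_inner_quadFeature_pos hγ hθ z
  have hD₀ := add_inner_quadFeature_pos hγ hθ₀ z
  rw [inner_normFeature, inner_normFeature, inner_normFeature, inner_sub_left]
  field_simp
  ring

lemma abs_inner_normFeature_le (hy : ∀ z, ‖normFeature γ θ z‖ ≤ C)
    (v : EuclideanSpace ℝ (UpperTri k)) (z : Fin k → ℝ) :
    |inner ℝ v (normFeature γ θ z)| ≤ ‖v‖ * C :=
  (abs_real_inner_le_norm _ _).trans (by gcongr; exact hy z)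

lemma abs_inner_normFeature_sub_le (hγ : 0 < γ) (hθ : θ ∈ posDefParams k)
    (hθ₀ : θ₀ ∈ posDefParams k) (hy : ∀ z, ‖normFeature γ θ z‖ ≤ C)
    (hy₀ : ∀ z, ‖normFeature γ θ₀ z‖ ≤ C) (v : EuclideanSpace ℝ (UpperTri k)) (z : Fin k → ℝ) :
    |inner ℝ v (normFeature γ θ z) - inner ℝ v (normFeature γ θ₀ z)| ≤
      C ^ 2 * ‖θ - θ₀‖ * ‖v‖ := by
  have hC : 0 ≤ C := (norm_nonneg _).trans (hy z)
  rw [inner_normFeature_sub_eq hγ hθ hθ₀, abs_neg, abs_mul]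
  calc _ ≤ (‖θ - θ₀‖ * C) * (‖v‖ * C) := mul_le_mul (abs_inner_normFeature_le hy₀ _ z)
        (abs_inner_normFeature_le hy _ z) (abs_nonneg _) (by positivity)
    _ = _ := by ring

/-- Strong monotonicity of the gradient around the true parameter. -/
lemma exists_strong_monotonicity (hγ : 0 < γ) (hθ₀ : θ₀ ∈ posDefParams k) :
    ∃ c > 0, ∃ s > 0, ∃ r > 0, Metric.closedBall θ₀ r ⊆ posDefParams k ∧
      ∀ (n : ℕ) (x : Fin n → Fin k → ℝ),
        (∀ p q, |momentDeviation γ (multivariateT γ (symMat θ₀)) θ₀ x p q| ≤ n * s) →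
        ∀ θ ∈ Metric.closedBall θ₀ r, n * c * ‖θ - θ₀‖ ^ 2 ≤
          fderiv ℝ (tNLL γ n x) θ (θ - θ₀) - fderiv ℝ (tNLL γ n x) θ₀ (θ - θ₀) := by
  have hμ := isProbabilityMeasure_multivariateT hγ hθ₀
  obtain ⟨C, hC, r₀, hr₀, hball, -, hb⟩ := exists_local_bound hθ₀
  obtain ⟨c, hc, hinfo⟩ := exists_information_lower_bound hγ hθ₀
  set a : ℝ := (γ + k) / 2 with ha
  have ha0 : 0 < a := by positivity
  have hder := (hasFDerivAt_fderiv_logDet hθ₀).isLittleO.def hc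
  obtain ⟨r₁, hr₁, hder⟩ := Metric.eventually_nhds_iff_ball.1 hder
  set d : ℝ := (Fintype.card (UpperTri k) : ℝ) ^ 2 with hd
  -- Of the information `c ‖v‖²` per observation, one half is spent on the Taylor remainder of `D
  -- log det`, an eighth on the fluctuation of the second moments and an eighth on the cubic
  -- remainder; a quarter is left. The `d + 1` avoids a zero denominator when there are no
  -- coordinates.
  refine ⟨c / 4, by positivity, c / (8 * (a * (d + 1))), by positivity,
    min (min r₀ (r₁ / 2)) (c / (8 * (a * C ^ 3))), by positivity,
    fun θ hθ => hball (Metric.closedBall_subset_closedBall ((min_le_left _ _).trans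
      (min_le_left _ _)) hθ), fun n x hS θ hθ => ?_⟩
  rw [Metric.mem_closedBall, dist_eq_norm] at hθ
  set v := θ - θ₀ with hv
  have hθr₀ : θ ∈ Metric.closedBall θ₀ r₀ := by
    rw [Metric.mem_closedBall, dist_eq_norm]
    exact hθ.trans ((min_le_left _ _).trans (min_le_left _ _))
  have hθΘ := hball hθr₀
  have hy := fun z => norm_normFeature_le hγ hθΘ hC.le (hb θ hθr₀ z)
  have hy₀ := fun z => norm_normFeature_le hγ hθ₀ hC.le
    (hb θ₀ (Metric.mem_closedBall_self hr₀.le) z)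
  have hv3 : a * C ^ 3 * ‖v‖ ≤ c / 8 := by
    have : ‖v‖ ≤ c / (8 * (a * C ^ 3)) := hθ.trans (min_le_right _ _)
    rw [le_div_iff₀ (by positivity)] at this
    linarith
  have hpsi : fderiv ℝ logDet θ v - fderiv ℝ logDet θ₀ v - fderiv ℝ (fderiv ℝ logDet) θ₀ v v ≤
      c * ‖v‖ ^ 2 := by
    have h1 := hder θ (by
      rw [Metric.mem_ball, dist_eq_norm]
      have : ‖v‖ ≤ r₁ / 2 := hθ.trans ((min_le_left _ _).trans (min_le_right _ _))
      linarith)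
    have h2 := (ContinuousLinearMap.le_opNorm (fderiv ℝ logDet θ - fderiv ℝ logDet θ₀ -
      fderiv ℝ (fderiv ℝ logDet) θ₀ (θ - θ₀)) v).trans
      (mul_le_mul_of_nonneg_right h1 (norm_nonneg v))
    rw [Real.norm_eq_abs] at h2
    refine (le_abs_self _).trans (h2.trans (le_of_eq ?_))
    rw [← hv]; ring
  -- The increment equals `-⟪v, y_θ₀⟫ ⟪v, y_θ⟫`; replacing `y_θ` by `y_θ₀` turns it into minus a
  -- square at the cost of a term cubic in `v`.
  have hterm : ∀ i, -(inner ℝ v (normFeature γ θ₀ (x i)) ^ 2) - C ^ 3 * ‖v‖ * ‖v‖ ^ 2 ≤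
      inner ℝ v (normFeature γ θ (x i)) - inner ℝ v (normFeature γ θ₀ (x i)) := by
    intro i
    have h1 := inner_normFeature_sub_eq hγ hθΘ hθ₀ v (x i)
    have h2 := abs_inner_normFeature_sub_le hγ hθΘ hθ₀ hy hy₀ v (x i)
    have h3 := abs_inner_normFeature_le hy₀ v (x i)
    rw [← hv] at h1 h2
    have h4 : |inner ℝ v (normFeature γ θ₀ (x i)) *
        (inner ℝ v (normFeature γ θ (x i)) - inner ℝ v (normFeature γ θ₀ (x i)))| ≤
        (‖v‖ * C) * (C ^ 2 * ‖v‖ * ‖v‖) := by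
      rw [abs_mul]
      exact mul_le_mul h3 h2 (abs_nonneg _) (by positivity)
    have h5 := (le_abs_self _).trans h4
    nlinarith [h1, h5]
  have hsum : -(∑ i, inner ℝ v (normFeature γ θ₀ (x i)) ^ 2) - n * (C ^ 3 * ‖v‖ * ‖v‖ ^ 2) ≤
      ∑ i, inner ℝ v (normFeature γ θ (x i)) - ∑ i, inner ℝ v (normFeature γ θ₀ (x i)) := by
    have h1 := Finset.sum_le_sum fun i (_ : i ∈ Finset.univ) => hterm i
    rw [Finset.sum_sub_distrib, Finset.sum_sub_distrib, Finset.sum_neg_distrib] at h1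
    simpa using h1
  have hsq := sum_inner_normFeature_sq_sub hγ hC.le hθ₀ hy₀ (μ := multivariateT γ (symMat θ₀)) x v
  have hdev := (le_abs_self _).trans (abs_sum_sum_mul_le v hS)
  rw [← hsq, ← hd] at hdev
  have hs : a * (d * (‖v‖ ^ 2 * (n * (c / (8 * (a * (d + 1))))))) ≤ n * (c / 8) * ‖v‖ ^ 2 := by
    have hd0 : 0 ≤ d := by positivity
    have h1 : a * d * (c / (8 * (a * (d + 1)))) ≤ c / 8 := by
      rw [mul_div_assoc', div_le_div_iff₀ (by positivity) (by positivity)]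
      nlinarith [mul_pos ha0 hc]
    calc _ = n * (a * d * (c / (8 * (a * (d + 1))))) * ‖v‖ ^ 2 := by ring
      _ ≤ _ := by gcongr
  have hv3' : n * (a * C ^ 3 * ‖v‖ * ‖v‖ ^ 2) ≤ n * (c / 8 * ‖v‖ ^ 2) := by gcongr
  have hinf := mul_le_mul_of_nonneg_left (hinfo v) (Nat.cast_nonneg (α := ℝ) n)
  have hpsi' := mul_le_mul_of_nonneg_left hpsi (Nat.cast_nonneg (α := ℝ) n)
  have hsum' := mul_le_mul_of_nonneg_left hsum ha0.le
  have hdev' := mul_le_mul_of_nonneg_left hdev ha0.le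
  rw [fderiv_tNLL_eq_inner_normFeature hγ x hθΘ, fderiv_tNLL_eq_inner_normFeature hγ x hθ₀, ← ha]
  generalize (∑ i, inner ℝ v (normFeature γ θ (x i)) : ℝ) = s₁ at *
  generalize (∑ i, inner ℝ v (normFeature γ θ₀ (x i)) : ℝ) = s₂ at *
  generalize (∑ i, inner ℝ v (normFeature γ θ₀ (x i)) ^ 2 : ℝ) = s₃ at *
  nlinarith

/-- The Hessian is positive definite around the true parameter. -/
lemma exists_hessian_posDef (hγ : 0 < γ) (hθ₀ : θ₀ ∈ posDefParams k) :
    ∃ s > 0, ∃ r > 0, ∀ (n : ℕ) (x : Fin n → Fin k → ℝ), 1 ≤ n →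
        (∀ p q, |momentDeviation γ (multivariateT γ (symMat θ₀)) θ₀ x p q| ≤ n * s) →
        ∀ θ ∈ Metric.closedBall θ₀ r, (hessian (tNLL γ n x) θ).PosDef := by
  have hμ := isProbabilityMeasure_multivariateT hγ hθ₀
  obtain ⟨C, hC, r₀, hr₀, hball, -, hb⟩ := exists_local_bound hθ₀
  obtain ⟨c, hc, hinfo⟩ := exists_information_lower_bound hγ hθ₀
  set a : ℝ := (γ + k) / 2 with ha
  have ha0 : 0 < a := by positivity
  have hnear := eventually_abs_fderiv_fderiv_sub_le
    ((contDiffOn_logDet k).contDiffAt ((isOpen_posDefParams k).mem_nhds hθ₀)) (half_pos hc)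
  obtain ⟨r₁, hr₁, hder⟩ := Metric.eventually_nhds_iff_ball.1 hnear
  set d : ℝ := (Fintype.card (UpperTri k) : ℝ) ^ 2 with hd
  -- Here a quarter of the information is spent on the change of `D² log det`, an eighth on moving
  -- the features from `θ₀` to `θ` and an eighth on the fluctuation; half remains, and it is
  -- strictly positive because `n ≥ 1`.
  refine ⟨c / (8 * (a * (d + 1))), by positivity,
    min (min r₀ (r₁ / 2)) (c / (16 * (a * C ^ 3))), by positivity, fun n x hn hS θ hθ => ?_⟩
  have hn0 : (0 : ℝ) < n := by exact_mod_cast hn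
  rw [Metric.mem_closedBall, dist_eq_norm] at hθ
  have hθr₀ : θ ∈ Metric.closedBall θ₀ r₀ := by
    rw [Metric.mem_closedBall, dist_eq_norm]
    exact hθ.trans ((min_le_left _ _).trans (min_le_left _ _))
  have hθΘ := hball hθr₀
  have hy := fun z => norm_normFeature_le hγ hθΘ hC.le (hb θ hθr₀ z)
  have hy₀ := fun z => norm_normFeature_le hγ hθ₀ hC.le
    (hb θ₀ (Metric.mem_closedBall_self hr₀.le) z)
  refine Matrix.PosDef.of_dotProduct_mulVec_pos (hessian_tNLL_isHermitian hγ x hθΘ) fun u hu => ?_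
  set v : EuclideanSpace ℝ (UpperTri k) := WithLp.toLp 2 u with hv
  have hv0 : 0 < ‖v‖ := norm_pos_iff.2 fun h => hu (by
    have := congrArg WithLp.ofLp h
    simpa [hv] using this)
  have hquad := dotProduct_hessian_tNLL_mulVec hγ x hθΘ v
  rw [star_trivial]
  change 0 < v.ofLp ⬝ᵥ (hessian (tNLL γ n x) θ *ᵥ v.ofLp)
  rw [hquad]
  simp only [← div_pow, ← inner_normFeature]
  have hv3 : a * C ^ 3 * ‖θ - θ₀‖ ≤ c / 16 := by
    have : ‖θ - θ₀‖ ≤ c / (16 * (a * C ^ 3)) := hθ.trans (min_le_right _ _)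
    rw [le_div_iff₀ (by positivity)] at this
    linarith
  have hpsi : fderiv ℝ (fderiv ℝ logDet) θ v v - fderiv ℝ (fderiv ℝ logDet) θ₀ v v ≤
      c / 2 * ‖v‖ ^ 2 := by
    have h1 := hder θ (by
      rw [Metric.mem_ball, dist_eq_norm]
      have : ‖θ - θ₀‖ ≤ r₁ / 2 := hθ.trans ((min_le_left _ _).trans (min_le_right _ _))
      linarith) v
    exact (le_abs_self _).trans (h1.trans (le_of_eq (by ring)))
  have hterm : ∀ i, inner ℝ v (normFeature γ θ (x i)) ^ 2 ≤
      inner ℝ v (normFeature γ θ₀ (x i)) ^ 2 + 2 * C ^ 3 * ‖θ - θ₀‖ * ‖v‖ ^ 2 := by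
    intro i
    have h2 := abs_inner_normFeature_sub_le hγ hθΘ hθ₀ hy hy₀ v (x i)
    have h3 := abs_inner_normFeature_le hy₀ v (x i)
    have h3' := abs_inner_normFeature_le hy v (x i)
    have h4 : |(inner ℝ v (normFeature γ θ (x i)) + inner ℝ v (normFeature γ θ₀ (x i))) *
        (inner ℝ v (normFeature γ θ (x i)) - inner ℝ v (normFeature γ θ₀ (x i)))| ≤
        (2 * (‖v‖ * C)) * (C ^ 2 * ‖θ - θ₀‖ * ‖v‖) := by
      rw [abs_mul]
      refine mul_le_mul ?_ h2 (abs_nonneg _) (by positivity)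
      linarith [abs_add_le (inner ℝ v (normFeature γ θ (x i)))
        (inner ℝ v (normFeature γ θ₀ (x i)))]
    have h5 := (le_abs_self _).trans h4
    linarith [h5]
  have hsum : ∑ i, inner ℝ v (normFeature γ θ (x i)) ^ 2 ≤
      ∑ i, inner ℝ v (normFeature γ θ₀ (x i)) ^ 2 + n * (2 * C ^ 3 * ‖θ - θ₀‖ * ‖v‖ ^ 2) := by
    have h1 := Finset.sum_le_sum fun i (_ : i ∈ Finset.univ) => hterm i
    rw [Finset.sum_add_distrib] at h1
    simpa using h1
  have hsq := sum_inner_normFeature_sq_sub hγ hC.le hθ₀ hy₀ (μ := multivariateT γ (symMat θ₀)) x v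
  have hdev := (le_abs_self _).trans (abs_sum_sum_mul_le v hS)
  rw [← hsq, ← hd] at hdev
  have hs : a * (d * (‖v‖ ^ 2 * (n * (c / (8 * (a * (d + 1))))))) ≤ n * (c / 8) * ‖v‖ ^ 2 := by
    have hd0 : 0 ≤ d := by positivity
    have h1 : a * d * (c / (8 * (a * (d + 1)))) ≤ c / 8 := by
      rw [mul_div_assoc', div_le_div_iff₀ (by positivity) (by positivity)]
      nlinarith [mul_pos ha0 hc]
    calc _ = n * (a * d * (c / (8 * (a * (d + 1))))) * ‖v‖ ^ 2 := by ring
      _ ≤ _ := by gcongr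
  have hv3' : n * (a * C ^ 3 * ‖θ - θ₀‖ * ‖v‖ ^ 2) ≤ n * (c / 16 * ‖v‖ ^ 2) := by gcongr
  have hinf := mul_le_mul_of_nonneg_left (hinfo v) (Nat.cast_nonneg (α := ℝ) n)
  have hpsi' := mul_le_mul_of_nonneg_left hpsi (Nat.cast_nonneg (α := ℝ) n)
  have hsum' := mul_le_mul_of_nonneg_left hsum ha0.le
  have hdev' := mul_le_mul_of_nonneg_left hdev ha0.le
  have hpos : 0 < n * c * ‖v‖ ^ 2 := by positivity
  rw [← ha]
  generalize (∑ i, inner ℝ v (normFeature γ θ (x i)) ^ 2 : ℝ) = s₁ at *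
  generalize (∑ i, inner ℝ v (normFeature γ θ₀ (x i)) ^ 2 : ℝ) = s₃ at *
  nlinarith

lemma measure_scoreDeviation_le (hγ : 0 < γ) (hC : 0 < C) (hθ₀ : θ₀ ∈ posDefParams k)
    (hy : ∀ z, ‖normFeature γ θ₀ z‖ ≤ C) (hn : 1 ≤ n) (p : ℕ)
    {A : ℝ} (hA : 0 ≤ A) (hAp : 2 * p * C ^ 2 ≤ A ^ 2) :
    sampleLaw γ n θ₀ {x | ∃ i, A * √(n * Real.log n) <
        |scoreDeviation γ (multivariateT γ (symMat θ₀)) θ₀ x i|} ≤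
      ENNReal.ofReal (Fintype.card (UpperTri k) * (2 * ((n : ℝ) ^ p)⁻¹)) := by
  have hμ := isProbabilityMeasure_multivariateT hγ hθ₀
  have h1 : ∀ i : UpperTri k, sampleLaw γ n θ₀ {x | A * √(n * Real.log n) <
        |scoreDeviation γ (multivariateT γ (symMat θ₀)) θ₀ x i|} ≤
      ENNReal.ofReal (2 * ((n : ℝ) ^ p)⁻¹) := fun i =>
    hoeffding_pi hn (measurable_normFeature_apply hγ hθ₀ i) hC
      (fun z => (abs_apply_le_norm _ i).trans (hy z)) p hA hAp
  simp only [Set.ofPred_exists]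
  calc _ ≤ ∑ i : UpperTri k, ENNReal.ofReal (2 * ((n : ℝ) ^ p)⁻¹) :=
        (measure_iUnion_fintype_le _ _).trans (Finset.sum_le_sum fun i _ => h1 i)
    _ = _ := by
        rw [ENNReal.ofReal_mul (by positivity : (0 : ℝ) ≤ Fintype.card (UpperTri k)),
          ENNReal.ofReal_natCast]
        simp only [Finset.sum_const, Finset.card_univ, nsmul_eq_mul]

end Local

/-! ### The perturbation -/

section Noise

variable {ι : Type*} [Fintype ι]

instance isProbabilityMeasure_noise : IsProbabilityMeasure (noise ι) :=
  Measure.isProbabilityMeasure_map (PiLp.continuous_toLp 2 _).measurable.aemeasurable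

/-- Each coordinate has variance `1/d ≤ 1`, so the parameter 1 serves in every dimension. -/
lemma hasSubgaussianMGF_noise [Nonempty ι] (p : ι) :
    HasSubgaussianMGF (fun w : EuclideanSpace ℝ ι => w p) 1 (noise ι) := by
  have hm : Measurable fun w : EuclideanSpace ℝ ι => w p :=
    (EuclideanSpace.proj (𝕜 := ℝ) p).continuous.measurable
  have hmap : (noise ι).map (fun w : EuclideanSpace ℝ ι => w p) =
      gaussianReal 0 ((Fintype.card ι : ℝ≥0)⁻¹) := by
    rw [noise, Measure.map_map hm (PiLp.continuous_toLp 2 _).measurable]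
    exact (measurePreserving_eval
      (fun _ : ι => gaussianReal 0 ((Fintype.card ι : ℝ≥0)⁻¹)) p).map_eq
  rw [← HasSubgaussianMGF.id_map_iff hm.aemeasurable, hmap]
  refine ⟨fun t => integrable_exp_mul_gaussianReal t, fun t => ?_⟩
  rw [mgf_id_gaussianReal]
  refine Real.exp_le_exp.2 ?_
  have h1 : ((Fintype.card ι : ℝ≥0)⁻¹ : ℝ≥0) ≤ 1 :=
    inv_le_one_of_one_le₀ (by exact_mod_cast Fintype.card_pos (α := ι))
  have h2 : (((Fintype.card ι : ℝ≥0)⁻¹ : ℝ≥0) : ℝ) ≤ (1 : ℝ≥0) := by exact_mod_cast h1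
  rw [zero_mul, zero_add]
  gcongr

lemma measure_noise_le [Nonempty ι] {n : ℕ} (hn : 1 ≤ n) :
    noise ι {w | ∃ p, 2 * √(Real.log n) < |w p|} ≤
      ENNReal.ofReal (Fintype.card ι * (2 * (n : ℝ)⁻¹)) := by
  have hn0 : (0 : ℝ) < n := by exact_mod_cast hn
  have h1 : ∀ p : ι, noise ι {w | 2 * √(Real.log n) < |w p|} ≤
      ENNReal.ofReal (2 * (n : ℝ)⁻¹) := by
    intro p
    -- Multiplication by `√n` gives a variable with parameter `n`, to which the tail bound designed
    -- for sums of `n` terms applies.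
    have h := HasSubgaussianMGF.mono ((hasSubgaussianMGF_noise p).const_mul (√n))
      (c' := n * 1 ^ 2) (by
        rw [← NNReal.coe_le_coe]
        change √(n : ℝ) ^ 2 * 1 ≤ n * 1 ^ 2
        rw [Real.sq_sqrt hn0.le, one_pow])
    have h2 := measure_lt_abs_le_of_hasSubgaussianMGF hn h one_pos 1 (A := 2) (by norm_num)
      (by norm_num)
    rw [pow_one] at h2
    refine (measure_mono fun w hw => ?_).trans h2
    simp only [Set.mem_ofPred_eq] at hw ⊢
    rw [Real.sqrt_mul hn0.le, abs_mul, abs_of_nonneg (Real.sqrt_nonneg _)]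
    calc _ = √n * (2 * √(Real.log n)) := by ring
      _ < _ := mul_lt_mul_of_pos_left hw (Real.sqrt_pos.2 hn0)
  simp only [Set.ofPred_exists]
  calc _ ≤ ∑ i : ι, ENNReal.ofReal (2 * (n : ℝ)⁻¹) :=
        (measure_iUnion_fintype_le _ _).trans (Finset.sum_le_sum fun i _ => h1 i)
    _ = _ := by
        rw [ENNReal.ofReal_mul (by positivity : (0 : ℝ) ≤ Fintype.card ι), ENNReal.ofReal_natCast]
        simp only [Finset.sum_const, Finset.card_univ, nsmul_eq_mul]

end Noise

/-! ### The estimator condition -/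

/-- From an interior point one can step against the gradient as far as the distance to the sphere
allows; the variational inequality along that step forces the gradient to vanish. -/
lemma IsConstrainedFOSP.gradient_eq_zero {ι : Type*} [Fintype ι] {g : EuclideanSpace ℝ ι → ℝ}
    {m θ : EuclideanSpace ℝ ι} {ρ : ℝ} (h : IsConstrainedFOSP g (Metric.closedBall m ρ) θ)
    (hθ : ‖θ - m‖ < ρ) : gradient g θ = 0 := by
  set u := gradient g θ with hu
  by_contra hne
  have hu0 : 0 < ‖u‖ := norm_pos_iff.2 hne
  set t := (ρ - ‖θ - m‖) / ‖u‖ with ht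
  have ht0 : 0 < t := div_pos (by linarith) hu0
  have h1 := h.2 (θ - t • u) (by
    rw [Metric.mem_closedBall, dist_eq_norm, sub_right_comm]
    refine (norm_sub_le _ _).trans ?_
    rw [norm_smul, Real.norm_of_nonneg ht0.le, ht, div_mul_cancel₀ _ hu0.ne']
    linarith)
  rw [← hu, sub_sub_cancel_left, inner_neg_right, inner_smul_right,
    real_inner_self_eq_norm_sq] at h1
  have : 0 < t * ‖u‖ ^ 2 := by positivity
  linarith

section Estimator

variable {k : ℕ} {γ : ℝ} {θ₀ : EuclideanSpace ℝ (UpperTri k)}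

/-- If the scores, the moments, the perturbation and the initial estimator are close to what they
estimate, a local estimator is close to the true parameter and a strict second-order stationary
point. -/
lemma exists_isSSOSP_of_deviations_le (hγ : 0 < γ) (hθ₀ : θ₀ ∈ posDefParams k)
    {σ ρ : ℕ → ℝ} (hσ_pos : ∀ n, 0 < σ n) (hσ : σ =O[atTop] fun n : ℕ => √(n : ℝ))
    (hρ_pos : ∀ n, 0 < ρ n) (hρ_zero : Tendsto ρ atTop (𝓝 0))
    (hρ : (fun n : ℕ => √(Real.log n / n)) =o[atTop] ρ) {C A₁ A₂ A₃ : ℝ}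
    (hy₀ : ∀ z, ‖normFeature γ θ₀ z‖ ≤ C) (hA₁ : 0 ≤ A₁) (hA₃ : 0 < A₃) :
    ∃ R > 0, ∀ᶠ n : ℕ in atTop, ∀ (x : Fin n → Fin k → ℝ) (w : EuclideanSpace ℝ (UpperTri k))
      (θhat : (Fin n → Fin k → ℝ) → EuclideanSpace ℝ (UpperTri k) →
        EuclideanSpace ℝ (UpperTri k)),
      (∀ p, |scoreDeviation γ (multivariateT γ (symMat θ₀)) θ₀ x p| ≤ A₁ * √(n * Real.log n)) →
      (∀ p q, |momentDeviation γ (multivariateT γ (symMat θ₀)) θ₀ x p q| ≤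
        A₂ * √(n * Real.log n)) →
      ‖initEst γ x - θ₀‖ ≤ A₃ * √(Real.log n / n) → (∀ p, |w p| ≤ 2 * √(Real.log n)) →
      IsLocalEstimator γ n (σ n) (ρ n) θhat →
      ‖θhat x w - θ₀‖ ≤ R * √(Real.log n / n) ∧
        IsSSOSP (perturbedNLL (sampleDensity γ n) (fun _ => 0) (σ n) x w) (θhat x w) := by
  obtain ⟨c, hc, s₁, hs₁, r₁, hr₁, hball, hmono⟩ := exists_strong_monotonicity hγ hθ₀
  obtain ⟨s₂, hs₂, r₂, hr₂, hposdef⟩ := exists_hessian_posDef hγ hθ₀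
  obtain ⟨Kσ, hKσ, hσ⟩ := hσ.exists_pos
  set a : ℝ := (γ + k) / 2 with ha
  have ha0 : 0 < a := by positivity
  set d : ℝ := (Fintype.card (UpperTri k) : ℝ) with hd
  have hd0 : 0 ≤ d := by positivity
  set R : ℝ := (2 * Kσ * d + a * d * A₁) / c + 1 with hR
  have hR0 : 0 < R := by positivity
  have hsmall : Tendsto (fun n : ℕ => A₂ * √(Real.log n / n)) atTop (𝓝 0) := by
    simpa using tendsto_sqrt_log_div.const_mul A₂
  have hrad : Tendsto (fun n : ℕ => ρ n + A₃ * √(Real.log n / n)) atTop (𝓝 0) := by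
    simpa using hρ_zero.add (tendsto_sqrt_log_div.const_mul A₃)
  -- With this constant the final error plus the initial error, `(R + A₃) √(log n / n)`, is at most
  -- `ρ n / 2`. Hence `θ₀` lies in the ball and the estimate will lie in its interior.
  have hlittle := hρ.def (c := 1 / (2 * (R + A₃))) (by positivity)
  refine ⟨R, hR0, ?_⟩
  filter_upwards [hsmall.eventually_le_const hs₁, hsmall.eventually_le_const hs₂,
    hrad.eventually_le_const (lt_min hr₁ hr₂), hlittle, hσ.bound, eventually_ge_atTop 1]
    with n hn₁ hn₂ hnr hnρ hnσ hn1 x w θhat hG hS hinit hw hest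
  have hn0 : (0 : ℝ) < n := by exact_mod_cast hn1
  have hlog : 0 ≤ Real.log n := Real.log_nonneg (by exact_mod_cast hn1)
  have hsqrt : √(n : ℝ) * √(Real.log n) = n * √(Real.log n / n) := by
    rw [← Real.sqrt_mul hn0.le, sqrt_mul_log_eq hn1]
  rw [sqrt_mul_log_eq hn1] at hG hS
  set L := √(Real.log n / n) with hL
  have hL0 : 0 ≤ L := Real.sqrt_nonneg _
  rw [Real.norm_of_nonneg hL0, Real.norm_of_nonneg (hρ_pos n).le] at hnρ
  rw [Real.norm_of_nonneg (hσ_pos n).le, Real.norm_of_nonneg (Real.sqrt_nonneg _)] at hnσ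
  have hRL : (R + A₃) * L < ρ n := by
    have h1 : (R + A₃) * L ≤ (R + A₃) * (1 / (2 * (R + A₃)) * ρ n) := by gcongr
    have h2 : (R + A₃) * (1 / (2 * (R + A₃)) * ρ n) = ρ n / 2 := by field_simp
    linarith [hρ_pos n]
  have hsub : ∀ θ ∈ Metric.closedBall (initEst γ x) (ρ n), ‖θ - θ₀‖ ≤ min r₁ r₂ := by
    intro θ hθ
    rw [Metric.mem_closedBall, dist_eq_norm] at hθ
    calc ‖θ - θ₀‖ = ‖(θ - initEst γ x) + (initEst γ x - θ₀)‖ := by rw [sub_add_sub_cancel]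
      _ ≤ ρ n + A₃ * L := (norm_add_le _ _).trans (add_le_add hθ hinit)
      _ ≤ _ := hnr
  have hsub₁ : ∀ θ ∈ Metric.closedBall (initEst γ x) (ρ n), θ ∈ Metric.closedBall θ₀ r₁ :=
    fun θ hθ => by
      rw [Metric.mem_closedBall, dist_eq_norm]
      exact (hsub θ hθ).trans (min_le_left _ _)
  have hfosp := (hest x w).2 fun θ hθ => hball (hsub₁ θ hθ)
  set θ := θhat x w
  have hθr := hsub θ hfosp.1
  have hθΘ : θ ∈ posDefParams k := (hest x w).1
  have hθ₀mem : θ₀ ∈ Metric.closedBall (initEst γ x) (ρ n) := by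
    rw [Metric.mem_closedBall, dist_eq_norm, norm_sub_rev]
    have : 0 ≤ R * L := by positivity
    linarith
  set v := θ - θ₀ with hv
  -- Testing at `θ₀` shows that the derivative of the objective at `θ` along `v` is nonpositive.
  -- Combined with strong monotonicity, `n c ‖v‖²` is bounded by terms linear in `v`: the score at
  -- `θ₀` and the perturbation, both of order `√(n log n) ‖v‖`.
  have h1 := hfosp.2 θ₀ hθ₀mem
  rw [← neg_sub, inner_neg_right, inner_gradient_perturbedNLL hγ (σ n) x w hθΘ, ← hv] at h1
  have h2 := hmono n x (fun p q => (hS p q).trans (by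
    calc A₂ * (n * L) = n * (A₂ * L) := by ring
      _ ≤ n * s₁ := by gcongr)) θ (hsub₁ θ hfosp.1)
  rw [← hv] at h2
  have h3 := neg_le_of_abs_le (abs_fderiv_tNLL_le hγ hθ₀ hy₀ x hG v)
  have h4 : |inner ℝ w v| ≤ d * (‖v‖ * (2 * √(Real.log n))) := by
    rw [real_inner_comm, inner_eq_sum_mul]
    exact abs_sum_mul_le v hw
  have h5 : σ n * |inner ℝ w v| ≤ 2 * Kσ * d * (‖v‖ * (n * L)) := by
    calc _ ≤ (Kσ * √n) * (d * (‖v‖ * (2 * √(Real.log n)))) :=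
          mul_le_mul hnσ h4 (abs_nonneg _) (by positivity)
      _ = 2 * Kσ * d * (‖v‖ * (√n * √(Real.log n))) := by ring
      _ = _ := by rw [hsqrt]
  have h6 : -(σ n * inner ℝ w v) ≤ σ n * |inner ℝ w v| := by
    rw [← mul_neg]
    exact mul_le_mul_of_nonneg_left (neg_le_abs _) (hσ_pos n).le
  have hkey : n * (c * ‖v‖ ^ 2) ≤ n * ((2 * Kσ * d + a * d * A₁) * L * ‖v‖) := by
    rw [← ha, ← hd] at h3
    linarith
  have hvR : ‖v‖ ≤ R * L := by
    rcases (norm_nonneg v).eq_or_lt with h0 | h0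
    · rw [← h0]; positivity
    · have h7 := le_of_mul_le_mul_left hkey hn0
      have h8 : c * ‖v‖ ≤ (2 * Kσ * d + a * d * A₁) * L :=
        le_of_mul_le_mul_right (by linarith) h0
      have h9 : ‖v‖ ≤ (2 * Kσ * d + a * d * A₁) / c * L := by
        rw [div_mul_eq_mul_div, le_div_iff₀ hc]
        linarith
      rw [hR]
      linarith
  refine ⟨hvR, hfosp.gradient_eq_zero ?_, ?_⟩
  · calc ‖θ - initEst γ x‖ = ‖v - (initEst γ x - θ₀)‖ := by rw [hv, sub_sub_sub_cancel_right]
      _ ≤ R * L + A₃ * L := (norm_sub_le _ _).trans (add_le_add hvR hinit)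
      _ < _ := by linarith
  · rw [hessian_perturbedNLL hγ (σ n) x w hθΘ]
    refine hposdef n x hn1 (fun p q => (hS p q).trans ?_) θ ?_
    · calc A₂ * (n * L) = n * (A₂ * L) := by ring
        _ ≤ n * s₂ := by gcongr
    · rw [Metric.mem_closedBall, dist_eq_norm]
      exact hθr.trans (min_le_right _ _)

/-- The estimator condition at `θ₀`, for large samples. -/
lemma exists_estimator_error (hk : 1 ≤ k) (hγ : 0 < γ) (hθ₀ : θ₀ ∈ posDefParams k)
    {σ ρ : ℕ → ℝ} (hσ_pos : ∀ n, 0 < σ n) (hσ : σ =O[atTop] fun n : ℕ => √(n : ℝ))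
    (hρ_pos : ∀ n, 0 < ρ n) (hρ_zero : Tendsto ρ atTop (𝓝 0))
    (hρ : (fun n : ℕ => √(Real.log n / n)) =o[atTop] ρ) :
    ∃ R > 0, ∃ K ≥ 0, ∀ᶠ n : ℕ in atTop, ∀ θhat : (Fin n → Fin k → ℝ) →
        EuclideanSpace ℝ (UpperTri k) → EuclideanSpace ℝ (UpperTri k),
      IsLocalEstimator γ n (σ n) (ρ n) θhat →
      ((sampleLaw γ n θ₀).prod (noise (UpperTri k)))
        {q | ¬ (‖θhat q.1 q.2 - θ₀‖ ≤ R * √(Real.log n / n) ∧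
          IsSSOSP (perturbedNLL (sampleDensity γ n) (fun _ => 0) (σ n) q.1 q.2)
            (θhat q.1 q.2))} ≤ ENNReal.ofReal (K * (n : ℝ)⁻¹) := by
  have : Nonempty (UpperTri k) := ⟨⟨(⟨0, hk⟩, ⟨0, hk⟩), le_rfl⟩⟩
  obtain ⟨C, hC, r₀, hr₀, -, -, hb⟩ := exists_local_bound hθ₀
  have hb₀ := hb θ₀ (Metric.mem_closedBall_self hr₀.le)
  have hy₀ := fun z => norm_normFeature_le hγ hθ₀ hC.le (hb₀ z)
  obtain ⟨A₃, hA₃, K₃, hK₃, hinit⟩ := initEst_concentration hγ hθ₀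
  -- The constants `2C` and `2C²` are enough for tails of order `n⁻¹`, since `2 B² ≤ (2B)²` for
  -- summands bounded by `B`.
  set A₁ : ℝ := 2 * C with hA₁
  set A₂ : ℝ := 2 * C ^ 2 with hA₂
  obtain ⟨R, hR, hgood⟩ := exists_isSSOSP_of_deviations_le hγ hθ₀ hσ_pos hσ hρ_pos hρ_zero hρ
    (A₁ := A₁) (A₂ := A₂) hy₀ (by positivity) hA₃
  set d : ℝ := (Fintype.card (UpperTri k) : ℝ) with hd
  refine ⟨R, hR, d * 2 + d ^ 2 * 2 + K₃ + d * 2, by positivity, ?_⟩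
  filter_upwards [hgood, hinit, eventually_ge_atTop 1] with n hgood hinit hn1 θhat hest
  have hP := isProbabilityMeasure_sampleLaw hγ n hθ₀
  have h₁ := measure_scoreDeviation_le hγ hC hθ₀ hy₀ hn1 1 (A := A₁) (by positivity)
    (by rw [hA₁, Nat.cast_one]; nlinarith [sq_nonneg C])
  have h₂ := measure_momentDeviation_le hγ hC hθ₀ hb₀ hn1 1 (A := A₂) (by positivity)
    (by rw [hA₂, Nat.cast_one]; nlinarith [sq_nonneg (C ^ 2)])
  have h₄ := measure_noise_le (ι := UpperTri k) hn1
  rw [pow_one, ← hd] at h₁ h₂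
  rw [← hd] at h₄
  set B₁ := {x : Fin n → Fin k → ℝ | ∃ i, A₁ * √(n * Real.log n) <
    |scoreDeviation γ (multivariateT γ (symMat θ₀)) θ₀ x i|}
  set B₂ := {x : Fin n → Fin k → ℝ | ∃ i j, A₂ * √(n * Real.log n) <
    |momentDeviation γ (multivariateT γ (symMat θ₀)) θ₀ x i j|}
  set B₃ := {x : Fin n → Fin k → ℝ | A₃ * √(Real.log n / n) < ‖initEst γ x - θ₀‖}
  set B₄ := {w : EuclideanSpace ℝ (UpperTri k) | ∃ p, 2 * √(Real.log n) < |w p|}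
  -- The covering set does not involve `θhat`, so one bound holds for all local estimators, and the
  -- outer measure is controlled without any measurability of `θhat`.
  have hincl : {q : (Fin n → Fin k → ℝ) × EuclideanSpace ℝ (UpperTri k) |
      ¬ (‖θhat q.1 q.2 - θ₀‖ ≤ R * √(Real.log n / n) ∧
        IsSSOSP (perturbedNLL (sampleDensity γ n) (fun _ => 0) (σ n) q.1 q.2)
          (θhat q.1 q.2))} ⊆ (B₁ ∪ B₂ ∪ B₃) ×ˢ Set.univ ∪ Set.univ ×ˢ B₄ := by
    rintro ⟨x, w⟩ hq
    by_contra hcon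
    simp only [Set.mem_union, Set.mem_prod, Set.mem_univ, and_true, true_and, not_or] at hcon
    obtain ⟨⟨⟨c₁, c₂⟩, c₃⟩, c₄⟩ := hcon
    simp only [B₁, B₂, B₃, B₄, Set.mem_ofPred_eq, not_exists, not_lt] at c₁ c₂ c₃ c₄
    exact hq (hgood x w θhat c₁ c₂ c₃ c₄ hest)
  refine (measure_mono hincl).trans ((measure_union_le _ _).trans ?_)
  rw [Measure.prod_prod, Measure.prod_prod, measure_univ, measure_univ, mul_one, one_mul]
  have hx : sampleLaw γ n θ₀ (B₁ ∪ B₂ ∪ B₃) ≤ ENNReal.ofReal (d * (2 * (n : ℝ)⁻¹)) +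
      ENNReal.ofReal (d ^ 2 * (2 * (n : ℝ)⁻¹)) + ENNReal.ofReal (K₃ * (n : ℝ)⁻¹) :=
    (measure_union_le _ _).trans (add_le_add ((measure_union_le _ _).trans (add_le_add h₁ h₂)) hinit)
  refine (add_le_add hx h₄).trans (le_of_eq ?_)
  rw [← ENNReal.ofReal_add (by positivity) (by positivity),
    ← ENNReal.ofReal_add (by positivity) (by positivity),
    ← ENNReal.ofReal_add (by positivity) (by positivity)]
  congr 1
  ring

/-- The rates and error bounds at a single parameter. -/
lemma exists_rates (hk : 1 ≤ k) (hγ : 0 < γ) (hθ₀ : θ₀ ∈ posDefParams k)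
    {σ ρ : ℕ → ℝ} (hσ_pos : ∀ n, 0 < σ n) (hσ : σ =O[atTop] fun n : ℕ => √(n : ℝ))
    (hρ_pos : ∀ n, 0 < ρ n) (hρ_zero : Tendsto ρ atTop (𝓝 0))
    (hρ : (fun n : ℕ => √(Real.log n / n)) =o[atTop] ρ) :
    ∃ r δ ε : ℕ → ℝ, ((∀ n, 0 < r n ∧ 0 ≤ δ n ∧ 0 ≤ ε n) ∧
        IsSoftO r (fun n => (n : ℝ) ^ (-(1 / 2) : ℝ)) ∧
        δ =O[atTop] (fun n : ℕ => (n : ℝ)⁻¹) ∧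
        IsSoftO ε (fun n => (n : ℝ) ^ (-(1 / 2) : ℝ))) ∧
      ∀ n, (∀ θhat : (Fin n → Fin k → ℝ) →
          EuclideanSpace ℝ (UpperTri k) → EuclideanSpace ℝ (UpperTri k),
        IsLocalEstimator γ n (σ n) (ρ n) θhat →
        ((sampleLaw γ n θ₀).prod (noise (UpperTri k)))
          {q | ¬ (‖θhat q.1 q.2 - θ₀‖ ≤ r n ∧
            IsSSOSP (perturbedNLL (sampleDensity γ n) (fun _ => 0) (σ n) q.1 q.2)
              (θhat q.1 q.2))} ≤ ENNReal.ofReal (δ n)) ∧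
        (∀ θ ∈ Metric.closedBall θ₀ (r n) ∩ posDefParams k, ∀ i j,
          Integrable (fun x => obsInfo (sampleDensity γ n) θ x i j) (sampleLaw γ n θ₀)) ∧
        ∫⁻ x, supDeviation (posDefParams k) θ₀ (r n)
          (fun θ => expInfo (sampleLaw γ n θ₀) (sampleDensity γ n) θ -
            obsInfo (sampleDensity γ n) θ x) ∂(sampleLaw γ n θ₀) ≤ ENNReal.ofReal (ε n) ∧
        ∫⁻ x, EReal.exp (supDeviation (posDefParams k) θ₀ (r n)
          (fun θ => obsInfo (sampleDensity γ n) θ x -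
            expInfo (sampleLaw γ n θ₀) (sampleDensity γ n) θ)) ∂(sampleLaw γ n θ₀) ≤
          ENNReal.ofReal (Real.exp (ε n)) := by
  obtain ⟨C, hC, r₀, hr₀, -, -, hb⟩ := exists_local_bound hθ₀
  obtain ⟨R, hR, K, hK, hest⟩ :=
    exists_estimator_error hk hγ hθ₀ hσ_pos hσ hρ_pos hρ_zero hρ
  have hRL : Tendsto (fun n : ℕ => R * √(Real.log n / n)) atTop (𝓝 0) := by
    simpa using tendsto_sqrt_log_div.const_mul R
  obtain ⟨N, hN⟩ := eventually_atTop.1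
    ((hest.and (hRL.eventually_le_const hr₀)).and (eventually_ge_atTop 2))
  -- Below the threshold `N` the asymptotic estimates say nothing: the radius is the fixed `r₀`, and
  -- `δ = 1` makes the estimator condition trivial. Since `N ≥ 2`, the logarithm is positive from
  -- `N` on and so is the radius.
  set r : ℕ → ℝ := fun n => if N ≤ n then R * √(Real.log n / n) else r₀ with hr
  have hrN : ∀ {n}, N ≤ n → r n = R * √(Real.log n / n) := fun h => if_pos h
  have hr' : ∀ᶠ n : ℕ in atTop, r n = R * √(Real.log n / n) := by
    filter_upwards [eventually_ge_atTop N] with n hn using hrN hn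
  have hrpos : ∀ n, 0 < r n := by
    intro n
    by_cases h : N ≤ n
    · rw [hrN h]
      have h2 : (1 : ℝ) < n := by exact_mod_cast (hN n h).2
      have := Real.log_pos h2
      positivity
    · simpa [hr, h] using hr₀
  have hrle : ∀ n, r n ≤ r₀ := by
    intro n
    by_cases h : N ≤ n
    · rw [hrN h]
      exact (hN n h).1.2
    · simp [hr, h]
  obtain ⟨ε, hε0, hεO, hε⟩ := exists_hessian_error hγ hθ₀ hC hb hrpos hrle hR hr'
  refine ⟨r, fun n => if N ≤ n then K * (n : ℝ)⁻¹ else 1, ε,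
    ⟨fun n => ⟨hrpos n, ?_, hε0 n⟩, ⟨1, ?_⟩, ?_, hεO⟩, fun n => ⟨fun θhat hθhat => ?_, hε n⟩⟩
  · dsimp only
    split_ifs <;> positivity
  · refine IsBigO.of_bound R ?_
    filter_upwards [hr', eventually_ge_atTop 1,
      (Real.tendsto_log_atTop.comp tendsto_natCast_atTop_atTop).eventually_ge_atTop 1]
      with n hn hn1 hl
    have hl' : 1 ≤ Real.log n := hl
    have hn0 : (0 : ℝ) < n := by exact_mod_cast hn1
    rw [hn, Real.norm_of_nonneg (by positivity), Real.norm_of_nonneg (by positivity), pow_one,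
      Real.rpow_neg hn0.le, ← Real.sqrt_eq_rpow, Real.sqrt_div (by linarith)]
    have : √(Real.log n) ≤ Real.log n := by
      rw [Real.sqrt_le_left (by linarith)]; nlinarith
    calc R * (√(Real.log n) / √n) ≤ R * (Real.log n / √n) := by gcongr
      _ = _ := by ring
  · refine IsBigO.of_bound K ?_
    filter_upwards [eventually_ge_atTop N] with n hn
    rw [if_pos hn, norm_mul, Real.norm_of_nonneg hK]
  · by_cases h : N ≤ n
    · simp only [hrN h, if_pos h]
      exact (hN n h).1.1 θhat hθhat
    · have hP := isProbabilityMeasure_sampleLaw hγ n hθ₀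
      simp only [if_neg h, ENNReal.ofReal_one]
      exact prob_le_one

end Estimator

end ACSS

theorem mainTheorem7 (k : ℕ) (hk : 1 ≤ k) (γ : ℝ) (hγ : 0 < γ)
    (σ : ℕ → ℝ) (hσ_pos : ∀ n, 0 < σ n) (hσ : σ =O[atTop] fun n : ℕ => √(n : ℝ))
    (ρ : ℕ → ℝ) (hρ_pos : ∀ n, 0 < ρ n) (hρ_zero : Tendsto ρ atTop (𝓝 0))
    (hρ : (fun n : ℕ => √(Real.log n / n)) =o[atTop] ρ) :
    ∃ r δ ε : ℕ → EuclideanSpace ℝ (ACSS.UpperTri k) → ℝ,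
      (∀ θ₀ ∈ ACSS.posDefParams k,
        (∀ n, 0 < r n θ₀ ∧ 0 ≤ δ n θ₀ ∧ 0 ≤ ε n θ₀) ∧
        ACSS.IsSoftO (fun n => r n θ₀) (fun n => (n : ℝ) ^ (-(1 / 2) : ℝ)) ∧
        (fun n => δ n θ₀) =O[atTop] (fun n : ℕ => (n : ℝ)⁻¹) ∧
        ACSS.IsSoftO (fun n => ε n θ₀) (fun n => (n : ℝ) ^ (-(1 / 2) : ℝ))) ∧
      ∀ n : ℕ,
        ACSS.RegularityConditions volume (ACSS.posDefParams k) (ACSS.sampleLaw γ n)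
          (ACSS.sampleDensity γ n) (fun _ => 0) ∧
        (∀ θhat : (Fin n → Fin k → ℝ) → EuclideanSpace ℝ (ACSS.UpperTri k) →
              EuclideanSpace ℝ (ACSS.UpperTri k),
          ACSS.IsLocalEstimator γ n (σ n) (ρ n) θhat →
            ACSS.EstimatorCondition (ACSS.posDefParams k) (ACSS.sampleLaw γ n)
              (ACSS.sampleDensity γ n) (fun _ => 0) (σ n) θhat (r n) (δ n)) ∧
        ACSS.HessianCondition (ACSS.posDefParams k) (ACSS.sampleLaw γ n)
          (ACSS.sampleDensity γ n) (r n) (ε n) := by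
  -- The rates are chosen separately at each `θ₀`; the constants are not uniform over the parameter
  -- space.
  choose! r δ ε hrates hcond using fun θ₀ (hθ₀ : θ₀ ∈ ACSS.posDefParams k) =>
    ACSS.exists_rates hk hγ hθ₀ hσ_pos hσ hρ_pos hρ_zero hρ
  refine ⟨fun n θ₀ => r θ₀ n, fun n θ₀ => δ θ₀ n, fun n θ₀ => ε θ₀ n, hrates, fun n =>
    ⟨ACSS.regularityConditions hγ n, fun θhat hθhat θ₀ hθ₀ => (hcond θ₀ hθ₀ n).1 θhat hθhat,
      ⟨fun θ₀ hθ₀ => (hcond θ₀ hθ₀ n).2.1, fun θ₀ hθ₀ => (hcond θ₀ hθ₀ n).2.2.1,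
        fun θ₀ hθ₀ => (hcond θ₀ hθ₀ n).2.2.2⟩⟩⟩
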